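/- **Setting.** Let $N\in\mathbb N$ and let $(a,b)\subset\mathbb R$ be a non-empty, finite or infinite, open interval; $[a,b]$ denotes its closure in $\mathbb R$. Let $W$ be a function on $(a,b)$ with values in the real symmetric positive definite $N\times N$ matrices such that * all moments are finite: $\int_a^b |x|^k |W_{ij}(x)|\,dx<\infty$ for all $k\ge 0$ and all $i,j$; * $W$ is locally Hölder continuous on $(a,b)$ (each point has a neighbourhood on which $W$ is Hölder continuous with some positive exponent), and, if $b=+\infty$ (resp. $a=-\infty$), $W$ is Hölder continuous with some positive exponent on $(a,b)\cap(r,\infty)$ (resp. on $(a,b)\cap(-\infty,r)$) for some real $r$; * at each finite endpoint $c\in\{a,b\}$ there are $\gamma_c>-1$ and a real matrix function $\widetilde W$ with $W(x)=|x-c|^{\gamma_c}\widetilde W(x)$ on $(a,b)$, $\widetilde W(c)\neq 0$, and $\widetilde W$ Hölder continuous with some positive exponent near $c$ in $(a,b)\cup\{c\}$. For a matrix function $F$ of a complex variable put $F^*(z)=(F(\bar z))^*$, where the second star is the Hermitian conjugate. A sequence of orthonormal matrix polynomials for $W$ is a sequence $(P_n)_{n\ge0}$ of polynomials with coefficients in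 $\mathbb C^{N\times N}$, $P_n$ of degree at most $n$ with nonsingular coefficient $\kappa_n$ of $x^n$, such that $\int_a^bP_n(x)W(x)P_m(x)^*\,dx=\delta_{nm}I_N$. Put $$Q_n(z)=\int_a^b\frac{P_n(t)-P_n(z)}{t-z}W(t)\,dt,\qquad \mathcal C(W)(z)=\frac1{2\pi i}\int_a^b\frac{W(t)}{t-z}\,dt .$$ For a finite endpoint $c$ let $h(z)=|z-c|^{\gamma_c}$ if $-1<\gamma_c<0$, $h(z)=\log|z-c|$ if $\gamma_c=0$, and $h(z)=1$ if $\gamma_c>0$. All $2N\times2N$ matrices are written in $N\times N$ blocks. **Problem (Y)$_n$:** find $Y^n:\mathbb C\setminus[a,b]\to\mathbb C^{2N\times 2N}$ such that * (Y1) $Y^n$ is analytic in $\mathbb C\setminus[a,b]$; * (Y2) $Y^n$ has continuous boundary values $Y^n_\pm$ on $(a,b)$ from the upper/lower half plane, and $Y^n_+(x)=Y^n_-(x)\begin{pmatrix}I_N&W(x)\\0&I_N\end{pmatrix}$ for $x\in(a,b)$; * (Y3) there are constant matrices $Y^n_1,Y_2^n,\dots$ such that for every $m\ge1$, as $z\to\infty$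 in $\mathbb C\setminus[a,b]$, $Y^n(z)=\Big(I_{2N}+\sum_{i=1}^mY^n_iz^{-i}+\mathcal O(z^{-m-1})\Big)\begin{pmatrix}z^nI_N&0\\0&z^{-n}I_N\end{pmatrix}$; * (Y4) as $z\to c$ in $\mathbb C\setminus[a,b]$, for each finite endpoint $c$, $Y^n(z)=\begin{pmatrix}\mathcal O(1)&\mathcal O(h(z))\\ \mathcal O(1)&\mathcal O(h(z))\end{pmatrix}$. **Dual problem (y)$_n$:** find $y^n:\mathbb C\setminus[a,b]\to\mathbb C^{2N\times 2N}$ such that * (y1) $y^n$ is analytic in $\mathbb C\setminus[a,b]$; * (y2) $y^n$ has continuous boundary values $y^n_\pm$ on $(a,b)$ from the upper/lower half plane, and $y^n_+(x)=\begin{pmatrix}I_N&-W(x)\\0&I_N\end{pmatrix}y^n_-(x)$ for $x\in(a,b)$; * (y3) there are constant matrices $\widetilde Y^n_1,\widetilde Y^n_2,\dots$ such that for every $m\ge1$, as $z\to\infty$ in $\mathbb C\setminus[a,b]$, $y^n(z)=\begin{pmatrix}z^{-n}I_N&0\\0&z^{n}I_N\end{pmatrix}\Big(I_{2N}+\sum_{i=1}^m\widetilde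 Y^n_iz^{-i}+\mathcal O(z^{-m-1})\Big)$; * (y4) as $z\to c$ in $\mathbb C\setminus[a,b]$, for each finite endpoint $c$, $y^n(z)=\begin{pmatrix}\mathcal O(h(z))&\mathcal O(h(z))\\ \mathcal O(1)&\mathcal O(1)\end{pmatrix}$. **Theorem.** A sequence of orthonormal matrix polynomials for $W$ exists. For every such sequence $(P_n)$ and every $n\ge0$: 1. Problem (Y)$_n$ has a unique solution (as a function on $\mathbb C\setminus[a,b]$). It is $Y^n=R_nY^0$, where $Y^0=\begin{pmatrix}I_N&\mathcal C(W)\\0&I_N\end{pmatrix}$ and $R_n$ is a matrix polynomial, given by $R_0=I_{2N}$ and, for $n\ge1$, $$R_n=\begin{pmatrix}\kappa_n^{-1}P_n&(2\pi i\kappa_n)^{-1}Q_n\\-2\pi i\kappa_{n-1}^*P_{n-1}&-\kappa_{n-1}^*Q_{n-1}\end{pmatrix}.$$ 2. Problem (y)$_n$ has a unique solution (as a function on $\mathbb C\setminus[a,b]$). It is $y^n=y^0r_n$, where $y^0=\begin{pmatrix}I_N&-\mathcal C(W)\\0&I_N\end{pmatrix}$ and $r_n$ is a matrix polynomial, given by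 $r_0=I_{2N}$ and, for $n\ge1$, $$r_n=\begin{pmatrix}-Q_{n-1}^*\kappa_{n-1}&-(2\pi i)^{-1}Q_n^*(\kappa_n^{*})^{-1}\\2\pi iP_{n-1}^*\kappa_{n-1}&P_n^*(\kappa_n^{*})^{-1}\end{pmatrix}.$$ 3. For all $z\in\mathbb C\setminus[a,b]$, and likewise for the boundary values from the upper and from the lower half plane at each point of $(a,b)$, $$y^n(z)=\begin{pmatrix}0&-I_N\\I_N&0\end{pmatrix}(Y^n(z))^T\begin{pmatrix}0&I_N\\-I_N&0\end{pmatrix}=(Y^n(z))^{-1},\qquad\det Y^n(z)=1 .$$ -/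

import Mathlib

open Filter Topology MeasureTheory Asymptotics

noncomputable section

namespace MOPRL

variable {N : ℕ}

/-- The open interval `(a, b)` of the real line; `a = -∞` and `b = +∞` are allowed. -/
def interval (a b : EReal) : Set ℝ := {x : ℝ | a < (x : EReal) ∧ (x : EReal) < b}

/-- The interval `[a, b]` (its real points) as a subset of the complex plane. -/
def cut (a b : EReal) : Set ℂ :=
  {z : ℂ | z.im = 0 ∧ a ≤ (z.re : EReal) ∧ (z.re : EReal) ≤ b}

/-- `c` is a finite endpoint of the interval. -/
def IsFiniteEndpoint (a b : EReal) (c : ℝ) : Prop := (c : EReal) = a ∨ (c : EReal) = b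

/-- Entrywise Hölder continuity, with some exponent `α > 0`, on the set `S`. -/
def IsHolderOn (F : ℝ → Matrix (Fin N) (Fin N) ℝ) (S : Set ℝ) : Prop :=
  ∃ C α : NNReal, 0 < α ∧ ∀ i j, HolderOnWith C α (fun t => F t i j) S

/-- The admissible weights: real symmetric positive definite on `(a, b)`, with finite moments of
all orders, locally Hölder continuous on `(a, b)`, Hölder continuous near an infinite endpoint,
and of the form `|x - c| ^ γ_c • Wt x`, with `γ_c > -1`, `Wt` Hölder continuous up to `c` and
`Wt c ≠ 0`, near a finite endpoint `c`.  Only the values of `γ` at finite endpoints matter. -/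
structure IsMatrixWeight (a b : EReal) (γ : ℝ → ℝ)
    (W : ℝ → Matrix (Fin N) (Fin N) ℝ) : Prop where
  posDef : ∀ x ∈ interval a b, (W x).PosDef
  moments : ∀ (k : ℕ) (i j : Fin N),
    IntegrableOn (fun x : ℝ => |x| ^ k * W x i j) (interval a b)
  holder : ∀ x ∈ interval a b, ∃ r : ℝ, 0 < r ∧
    IsHolderOn W (interval a b ∩ Metric.ball x r)
  holder_top : b = ⊤ → ∃ r : ℝ, IsHolderOn W (interval a b ∩ Set.Ioi r)
  holder_bot : a = ⊥ → ∃ r : ℝ, IsHolderOn W (interval a b ∩ Set.Iio r)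
  endpoint : ∀ c : ℝ, IsFiniteEndpoint a b c → -1 < γ c ∧
    ∃ Wt : ℝ → Matrix (Fin N) (Fin N) ℝ,
      (∀ x ∈ interval a b, W x = |x - c| ^ γ c • Wt x) ∧ Wt c ≠ 0 ∧
      ∃ r : ℝ, 0 < r ∧ IsHolderOn Wt (insert c (interval a b) ∩ Metric.ball c r)

/-- The weight with its entries regarded as complex numbers. -/
def cW (W : ℝ → Matrix (Fin N) (Fin N) ℝ) (x : ℝ) : Matrix (Fin N) (Fin N) ℂ :=
  (W x).map (fun s : ℝ => (s : ℂ))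

/-- Entrywise integral over `(a, b)`. -/
def matInt (a b : EReal) (F : ℝ → Matrix (Fin N) (Fin N) ℂ) : Matrix (Fin N) (Fin N) ℂ :=
  Matrix.of fun i j => ∫ t in interval a b, F t i j

/-- The value `∑ k, z ^ k • A_k` of a matrix polynomial at a complex number. -/
def pval {ι : Type*} [Fintype ι] [DecidableEq ι] (P : Polynomial (Matrix ι ι ℂ)) (z : ℂ) :
    Matrix ι ι ℂ := P.eval (Matrix.scalar ι z)

/-- `F^*(z) = (F(\bar z))^*`. -/
def starFun (F : ℂ → Matrix (Fin N) (Fin N) ℂ) (z : ℂ) : Matrix (Fin N) (Fin N) ℂ :=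
  (F (starRingEnd ℂ z)).conjTranspose

/-- The matrix-valued inner product `(P, Q)_W = ∫ P(x) W(x) Q(x)^* dx`. -/
def innerW (a b : EReal) (W : ℝ → Matrix (Fin N) (Fin N) ℝ)
    (P Q : Polynomial (Matrix (Fin N) (Fin N) ℂ)) : Matrix (Fin N) (Fin N) ℂ :=
  matInt a b fun x => pval P x * cW W x * (pval Q x).conjTranspose

/-- A sequence of orthonormal matrix polynomials: `P_n` has degree `n`, with a nonsingular
coefficient of `x ^ n`, and `(P_n, P_m)_W = δ_{nm} I`. -/
structure IsOrthonormalSeq (a b : EReal) (W : ℝ → Matrix (Fin N) (Fin N) ℝ)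
    (P : ℕ → Polynomial (Matrix (Fin N) (Fin N) ℂ)) : Prop where
  natDegree_le : ∀ n, (P n).natDegree ≤ n
  isUnit_lead : ∀ n, IsUnit ((P n).coeff n)
  orthonormal : ∀ n m, innerW a b W (P n) (P m) = if n = m then 1 else 0

/-- The leading coefficient `κ_n` of `P_n`. -/
def kappa (P : ℕ → Polynomial (Matrix (Fin N) (Fin N) ℂ)) (n : ℕ) :
    Matrix (Fin N) (Fin N) ℂ := (P n).coeff n

/-- The Cauchy transform of the weight. -/
def cauchyW (a b : EReal) (W : ℝ → Matrix (Fin N) (Fin N) ℝ) (z : ℂ) :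
    Matrix (Fin N) (Fin N) ℂ :=
  (2 * Real.pi * Complex.I : ℂ)⁻¹ • matInt a b fun t => ((t : ℂ) - z)⁻¹ • cW W t

/-- The matrix polynomials of the second kind
`Q_n(z) = ∫ (P_n(t) - P_n(z)) / (t - z) W(t) dt`. -/
def secondKind (a b : EReal) (W : ℝ → Matrix (Fin N) (Fin N) ℝ)
    (P : ℕ → Polynomial (Matrix (Fin N) (Fin N) ℂ)) (n : ℕ) (z : ℂ) :
    Matrix (Fin N) (Fin N) ℂ :=
  matInt a b fun t => (((t : ℂ) - z)⁻¹ • (pval (P n) t - pval (P n) z)) * cW W t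

/-- `2N × 2N` matrices, partitioned into `N × N` blocks. -/
abbrev BlockMat (N : ℕ) : Type := Matrix (Fin N ⊕ Fin N) (Fin N ⊕ Fin N) ℂ

/-- `Y^0`. -/
def Y0 (a b : EReal) (W : ℝ → Matrix (Fin N) (Fin N) ℝ) (z : ℂ) : BlockMat N :=
  Matrix.fromBlocks 1 (cauchyW a b W z) 0 1

/-- `y^0`. -/
def dualY0 (a b : EReal) (W : ℝ → Matrix (Fin N) (Fin N) ℝ) (z : ℂ) : BlockMat N :=
  Matrix.fromBlocks 1 (-cauchyW a b W z) 0 1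

/-- The transfer matrix `R_n`. -/
def transferR (a b : EReal) (W : ℝ → Matrix (Fin N) (Fin N) ℝ)
    (P : ℕ → Polynomial (Matrix (Fin N) (Fin N) ℂ)) : ℕ → ℂ → BlockMat N
  | 0, _ => 1
  | n + 1, z => Matrix.fromBlocks
      ((kappa P (n + 1))⁻¹ * pval (P (n + 1)) z)
      ((2 * Real.pi * Complex.I : ℂ)⁻¹ • ((kappa P (n + 1))⁻¹ * secondKind a b W P (n + 1) z))
      (-((2 * Real.pi * Complex.I : ℂ) • ((kappa P n).conjTranspose * pval (P n) z)))
      (-((kappa P n).conjTranspose * secondKind a b W P n z))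

/-- The dual transfer matrix `r_n`. -/
def transferDual (a b : EReal) (W : ℝ → Matrix (Fin N) (Fin N) ℝ)
    (P : ℕ → Polynomial (Matrix (Fin N) (Fin N) ℂ)) : ℕ → ℂ → BlockMat N
  | 0, _ => 1
  | n + 1, z => Matrix.fromBlocks
      (-(starFun (secondKind a b W P n) z * kappa P n))
      (-((2 * Real.pi * Complex.I : ℂ)⁻¹ •
        (starFun (secondKind a b W P (n + 1)) z * ((kappa P (n + 1)).conjTranspose)⁻¹)))
      ((2 * Real.pi * Complex.I : ℂ) • (starFun (pval (P n)) z * kappa P n))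
      (starFun (pval (P (n + 1))) z * ((kappa P (n + 1)).conjTranspose)⁻¹)

/-- `Y^n = R_n Y^0`. -/
def solY (a b : EReal) (W : ℝ → Matrix (Fin N) (Fin N) ℝ)
    (P : ℕ → Polynomial (Matrix (Fin N) (Fin N) ℂ)) (n : ℕ) (z : ℂ) : BlockMat N :=
  transferR a b W P n z * Y0 a b W z

/-- `y^n = y^0 r_n`. -/
def solDual (a b : EReal) (W : ℝ → Matrix (Fin N) (Fin N) ℝ)
    (P : ℕ → Polynomial (Matrix (Fin N) (Fin N) ℂ)) (n : ℕ) (z : ℂ) : BlockMat N :=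
  dualY0 a b W z * transferDual a b W P n z

/-- The filter of approach to `x ∈ ℝ` from the upper half plane. -/
def nhdsUpper (x : ℝ) : Filter ℂ := 𝓝[{z : ℂ | 0 < z.im}] (x : ℂ)

/-- The filter of approach to `x ∈ ℝ` from the lower half plane. -/
def nhdsLower (x : ℝ) : Filter ℂ := 𝓝[{z : ℂ | z.im < 0}] (x : ℂ)

/-- `z → ∞` in `ℂ ∖ [a, b]`. -/
def atInfty (a b : EReal) : Filter ℂ := Bornology.cobounded ℂ ⊓ 𝓟 (cut a b)ᶜ

/-- `z → c` in `ℂ ∖ [a, b]`. -/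
def atEndpoint (a b : EReal) (c : ℝ) : Filter ℂ := 𝓝[(cut a b)ᶜ] (c : ℂ)

/-- The function `h` that bounds the growth at the finite endpoint `c`, for `γ_c = g`. -/
def hfun (g c : ℝ) (z : ℂ) : ℝ :=
  if g < 0 then ‖z - c‖ ^ g else if g = 0 then Real.log ‖z - c‖ else 1

/-- The matrix `diag(z^k I, z^{-k} I)`. -/
def diagPow (k : ℤ) (z : ℂ) : BlockMat N :=
  Matrix.fromBlocks (z ^ k • 1) 0 0 (z ^ (-k) • 1)

/-- The matrix Riemann–Hilbert problem. -/
structure SolvesRHP (a b : EReal) (γ : ℝ → ℝ) (W : ℝ → Matrix (Fin N) (Fin N) ℝ) (n : ℕ)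
    (Y : ℂ → BlockMat N) : Prop where
  analytic : ∀ i j, AnalyticOnNhd ℂ (fun z => Y z i j) (cut a b)ᶜ
  jump : ∃ Yp Ym : ℝ → BlockMat N,
    ContinuousOn Yp (interval a b) ∧ ContinuousOn Ym (interval a b) ∧
    ∀ x ∈ interval a b, Tendsto Y (nhdsUpper x) (𝓝 (Yp x)) ∧
      Tendsto Y (nhdsLower x) (𝓝 (Ym x)) ∧
      Yp x = Ym x * Matrix.fromBlocks 1 (cW W x) 0 1
  infinity : ∃ A : ℕ → BlockMat N, ∀ m : ℕ, 1 ≤ m → ∃ E : ℂ → BlockMat N,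
    (∀ i j, (fun z => E z i j) =O[atInfty a b] fun z => (z ^ (m + 1))⁻¹) ∧
    ∀ᶠ z in atInfty a b,
      Y z = (1 + ∑ k ∈ Finset.Icc 1 m, (z ^ k)⁻¹ • A k + E z) * diagPow n z
  endpoint : ∀ c : ℝ, IsFiniteEndpoint a b c → ∀ i j,
    (fun z => Y z i (Sum.inl j)) =O[atEndpoint a b c] (fun _ => (1 : ℝ)) ∧
    (fun z => Y z i (Sum.inr j)) =O[atEndpoint a b c] (hfun (γ c) c)

/-- The dual matrix Riemann–Hilbert problem. -/
structure SolvesDualRHP (a b : EReal) (γ : ℝ → ℝ) (W : ℝ → Matrix (Fin N) (Fin N) ℝ) (n : ℕ)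
    (y : ℂ → BlockMat N) : Prop where
  analytic : ∀ i j, AnalyticOnNhd ℂ (fun z => y z i j) (cut a b)ᶜ
  jump : ∃ yp ym : ℝ → BlockMat N,
    ContinuousOn yp (interval a b) ∧ ContinuousOn ym (interval a b) ∧
    ∀ x ∈ interval a b, Tendsto y (nhdsUpper x) (𝓝 (yp x)) ∧
      Tendsto y (nhdsLower x) (𝓝 (ym x)) ∧
      yp x = Matrix.fromBlocks 1 (-cW W x) 0 1 * ym x
  infinity : ∃ A : ℕ → BlockMat N, ∀ m : ℕ, 1 ≤ m → ∃ E : ℂ → BlockMat N,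
    (∀ i j, (fun z => E z i j) =O[atInfty a b] fun z => (z ^ (m + 1))⁻¹) ∧
    ∀ᶠ z in atInfty a b,
      y z = diagPow (-n) z * (1 + ∑ k ∈ Finset.Icc 1 m, (z ^ k)⁻¹ • A k + E z)
  endpoint : ∀ c : ℝ, IsFiniteEndpoint a b c → ∀ i j,
    (fun z => y z (Sum.inl i) j) =O[atEndpoint a b c] (hfun (γ c) c) ∧
    (fun z => y z (Sum.inr i) j) =O[atEndpoint a b c] (fun _ => (1 : ℝ))

/-- The transformation `A ↦ [[0, -I], [I, 0]] Aᵀ [[0, I], [-I, 0]]`. -/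
def dualTranspose (A : BlockMat N) : BlockMat N :=
  Matrix.fromBlocks 0 (-1) 1 0 * A.transpose * Matrix.fromBlocks 0 1 (-1) 0

end MOPRL

end

namespace MOPRL

/-! ### Geometry of the cut -/

/-! Existence rests on one identity: the Cauchy transform of `P_n W` is `P_n` times that of `W`,
plus `Q_n` (`cauchyPoly_eq`). Hence the right column of `R_n Y^0` consists of Cauchy transforms of
`P_n W` and `P_{n-1} W`, and the four conditions become statements about Cauchy integrals. `R_n` is
polynomial, so the jump and the endpoint growth reduce to those of `C(W)`. At infinity, the
coefficients of the expansion are inner products of `P_n` with monomials (`cauchyPoly_expansion`).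
Orthogonality kills the first ones, and orthonormality makes the constant term the identity
(`solY_hasExpansion`).

The analytic input is local. Subtracting the value of the density at `Re z` splits its Cauchy
integral into a far part, a part made integrable by Hölder continuity, and an explicit arctangent
(`cauchyInt_decomposition`). With a fixed window this gives the Plemelj formula. With a window of
length one it bounds the Cauchy integral of `t^m W` near an infinite end of the cut, because Hölder
continuity and finite moments force rapid decay (`HolderAtTop.exists_decay`). With a window
proportional to the distance from a finite endpoint it gives the growth `h`
(`EndpointData.exists_bound`).

For uniqueness, let `Y` be any solution. Multiplied on the right by the inverse of `Y^n`, it has no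
jump, its endpoint singularities are weaker than poles because `γ_c > -1`, and it tends to the
identity at infinity. It is therefore constant by Morera and Liouville (`exists_entire_extension`,
`eq_of_tendsto_atInfty`, `SolvesRHP.eqOn_solY`).

The dual problem is the image of the first under `A ↦ J Aᵀ J⁻¹`, since `W` is symmetric. The star in
`r_n` contains a complex conjugation. As `W` is real, the conjugated polynomials are again
orthonormal, and `r_n` is the dual of their transfer matrix (`transferDual_eq`). By uniqueness they
produce the same `Y^n`, which yields the symmetry. The inverse relation follows because `R_n r_n` is
a polynomial tending to the identity.

Orthonormal polynomials come from Gram–Schmidt with matrix coefficients. The step that needs an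
argument is that the Gram matrix of a monic polynomial is positive definite (`innerW_self_posDef`).
-/

theorem isOpen_interval (a b : EReal) : IsOpen (interval a b) :=
  (isOpen_lt continuous_const continuous_coe_real_ereal).inter
    (isOpen_lt continuous_coe_real_ereal continuous_const)

theorem isClosed_cut (a b : EReal) : IsClosed (cut a b) := by
  have h : Continuous fun z : ℂ => (z.re : EReal) :=
    continuous_coe_real_ereal.comp Complex.continuous_re
  exact (isClosed_eq Complex.continuous_im continuous_const).inter
    ((isClosed_le continuous_const h).inter (isClosed_le h continuous_const))

theorem isOpen_compl_cut (a b : EReal) : IsOpen (cut a b)ᶜ := (isClosed_cut a b).isOpen_compl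

theorem mem_compl_cut_of_im_ne_zero {a b : EReal} {z : ℂ} (hz : z.im ≠ 0) : z ∈ (cut a b)ᶜ :=
  fun h => hz h.1

theorem mem_closure_upper (x : ℝ) : (x : ℂ) ∈ closure {z : ℂ | 0 < z.im} := by
  rw [Complex.closure_setOfPred_lt_im]; simp

theorem mem_closure_lower (x : ℝ) : (x : ℂ) ∈ closure {z : ℂ | z.im < 0} := by
  rw [Complex.closure_setOfPred_im_lt]; simp

instance nhdsUpper_neBot (x : ℝ) : (nhdsUpper x).NeBot :=
  mem_closure_iff_nhdsWithin_neBot.1 (mem_closure_upper x)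

instance nhdsLower_neBot (x : ℝ) : (nhdsLower x).NeBot :=
  mem_closure_iff_nhdsWithin_neBot.1 (mem_closure_lower x)

theorem dense_compl_cut (a b : EReal) : Dense (cut a b)ᶜ := by
  intro z
  by_cases hz : z.im = 0
  · have : ((z.re : ℝ) : ℂ) = z := by apply Complex.ext <;> simp [hz]
    rw [← this]
    exact closure_mono (fun w hw => mem_compl_cut_of_im_ne_zero (ne_of_gt hw))
      (mem_closure_upper z.re)
  · exact subset_closure (mem_compl_cut_of_im_ne_zero hz)

instance nhdsWithin_compl_cut_neBot (a b : EReal) (z : ℂ) : (𝓝[(cut a b)ᶜ] z).NeBot :=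
  mem_closure_iff_nhdsWithin_neBot.1 (dense_compl_cut a b z)

theorem nhdsUpper_le (a b : EReal) (x : ℝ) : nhdsUpper x ≤ 𝓝[(cut a b)ᶜ] (x : ℂ) :=
  nhdsWithin_mono _ fun _ hw => mem_compl_cut_of_im_ne_zero (ne_of_gt hw)

theorem nhdsLower_le (a b : EReal) (x : ℝ) : nhdsLower x ≤ 𝓝[(cut a b)ᶜ] (x : ℂ) :=
  nhdsWithin_mono _ fun _ hw => mem_compl_cut_of_im_ne_zero (ne_of_lt hw)

/-- Near an interior point of the cut, the complement of the cut is the union of the two open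
half planes. -/
theorem nhdsWithin_compl_cut_le {a b : EReal} {x : ℝ} (hx : x ∈ interval a b) :
    𝓝[(cut a b)ᶜ] (x : ℂ) ≤ nhdsUpper x ⊔ nhdsLower x := by
  rw [nhdsUpper, nhdsLower, ← nhdsWithin_union]
  have hU : Complex.re ⁻¹' interval a b ∈ 𝓝 (x : ℂ) :=
    ((isOpen_interval a b).preimage Complex.continuous_re).mem_nhds (by simpa using hx)
  rw [← nhdsWithin_inter_of_mem' (mem_nhdsWithin_of_mem_nhds hU)]
  refine nhdsWithin_mono _ ?_
  rintro z ⟨hz, hz'⟩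
  rcases lt_trichotomy z.im 0 with h | h | h
  · exact Or.inr h
  · exact absurd ⟨h, le_of_lt hz'.1, le_of_lt hz'.2⟩ hz
  · exact Or.inl h

theorem mem_cut_cases {a b : EReal} {z : ℂ} (hz : z ∈ cut a b) :
    ∃ x : ℝ, (x : ℂ) = z ∧ (x ∈ interval a b ∨ IsFiniteEndpoint a b x) := by
  refine ⟨z.re, by apply Complex.ext <;> simp [hz.1], ?_⟩
  rcases eq_or_lt_of_le hz.2.1 with h | h
  · exact Or.inr (Or.inl h.symm)
  rcases eq_or_lt_of_le hz.2.2 with h' | h'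
  · exact Or.inr (Or.inr h')
  · exact Or.inl ⟨h, h'⟩

theorem finite_setOf_isFiniteEndpoint (a b : EReal) : {c : ℝ | IsFiniteEndpoint a b c}.Finite := by
  have h : ∀ e : EReal, {c : ℝ | (c : EReal) = e}.Finite := fun e =>
    Set.Subsingleton.finite fun x hx y hy => EReal.coe_injective (hx.trans hy.symm)
  exact (h a).union (h b)

/-! ### Entire extension across the cut -/

/-- A continuous function on the plane that is holomorphic off the real line is entire. -/
theorem differentiable_of_continuous_of_off_real {f : ℂ → ℂ} (hc : Continuous f)
    (hd : ∀ z : ℂ, z.im ≠ 0 → DifferentiableAt ℂ f z) : Differentiable ℂ f := by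
  -- Cauchy's theorem on a rectangle with a side on the real axis: differentiability is needed only
  -- in the open interior, continuity suffices on the boundary.
  have key : ∀ z w : ℂ, z.im = 0 ∨ w.im = 0 →
      (∫ x : ℝ in z.re..w.re, f (x + z.im * Complex.I)) -
        (∫ x : ℝ in z.re..w.re, f (x + w.im * Complex.I)) +
        Complex.I • (∫ y : ℝ in z.im..w.im, f (w.re + y * Complex.I)) -
        Complex.I • (∫ y : ℝ in z.im..w.im, f (z.re + y * Complex.I)) = 0 := by
    intro z w h
    refine Complex.integral_boundary_rect_eq_zero_of_continuousOn_of_differentiableOn f z w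
      hc.continuousOn ?_
    rintro u ⟨-, hu⟩
    refine (hd u ?_).differentiableWithinAt
    have hu' : min z.im w.im < u.im ∧ u.im < max z.im w.im := hu
    rcases h with h | h <;> rw [h] at hu' <;>
      · intro h0
        rw [h0] at hu'
        have := hu'.1; have := hu'.2
        simp only [min_lt_iff, lt_max_iff, lt_self_iff_false, or_false, false_or] at *
        linarith
  -- Morera: a general rectangle is cut along the real axis into two of the above, and the integrals
  -- over the common side cancel.
  have hcons : Complex.IsConservativeOn f Set.univ := by
    intro z w _
    rw [← add_eq_zero_iff_eq_neg, Complex.wedgeIntegral_add_wedgeIntegral_eq]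
    have h1 := key z ⟨w.re, 0⟩ (Or.inr rfl)
    have h2 := key ⟨z.re, 0⟩ w (Or.inl rfl)
    simp only at h1 h2
    have hi : ∀ (c : ℝ) (p q : ℝ), IntervalIntegrable
        (fun y : ℝ => f (c + y * Complex.I)) volume p q := fun c p q =>
      Continuous.intervalIntegrable (by fun_prop) _ _
    rw [← intervalIntegral.integral_add_adjacent_intervals (hi w.re z.im 0) (hi w.re 0 w.im),
      ← intervalIntegral.integral_add_adjacent_intervals (hi z.re z.im 0) (hi z.re 0 w.im)]
    simp only [smul_eq_mul] at *
    linear_combination h1 + h2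
  exact differentiableOn_univ.1
    ((Complex.isConservativeOn_and_continuousOn_iff_isDifferentiableOn isOpen_univ).1
      ⟨hcons, hc.continuousOn⟩)

theorem tendsto_dense_unique {a b : EReal} {f g : ℂ → ℂ} {c y : ℂ} (hg : Continuous g)
    (hfg : Set.EqOn g f (cut a b)ᶜ) (hf : Tendsto f (𝓝[(cut a b)ᶜ] c) (𝓝 y)) : g c = y :=
  tendsto_nhds_unique ((hg.tendsto c).mono_left nhdsWithin_le_nhds)
    (hf.congr' (eventually_mem_nhdsWithin.mono fun _ hz => (hfg hz).symm))

/-- The factors `z - c` are divided out one at a time. The growth hypothesis forces `G c = 0`, so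
the divided difference `dslope G c` is again entire and carries one factor fewer. -/
theorem exists_entire_of_prod_mul {a b : EReal} (s : Finset ℝ) :
    ∀ f : ℂ → ℂ, (∀ c ∈ s, (c : ℂ) ∈ cut a b ∧
      Tendsto (fun z : ℂ => (z - c) * f z) (𝓝[(cut a b)ᶜ] (c : ℂ)) (𝓝 0)) →
    ∀ G : ℂ → ℂ, Differentiable ℂ G → Set.EqOn G (fun z => (∏ c ∈ s, (z - c)) * f z) (cut a b)ᶜ →
    ∃ g : ℂ → ℂ, Differentiable ℂ g ∧ Set.EqOn g f (cut a b)ᶜ := by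
  induction s using Finset.induction_on with
  | empty => exact fun f _ G hG hGf => ⟨G, hG, fun z hz => by simpa using hGf hz⟩
  | insert c s hc ih =>
    intro f hf G hG hGf
    refine ih f (fun d hd => hf d (Finset.mem_insert_of_mem hd)) (dslope G c) ?_ ?_
    · rw [← differentiableOn_univ] at hG ⊢
      exact (Complex.differentiableOn_dslope univ_mem).2 hG
    · have hGc : G c = 0 := by
        refine tendsto_dense_unique hG.continuous hGf ?_
        have h1 := (hf c (Finset.mem_insert_self _ _)).2
        have h2 : Tendsto (fun z : ℂ => ∏ d ∈ s, (z - d)) (𝓝[(cut a b)ᶜ] (c : ℂ))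
            (𝓝 (∏ d ∈ s, ((c : ℂ) - d))) :=
          (Continuous.tendsto (by fun_prop) _).mono_left nhdsWithin_le_nhds
        have h3 := h2.mul h1
        rw [mul_zero] at h3
        refine h3.congr fun z => ?_
        rw [Finset.prod_insert hc]; ring
      intro z hz
      have hzc : z ≠ c := by
        rintro rfl
        exact hz (hf c (Finset.mem_insert_self _ _)).1
      have := hGf hz
      simp only [Finset.prod_insert hc] at this ⊢
      rw [dslope_of_ne _ hzc, slope_def_field, hGc, this]
      have : z - c ≠ 0 := sub_ne_zero.2 hzc
      field_simp
      ring

theorem coe_mem_cut {a b : EReal} (hab : a < b) {c : ℝ} (hc : IsFiniteEndpoint a b c) :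
    (c : ℂ) ∈ cut a b := by
  rcases hc with rfl | rfl
  · exact ⟨by simp, by simp, by simpa using hab.le⟩
  · exact ⟨by simp, by simpa using hab.le, by simp⟩

/-- A function analytic off the cut, without jump across its interior, and with singularities at
the endpoints weaker than a pole, is the restriction of an entire function. -/
theorem exists_entire_extension {a b : EReal} (hab : a < b) {f : ℂ → ℂ}
    (hf : AnalyticOnNhd ℂ f (cut a b)ᶜ)
    (hj : ∀ x ∈ interval a b, ∃ l, Tendsto f (𝓝[(cut a b)ᶜ] (x : ℂ)) (𝓝 l))
    (he : ∀ c : ℝ, IsFiniteEndpoint a b c →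
      Tendsto (fun z : ℂ => (z - c) * f z) (𝓝[(cut a b)ᶜ] (c : ℂ)) (𝓝 0)) :
    ∃ g : ℂ → ℂ, Differentiable ℂ g ∧ Set.EqOn g f (cut a b)ᶜ := by
  set s := (finite_setOf_isFiniteEndpoint a b).toFinset with hs
  have hs' : ∀ c, c ∈ s ↔ IsFiniteEndpoint a b c := fun c => by simp [hs]
  -- Multiplying by `q` makes the function extend continuously to the endpoints as well; the zeros
  -- of `q` are removed at the end.
  set q : ℂ → ℂ := fun z => ∏ c ∈ s, (z - c) with hq
  have hqc : Continuous q := by fun_prop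
  have hcont : ContinuousOn (fun z => q z * f z) (cut a b)ᶜ :=
    hqc.continuousOn.mul hf.continuousOn
  set G := extendFrom (cut a b)ᶜ (fun z => q z * f z) with hG
  have hGf : Set.EqOn G (fun z => q z * f z) (cut a b)ᶜ := fun z hz =>
    extendFrom_extends hcont z hz
  have hGc : Continuous G := by
    refine continuous_extendFrom (dense_compl_cut a b) fun z => ?_
    by_cases hz : z ∈ cut a b
    · obtain ⟨x, rfl, hx | hx⟩ := mem_cut_cases hz
      · obtain ⟨l, hl⟩ := hj x hx
        exact ⟨_, ((hqc.tendsto _).mono_left nhdsWithin_le_nhds).mul hl⟩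
      · have h1 := he x hx
        have h2 : Tendsto (fun z : ℂ => ∏ d ∈ s.erase x, (z - d)) (𝓝[(cut a b)ᶜ] (x : ℂ))
            (𝓝 (∏ d ∈ s.erase x, ((x : ℂ) - d))) :=
          (Continuous.tendsto (by fun_prop) _).mono_left nhdsWithin_le_nhds
        refine ⟨_, (h2.mul h1).congr fun z => ?_⟩
        simp only [hq]
        rw [← Finset.prod_erase_mul s _ ((hs' x).2 hx)]
        ring
    · exact ⟨_, hcont z hz⟩
  have hGd : Differentiable ℂ G := by
    refine differentiable_of_continuous_of_off_real hGc fun z hz => ?_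
    have hz' : z ∈ (cut a b)ᶜ := mem_compl_cut_of_im_ne_zero hz
    have hqd : Differentiable ℂ q := by fun_prop
    refine (hqd.differentiableAt.mul (hf z hz').differentiableAt).congr_of_eventuallyEq ?_
    filter_upwards [(isOpen_compl_cut a b).mem_nhds hz'] with w hw using hGf hw
  exact exists_entire_of_prod_mul s f
    (fun c hc => ⟨coe_mem_cut hab ((hs' c).1 hc), he c ((hs' c).1 hc)⟩) G hGd hGf

/-- Liouville's theorem, with the limit at infinity taken off the cut. -/
theorem eq_of_tendsto_atInfty {a b : EReal} {g : ℂ → ℂ} (hg : Differentiable ℂ g) {l : ℂ}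
    (h : Tendsto g (atInfty a b) (𝓝 l)) (z : ℂ) : g z = l := by
  refine hg.apply_eq_of_tendsto_cocompact z ?_
  rw [← Metric.cobounded_eq_cocompact]
  rw [(Metric.nhds_basis_closedBall (x := l)).tendsto_right_iff] at h ⊢
  intro ε hε
  have h1 := h ε hε
  rw [atInfty, eventually_inf_principal, ← comap_norm_atTop, eventually_comap]
    at h1
  obtain ⟨R, hR⟩ := eventually_atTop.1 h1
  rw [← comap_norm_atTop, eventually_comap]
  filter_upwards [eventually_gt_atTop R] with r hr w hw
  have hU : IsOpen {u : ℂ | R < ‖u‖} := isOpen_lt continuous_const continuous_norm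
  -- The bound is known only off the cut. Density and continuity carry it to points of the cut,
  -- which may be unbounded.
  have hcl : w ∈ closure ({u : ℂ | R < ‖u‖} ∩ (cut a b)ᶜ) :=
    (dense_compl_cut a b).open_subset_closure_inter hU (by simpa [hw] using hr)
  have hC : IsClosed (g ⁻¹' Metric.closedBall l ε) := Metric.isClosed_closedBall.preimage
    hg.continuous
  exact closure_minimal (fun u hu => hR ‖u‖ (le_of_lt hu.1) u rfl hu.2) hC hcl

/-! ### Cauchy integrals of scalar functions -/

/-- The Cauchy integral `∫ g(t) / (t - z) dt` of a function on the line. -/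
noncomputable def cauchyInt (g : ℝ → ℂ) (z : ℂ) : ℂ := ∫ t : ℝ, ((t : ℂ) - z)⁻¹ * g t

theorem measurable_cauchyKernel (z : ℂ) : Measurable fun t : ℝ => ((t : ℂ) - z)⁻¹ := by fun_prop

theorem integrable_kernel_mul {g : ℝ → ℂ} (hg : Integrable g) {z : ℂ} {ε : ℝ} (hε : 0 < ε)
    (h : ∀ t : ℝ, g t ≠ 0 → ε ≤ ‖(t : ℂ) - z‖) :
    Integrable fun t : ℝ => ((t : ℂ) - z)⁻¹ * g t := by
  refine (hg.norm.const_mul ε⁻¹).mono'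
    ((measurable_cauchyKernel z).aestronglyMeasurable.mul hg.aestronglyMeasurable) ?_
  refine Eventually.of_forall fun t => ?_
  by_cases ht : g t = 0
  · simp [ht]
  · rw [norm_mul, norm_inv]
    gcongr
    exact h t ht

theorem norm_cauchyInt_le {g : ℝ → ℂ} (hg : Integrable g) {z : ℂ} {ε : ℝ} (hε : 0 < ε)
    (h : ∀ t : ℝ, g t ≠ 0 → ε ≤ ‖(t : ℂ) - z‖) : ‖cauchyInt g z‖ ≤ ε⁻¹ * ∫ t, ‖g t‖ := by
  rw [← integral_const_mul]
  refine norm_integral_le_of_norm_le (hg.norm.const_mul ε⁻¹) (Eventually.of_forall fun t => ?_)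
  by_cases ht : g t = 0
  · simp [ht]
  · rw [norm_mul, norm_inv]
    gcongr
    exact h t ht

/-- Halving the radius leaves room for `w` to move, so the lower bound is uniform near `z`; this is
what allows differentiation under the integral sign. -/
theorem exists_dist_cut {a b : EReal} {z : ℂ} (hz : z ∈ (cut a b)ᶜ) :
    ∃ ε : ℝ, 0 < ε ∧ ∀ w : ℂ, ‖w - z‖ < ε → ∀ t ∈ interval a b, ε ≤ ‖(t : ℂ) - w‖ := by
  obtain ⟨ε, hε, h⟩ := Metric.isOpen_iff.1 (isOpen_compl_cut a b) z hz
  refine ⟨ε / 2, by linarith, fun w hw t ht => ?_⟩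
  by_contra! hlt
  have : (t : ℂ) ∈ Metric.ball z ε := by
    rw [mem_ball_iff_norm]
    calc ‖(t : ℂ) - z‖ = ‖((t : ℂ) - w) + (w - z)‖ := by ring_nf
      _ ≤ ‖(t : ℂ) - w‖ + ‖w - z‖ := norm_add_le _ _
      _ < ε := by linarith
  exact h this ⟨by simp, by simpa using ht.1.le, by simpa using ht.2.le⟩

theorem integrable_kernel_mul_of_compl_cut {a b : EReal} {g : ℝ → ℂ} (hg : Integrable g)
    (hs : ∀ t, t ∉ interval a b → g t = 0) {z : ℂ} (hz : z ∈ (cut a b)ᶜ) :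
    Integrable fun t : ℝ => ((t : ℂ) - z)⁻¹ * g t := by
  obtain ⟨ε, hε, h⟩ := exists_dist_cut hz
  refine integrable_kernel_mul hg hε fun t ht => h z (by simpa using hε) t ?_
  by_contra h'
  exact ht (hs t h')

/-- The Cauchy integral is analytic off the support of the density. -/
theorem analyticOnNhd_cauchyInt {a b : EReal} {g : ℝ → ℂ} (hg : Integrable g)
    (hs : ∀ t, t ∉ interval a b → g t = 0) : AnalyticOnNhd ℂ (cauchyInt g) (cut a b)ᶜ := by
  refine DifferentiableOn.analyticOnNhd (fun z hz => ?_) (isOpen_compl_cut a b)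
  obtain ⟨ε, hε, h⟩ := exists_dist_cut hz
  have hs' : ∀ t, g t ≠ 0 → t ∈ interval a b := fun t ht => by
    by_contra h'; exact ht (hs t h')
  have key := hasDerivAt_integral_of_dominated_loc_of_deriv_le (μ := volume)
    (F := fun (w : ℂ) (t : ℝ) => ((t : ℂ) - w)⁻¹ * g t)
    (F' := fun (w : ℂ) (t : ℝ) => (((t : ℂ) - w) ^ 2)⁻¹ * g t) (x₀ := z)
    (bound := fun t => (ε ^ 2)⁻¹ * ‖g t‖) (Metric.ball_mem_nhds z hε)
    (Eventually.of_forall fun w =>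
      (measurable_cauchyKernel w).aestronglyMeasurable.mul hg.aestronglyMeasurable)
    (integrable_kernel_mul_of_compl_cut hg hs hz)
    ((by fun_prop : Measurable fun t : ℝ => (((t : ℂ) - z) ^ 2)⁻¹).aestronglyMeasurable.mul
      hg.aestronglyMeasurable)
    (Eventually.of_forall fun t w hw => ?_) (hg.norm.const_mul _)
    (Eventually.of_forall fun t w hw => ?_)
  · exact key.2.differentiableAt.differentiableWithinAt
  · by_cases ht : g t = 0
    · simp [ht]
    · rw [norm_mul, norm_inv, norm_pow]
      gcongr
      exact h w (mem_ball_iff_norm.1 hw) t (hs' t ht)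
  · by_cases ht : g t = 0
    · simp only [ht, mul_zero]
      exact hasDerivAt_const _ _
    · have h1 := h w (mem_ball_iff_norm.1 hw) t (hs' t ht)
      have h2 : (t : ℂ) - w ≠ 0 := norm_pos_iff.1 (hε.trans_le h1)
      have h3 := (((hasDerivAt_id w).const_sub (t : ℂ)).inv h2).mul_const (g t)
      simpa [neg_div, one_div] using h3

/-- The antiderivative is `½ log(u² + y²) + i arctan(u / y)`. On a symmetric interval the even
logarithm cancels and the odd arctangent doubles. Its sign change with `y` is the source of the
jump. -/
theorem integral_kernel_symm {y : ℝ} (hy : y ≠ 0) (ρ : ℝ) :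
    ∫ u : ℝ in -ρ..ρ, ((u : ℂ) - y * Complex.I)⁻¹ =
      ((2 * Real.arctan (ρ / y) : ℝ) : ℂ) * Complex.I := by
  have hpos : ∀ u : ℝ, 0 < u ^ 2 + y ^ 2 := fun u => by positivity
  have hne : ∀ u : ℝ, (u : ℂ) - y * Complex.I ≠ 0 := fun u h => by
    have := congrArg Complex.im h
    simp at this
    exact hy this
  have hd : ∀ u : ℝ, HasDerivAt (fun u : ℝ => ((1 / 2 * Real.log (u ^ 2 + y ^ 2) : ℝ) : ℂ) +
      ((Real.arctan (u / y) : ℝ) : ℂ) * Complex.I) (((u : ℂ) - y * Complex.I)⁻¹) u := by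
    intro u
    have h1 : HasDerivAt (fun u : ℝ => 1 / 2 * Real.log (u ^ 2 + y ^ 2)) (u / (u ^ 2 + y ^ 2)) u := by
      have := ((((hasDerivAt_id u).pow 2).add_const (y ^ 2)).log (hpos u).ne').const_mul (1 / 2 : ℝ)
      refine this.congr_deriv ?_
      simp
      ring
    have h2 : HasDerivAt (fun u : ℝ => Real.arctan (u / y)) (y / (u ^ 2 + y ^ 2)) u := by
      refine ((hasDerivAt_id u).div_const y).arctan.congr_deriv ?_
      have := (hpos u).ne'
      simp only [id]
      field_simp
      ring
    refine (h1.ofReal_comp.add (h2.ofReal_comp.mul_const Complex.I)).congr_deriv ?_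
    refine eq_inv_of_mul_eq_one_left ?_
    have h3 : ((u : ℂ) ^ 2 + y ^ 2) ≠ 0 := by exact_mod_cast (hpos u).ne'
    push_cast
    field_simp
    ring_nf
    simp
  rw [intervalIntegral.integral_eq_sub_of_hasDerivAt (fun u _ => hd u)]
  · simp [neg_div, Real.arctan_neg]
    ring
  · refine Continuous.intervalIntegrable ?_ _ _
    exact Continuous.inv₀ (by fun_prop) hne

theorem norm_le_norm_ofReal_sub {y u : ℝ} : |u| ≤ ‖(u : ℂ) - y * Complex.I‖ := by
  simpa using Complex.abs_re_le_norm ((u : ℂ) - y * Complex.I)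

theorem intervalIntegrable_abs_rpow {α : ℝ} (hα : 0 < α) (ρ : ℝ) :
    IntervalIntegrable (fun u : ℝ => |u| ^ (α - 1)) volume 0 ρ := by
  have hp : ∀ r : ℝ, 0 ≤ r → IntervalIntegrable (fun u : ℝ => |u| ^ (α - 1)) volume 0 r := by
    intro r hr
    refine (intervalIntegral.intervalIntegrable_rpow' (a := 0) (b := r)
      (by linarith : -1 < α - 1)).congr ?_
    intro u hu
    rw [Set.uIoc_of_le hr] at hu
    simp [abs_of_pos hu.1]
  rcases le_total 0 ρ with h | h
  · exact hp ρ h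
  · have := (IntervalIntegrable.iff_comp_neg).1 (hp (-ρ) (by linarith))
    simpa using this

theorem integral_abs_rpow {α ρ : ℝ} (hα : 0 < α) (hρ : 0 ≤ ρ) :
    ∫ u in -ρ..ρ, |u| ^ (α - 1) = 2 * ρ ^ α / α := by
  have h0 : ∫ u in (0 : ℝ)..ρ, |u| ^ (α - 1) = ρ ^ α / α := by
    rw [intervalIntegral.integral_congr (g := fun u => u ^ (α - 1)), integral_rpow (by left; linarith)]
    · simp [Real.zero_rpow hα.ne']
    · intro u hu
      rw [Set.uIcc_of_le hρ] at hu
      simp [abs_of_nonneg hu.1]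
  have h1 : ∫ u in -ρ..0, |u| ^ (α - 1) = ρ ^ α / α := by
    rw [← h0]
    have := intervalIntegral.integral_comp_neg (a := -ρ) (b := 0) (fun u : ℝ => |u| ^ (α - 1))
    simpa using this
  rw [← intervalIntegral.integral_add_adjacent_intervals
    (intervalIntegrable_abs_rpow hα (-ρ)).symm (intervalIntegrable_abs_rpow hα ρ), h0, h1]
  ring

/-- Splitting of the Cauchy integral into the contributions away from and near `Re z`. -/
theorem cauchyInt_decomposition {g : ℝ → ℂ} (hg : Integrable g) {z : ℂ} (hz : z.im ≠ 0) {ρ : ℝ}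
    (hρ : 0 < ρ) :
    cauchyInt g z = (∫ t, {t : ℝ | ρ ≤ |t - z.re|}.indicator
        (fun t => ((t : ℂ) - z)⁻¹ * g t) t) +
      (∫ u in -ρ..ρ, ((u : ℂ) - z.im * Complex.I)⁻¹ * (g (z.re + u) - g z.re)) +
      ((2 * Real.arctan (ρ / z.im) : ℝ) : ℂ) * Complex.I * g z.re := by
  have hS : MeasurableSet {t : ℝ | ρ ≤ |t - z.re|} := measurableSet_le (by fun_prop) (by fun_prop)
  have hne : ∀ u : ℝ, (u : ℂ) - z.im * Complex.I ≠ 0 := fun u h => by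
    have := congrArg Complex.im h
    simp at this
    exact hz this
  have hint : Integrable fun t : ℝ => ((t : ℂ) - z)⁻¹ * g t :=
    integrable_kernel_mul hg (abs_pos.2 hz) fun t _ => by
      simpa using Complex.abs_im_le_norm ((t : ℂ) - z)
  have hsh : ∀ u : ℝ, ((z.re + u : ℝ) : ℂ) - z = (u : ℂ) - z.im * Complex.I := fun u => by
    apply Complex.ext <;> simp
  have hint' : Integrable fun u : ℝ => ((u : ℂ) - z.im * Complex.I)⁻¹ * g (z.re + u) := by
    have := hint.comp_add_left z.re
    simpa only [hsh] using this
  have hc : Continuous fun u : ℝ => ((u : ℂ) - z.im * Complex.I)⁻¹ * g z.re :=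
    (Continuous.inv₀ (by fun_prop) hne).mul continuous_const
  have hcompl : {t : ℝ | ρ ≤ |t - z.re|}ᶜ = Set.Ioo (z.re - ρ) (z.re + ρ) := by
    ext t
    simp only [Set.mem_compl_iff, Set.mem_ofPred_eq, not_le, abs_lt, Set.mem_Ioo]
    constructor <;> rintro ⟨h1, h2⟩ <;> constructor <;> linarith
  rw [integral_indicator hS, cauchyInt, ← integral_add_compl hS hint, hcompl, add_assoc]
  congr 1
  rw [← integral_Ioc_eq_integral_Ioo, ← intervalIntegral.integral_of_le (by linarith)]
  have h1 := intervalIntegral.integral_comp_add_left (a := -ρ) (b := ρ)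
    (fun t : ℝ => ((t : ℂ) - z)⁻¹ * g t) z.re
  rw [← sub_eq_add_neg] at h1
  rw [← h1, ← integral_kernel_symm hz, ← intervalIntegral.integral_mul_const,
    ← intervalIntegral.integral_add]
  · refine intervalIntegral.integral_congr fun u _ => ?_
    simp only [hsh]
    ring
  · simp only [mul_sub]
    exact hint'.intervalIntegrable.sub (hc.intervalIntegrable _ _)
  · exact hc.intervalIntegrable _ _

/-- The factor `|u|^α` from Hölder continuity turns the singularity of the kernel into an integrable
one, with a bound independent of `y`. -/
theorem holder_kernel_le {g : ℝ → ℂ} {x y H α u : ℝ} (hH : 0 ≤ H)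
    (h : ‖g (x + u) - g x‖ ≤ H * |u| ^ α) :
    ‖((u : ℂ) - y * Complex.I)⁻¹ * (g (x + u) - g x)‖ ≤ H * |u| ^ (α - 1) := by
  rcases eq_or_ne u 0 with rfl | hu
  · simp only [add_zero, sub_self, mul_zero, norm_zero, abs_zero]
    exact mul_nonneg hH (Real.rpow_nonneg le_rfl _)
  · have hu' : 0 < |u| := abs_pos.2 hu
    rw [norm_mul, norm_inv, Real.rpow_sub_one hu'.ne', ← mul_div_assoc, div_eq_inv_mul]
    gcongr
    exact norm_le_norm_ofReal_sub

/-- Window and Hölder constant are left free, since both will depend on `z` near an endpoint. The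
last term is uniform in `Im z` because `|2 arctan| ≤ π`. -/
theorem norm_cauchyInt_le_of_holder {g : ℝ → ℂ} (hg : Integrable g) {z : ℂ} (hz : z.im ≠ 0)
    {ρ H α : ℝ} (hρ : 0 < ρ) (hα : 0 < α) (hH0 : 0 ≤ H)
    (hH : ∀ u, |u| ≤ ρ → ‖g (z.re + u) - g z.re‖ ≤ H * |u| ^ α) :
    ‖cauchyInt g z‖ ≤ (∫ t, {t : ℝ | ρ ≤ |t - z.re|}.indicator
        (fun t => ‖(t : ℂ) - z‖⁻¹ * ‖g t‖) t) + 2 * H * ρ ^ α / α + Real.pi * ‖g z.re‖ := by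
  rw [cauchyInt_decomposition hg hz hρ]
  refine (norm_add₃_le).trans ?_
  gcongr
  · refine (norm_integral_le_integral_norm _).trans (le_of_eq ?_)
    simp only [norm_indicator_eq_indicator_norm, norm_mul, norm_inv]
  · refine (intervalIntegral.norm_integral_le_of_norm_le (g := fun u => H * |u| ^ (α - 1))
      (by linarith) (Eventually.of_forall fun u hu => ?_) ?_).trans (le_of_eq ?_)
    · exact holder_kernel_le hH0 (hH u (abs_le.2 ⟨hu.1.le, hu.2⟩))
    · exact (((intervalIntegrable_abs_rpow hα (-ρ)).symm).trans
        (intervalIntegrable_abs_rpow hα ρ)).const_mul _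
    · rw [intervalIntegral.integral_const_mul, integral_abs_rpow hα hρ.le]
      ring
  · rw [norm_mul, norm_mul, Complex.norm_I, mul_one, Complex.norm_real, Real.norm_eq_abs, abs_mul,
      abs_two]
    gcongr
    have h1 := Real.arctan_lt_pi_div_two (ρ / z.im)
    have h2 := Real.neg_pi_div_two_lt_arctan (ρ / z.im)
    have : |Real.arctan (ρ / z.im)| ≤ Real.pi / 2 := abs_le.2 ⟨by linarith, by linarith⟩
    linarith

/-- The Sokhotski–Plemelj formula: the limits of the Cauchy integral along a filter of approach to
`x₀`, on which `arctan (ρ / Im z)` tends to `θ`. -/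
theorem exists_tendsto_cauchyInt {g : ℝ → ℂ} (hg : Integrable g) {x₀ ρ H α : ℝ} (hρ : 0 < ρ)
    (hα : 0 < α) (hH0 : 0 ≤ H)
    (hH : ∀ x, |x - x₀| < ρ → ∀ u, |u| ≤ ρ → ‖g (x + u) - g x‖ ≤ H * |u| ^ α) :
    ∃ v : ℂ, ∀ (l : Filter ℂ) (θ : ℝ), l.IsCountablyGenerated → l ≤ 𝓝 (x₀ : ℂ) →
      (∀ᶠ z in l, z.im ≠ 0) →
      Tendsto (fun z : ℂ => Real.arctan (ρ / z.im)) l (𝓝 θ) →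
      Tendsto (cauchyInt g) l (𝓝 (v + ((2 * θ : ℝ) : ℂ) * Complex.I * g x₀)) := by
  -- The candidate `v` is the decomposition at `Im z = 0`, in effect a principal value. It does not
  -- depend on the filter, so it is common to both half planes and cancels in the jump.
  refine ⟨(∫ t, {t : ℝ | ρ ≤ |t - x₀|}.indicator
        (fun t => ((t : ℂ) - x₀)⁻¹ * g t) t) +
      (∫ u in -ρ..ρ, ((u : ℂ) - (0 : ℝ) * Complex.I)⁻¹ * (g (x₀ + u) - g x₀)), ?_⟩
  intro l θ hcg hl him hθ
  have hre : Tendsto (fun z : ℂ => z.re) l (𝓝 x₀) := by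
    simpa using (Complex.continuous_re.tendsto (x₀ : ℂ)).mono_left hl
  have him0 : Tendsto (fun z : ℂ => z.im) l (𝓝 0) := by
    simpa using (Complex.continuous_im.tendsto (x₀ : ℂ)).mono_left hl
  have hnear : ∀ᶠ z in l, |z.re - x₀| < ρ := by
    have : Tendsto (fun z : ℂ => |z.re - x₀|) l (𝓝 |x₀ - x₀|) := (hre.sub_const x₀).abs
    rw [sub_self, abs_zero] at this
    exact this.eventually_lt_const hρ
  -- The window is centred at the moving point `Re z`, so the pointwise limits need continuity of
  -- `g` on a neighbourhood of `x₀`, not only at `x₀`.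
  have hgc : ∀ x, |x - x₀| < ρ → ContinuousAt g x := by
    intro x hx
    rw [ContinuousAt, tendsto_iff_norm_sub_tendsto_zero]
    have h1 : Tendsto (fun t => H * |t - x| ^ α) (𝓝 x) (𝓝 (H * |x - x| ^ α)) := by
      refine Tendsto.const_mul _ (Tendsto.rpow_const ?_ (Or.inr hα.le))
      exact Continuous.tendsto (by fun_prop) x
    rw [sub_self, abs_zero, Real.zero_rpow hα.ne', mul_zero] at h1
    refine squeeze_zero' (Eventually.of_forall fun _ => norm_nonneg _) ?_ h1
    have : ∀ᶠ t in 𝓝 x, |t - x| < ρ := by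
      have h2 : Tendsto (fun t => |t - x|) (𝓝 x) (𝓝 |x - x|) :=
        Continuous.tendsto (by fun_prop) x
      rw [sub_self, abs_zero] at h2
      exact h2.eventually_lt_const hρ
    filter_upwards [this] with t ht
    have := hH x hx (t - x) ht.le
    rwa [add_sub_cancel] at this
  have hg0 : Tendsto (fun z : ℂ => g z.re) l (𝓝 (g x₀)) :=
    (hgc x₀ (by simpa using hρ)).tendsto.comp hre
  have hsum : ∀ᶠ z in l, _ = cauchyInt g z :=
    him.mono fun z hz => (cauchyInt_decomposition hg hz hρ).symm
  refine Tendsto.congr' hsum (Tendsto.add (Tendsto.add ?_ ?_) ?_)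
  · refine tendsto_integral_filter_of_dominated_convergence (fun t => ρ⁻¹ * ‖g t‖)
      (Eventually.of_forall fun z => ?_) (Eventually.of_forall fun z => ?_) (hg.norm.const_mul _) ?_
    · exact ((measurable_cauchyKernel z).aestronglyMeasurable.mul hg.aestronglyMeasurable).indicator
        (measurableSet_le (by fun_prop) (by fun_prop))
    · refine Eventually.of_forall fun t => ?_
      by_cases ht : ρ ≤ |t - z.re|
      · rw [Set.indicator_of_mem (by exact ht), norm_mul, norm_inv]
        gcongr
        refine ht.trans ?_
        simpa using Complex.abs_re_le_norm ((t : ℂ) - z)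
      · rw [Set.indicator_of_notMem (by exact ht), norm_zero]
        positivity
    -- At the two rim points of the window the indicator need not converge; they form a null set.
    · have hae : ∀ᵐ t : ℝ, t ≠ x₀ + ρ ∧ t ≠ x₀ - ρ := by
        have h1 : ∀ c : ℝ, ∀ᵐ t : ℝ, t ≠ c := fun c => by
          rw [ae_iff]; simp
        exact (h1 _).and (h1 _)
      filter_upwards [hae] with t ht
      have habs : Tendsto (fun z : ℂ => |t - z.re|) l (𝓝 |t - x₀|) := (hre.const_sub t).abs
      rcases lt_trichotomy ρ |t - x₀| with h | h | h
      · rw [Set.indicator_of_mem (by exact h.le)]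
        have hev : ∀ᶠ z in l, ((t : ℂ) - z)⁻¹ * g t =
            {t : ℝ | ρ ≤ |t - z.re|}.indicator (fun t : ℝ => ((t : ℂ) - z)⁻¹ * g t) t := by
          filter_upwards [habs.eventually_const_lt h] with z hz
          rw [Set.indicator_of_mem (by exact hz.le)]
        refine Tendsto.congr' hev (Tendsto.mul_const _ (Tendsto.inv₀ ?_ ?_))
        · exact (Continuous.tendsto (by fun_prop : Continuous fun z : ℂ => (t : ℂ) - z)
            (x₀ : ℂ)).mono_left hl
        · intro h0
          rw [← Complex.ofReal_sub, Complex.ofReal_eq_zero] at h0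
          rw [h0, abs_zero] at h
          exact absurd h (not_lt.2 hρ.le)
      · exfalso
        rcases abs_choice (t - x₀) with h' | h'
        · exact ht.1 (by linarith)
        · exact ht.2 (by linarith)
      · rw [Set.indicator_of_notMem (by exact not_le.2 h)]
        refine tendsto_const_nhds.congr' ?_
        filter_upwards [habs.eventually_lt_const h] with z hz
        rw [Set.indicator_of_notMem (by exact not_le.2 hz)]
  · refine intervalIntegral.tendsto_integral_filter_of_dominated_convergence
      (fun u => H * |u| ^ (α - 1)) (Eventually.of_forall fun z => ?_) ?_ ?_ ?_
    · refine AEStronglyMeasurable.restrict ?_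
      refine (by fun_prop : Measurable fun u : ℝ => ((u : ℂ) - z.im * Complex.I)⁻¹
        ).aestronglyMeasurable.mul ?_
      exact (hg.comp_add_left z.re).aestronglyMeasurable.sub aestronglyMeasurable_const
    · filter_upwards [hnear] with z hz
      refine Eventually.of_forall fun u hu => ?_
      rw [Set.uIoc_of_le (by linarith)] at hu
      exact holder_kernel_le hH0 (hH _ hz u (abs_le.2 ⟨hu.1.le, hu.2⟩))
    · exact (((intervalIntegrable_abs_rpow hα (-ρ)).symm).trans
        (intervalIntegrable_abs_rpow hα ρ)).const_mul _
    · have h1 : ∀ c : ℝ, ∀ᵐ t : ℝ, t ≠ c := fun c => by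
        rw [ae_iff]; simp
      filter_upwards [h1 0, h1 ρ] with u hu0 huρ hu
      rw [Set.uIoc_of_le (by linarith)] at hu
      refine Tendsto.mul (Tendsto.inv₀ ?_ ?_) (Tendsto.sub ?_ hg0)
      · refine Tendsto.const_sub _ (Tendsto.mul_const _ ?_)
        exact (Complex.continuous_ofReal.tendsto _).comp him0
      · simpa using hu0
      · have hu' : |x₀ + u - x₀| < ρ := by
          rw [add_sub_cancel_left, abs_lt]
          exact ⟨hu.1, lt_of_le_of_ne hu.2 huρ⟩
        exact (hgc _ hu').tendsto.comp (hre.add_const u)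
  · refine Tendsto.mul (Tendsto.mul_const _ ?_) hg0
    exact (Complex.continuous_ofReal.tendsto _).comp (hθ.const_mul 2)

theorem tendsto_arctan_nhdsUpper {ρ : ℝ} (hρ : 0 < ρ) (x : ℝ) :
    Tendsto (fun z : ℂ => Real.arctan (ρ / z.im)) (nhdsUpper x) (𝓝 (Real.pi / 2)) := by
  refine (Real.tendsto_arctan_atTop.mono_right nhdsWithin_le_nhds).comp ?_
  simp only [div_eq_mul_inv]
  refine Tendsto.const_mul_atTop hρ (tendsto_inv_nhdsGT_zero.comp ?_)
  refine tendsto_nhdsWithin_iff.2 ⟨?_, eventually_mem_nhdsWithin⟩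
  simpa [nhdsUpper] using (Complex.continuous_im.tendsto (x : ℂ)).mono_left
    (nhdsWithin_le_nhds (s := {z : ℂ | 0 < z.im}))

theorem tendsto_arctan_nhdsLower {ρ : ℝ} (hρ : 0 < ρ) (x : ℝ) :
    Tendsto (fun z : ℂ => Real.arctan (ρ / z.im)) (nhdsLower x) (𝓝 (-(Real.pi / 2))) := by
  refine (Real.tendsto_arctan_atBot.mono_right nhdsWithin_le_nhds).comp ?_
  simp only [div_eq_mul_inv]
  refine Tendsto.const_mul_atBot hρ (tendsto_inv_nhdsLT_zero.comp ?_)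
  refine tendsto_nhdsWithin_iff.2 ⟨?_, eventually_mem_nhdsWithin⟩
  simpa [nhdsLower] using (Complex.continuous_im.tendsto (x : ℂ)).mono_left
    (nhdsWithin_le_nhds (s := {z : ℂ | z.im < 0}))

/-- The Sokhotski–Plemelj formula for the two half planes. -/
theorem exists_boundary_values_cauchyInt {g : ℝ → ℂ} (hg : Integrable g) {x₀ ρ H α : ℝ}
    (hρ : 0 < ρ) (hα : 0 < α) (hH0 : 0 ≤ H)
    (hH : ∀ x, |x - x₀| < ρ → ∀ u, |u| ≤ ρ → ‖g (x + u) - g x‖ ≤ H * |u| ^ α) :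
    ∃ vp vm : ℂ, Tendsto (cauchyInt g) (nhdsUpper x₀) (𝓝 vp) ∧
      Tendsto (cauchyInt g) (nhdsLower x₀) (𝓝 vm) ∧
      vp - vm = 2 * Real.pi * Complex.I * g x₀ := by
  obtain ⟨v, hv⟩ := exists_tendsto_cauchyInt hg hρ hα hH0 hH
  have hu := hv (nhdsUpper x₀) _ (by unfold nhdsUpper; infer_instance) nhdsWithin_le_nhds
    (eventually_mem_nhdsWithin.mono fun z hz => ne_of_gt hz) (tendsto_arctan_nhdsUpper hρ x₀)
  have hl := hv (nhdsLower x₀) _ (by unfold nhdsLower; infer_instance) nhdsWithin_le_nhds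
    (eventually_mem_nhdsWithin.mono fun z hz => ne_of_lt hz) (tendsto_arctan_nhdsLower hρ x₀)
  refine ⟨_, _, hu, hl, ?_⟩
  push_cast
  ring

/-! ### Boundedness at infinity -/

/-- Hölder continuity on a neighbourhood of `+∞`. -/
def HolderAtTop (g : ℝ → ℂ) : Prop :=
  ∃ r C α : ℝ, 0 < α ∧ 0 ≤ C ∧ ∀ s, r < s → ∀ t, r < t → ‖g s - g t‖ ≤ C * |s - t| ^ α

/-- A function with finite moments that is Hölder continuous near `+∞` decays there faster than
any power. -/
theorem HolderAtTop.exists_decay {g : ℝ → ℂ} (h : HolderAtTop g)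
    (hm : ∀ k : ℕ, Integrable fun t : ℝ => (t : ℂ) ^ k * g t) (k : ℕ) :
    ∃ R K : ℝ, 0 ≤ K ∧ ∀ x, R < x → x ^ k * ‖g x‖ ≤ K := by
  obtain ⟨r, C, α, hα, hC, hH⟩ := h
  obtain ⟨p, hp⟩ := exists_nat_ge ((k : ℝ) / α)
  rw [div_le_iff₀ hα] at hp
  set M := ∫ t : ℝ, ‖(t : ℂ) ^ (k + p) * g t‖ with hM
  have hM0 : 0 ≤ M := integral_nonneg fun _ => norm_nonneg _
  refine ⟨max r 1, M + C, by positivity, fun x hx => ?_⟩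
  -- `p ≥ k / α` was chosen so that an interval of length `δ = x^{-p}` has `x^k δ^α ≤ 1`: the
  -- oscillation of `g` on it is then negligible at order `k`.
  have hxr : r < x := (le_max_left _ _).trans_lt hx
  have hx1 : 1 < x := (le_max_right _ _).trans_lt hx
  have hx0 : 0 < x := by linarith
  set δ := (x ^ p)⁻¹ with hδ
  have hδ0 : 0 < δ := by positivity
  have hδα : x ^ k * δ ^ α ≤ 1 := by
    rw [hδ, Real.inv_rpow (by positivity), ← Real.rpow_natCast x p, ← Real.rpow_mul hx0.le,
      ← Real.rpow_natCast x k, ← div_eq_mul_inv, div_le_one (by positivity)]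
    exact Real.rpow_le_rpow_of_exponent_le hx1.le hp
  have hg : Integrable g := by simpa using hm 0
  -- Average over the short interval: `g x` differs from `g t` by at most `C δ^α`, and the mean of
  -- `‖g t‖` is controlled by the moment of order `k + p`, whose extra `p` powers pay for the
  -- division by `δ`.
  have h1 : ∫ t in Set.Ioc x (x + δ), ‖g x‖ ≤ ∫ t in Set.Ioc x (x + δ),
      ((x ^ (k + p))⁻¹ * ‖(t : ℂ) ^ (k + p) * g t‖ + C * δ ^ α) := by
    refine setIntegral_mono_on (integrableOn_const (by simp)) ?_ measurableSet_Ioc ?_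
    · exact ((hm (k + p)).norm.const_mul _).integrableOn.add (integrableOn_const (by simp))
    · intro t ht
      have ht0 : x < t := ht.1
      have h2 : ‖g x‖ ≤ ‖g t‖ + ‖g x - g t‖ := by
        have := norm_add_le (g t) (g x - g t)
        rwa [add_sub_cancel] at this
      refine h2.trans (add_le_add ?_ ((hH x hxr t (hxr.trans ht0)).trans ?_))
      · rw [norm_mul, norm_pow, Complex.norm_real, Real.norm_eq_abs, abs_of_pos (hx0.trans ht0),
          ← mul_assoc]
        refine le_mul_of_one_le_left (norm_nonneg _) ?_
        rw [← div_eq_inv_mul, one_le_div (by positivity)]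
        gcongr
      · gcongr
        rw [abs_sub_comm, abs_of_nonneg (by linarith)]
        linarith [ht.2]
  rw [integral_add ((hm (k + p)).norm.const_mul _).integrableOn (integrableOn_const (by simp)),
    setIntegral_const, setIntegral_const, integral_const_mul] at h1
  have h3 : ∫ t in Set.Ioc x (x + δ), ‖(t : ℂ) ^ (k + p) * g t‖ ≤ M :=
    setIntegral_le_integral (hm (k + p)).norm (Eventually.of_forall fun _ => norm_nonneg _)
  have hv : volume.real (Set.Ioc x (x + δ)) = δ := by simp [hδ0.le]
  rw [hv, smul_eq_mul, smul_eq_mul] at h1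
  have h4 : δ * ‖g x‖ ≤ (x ^ (k + p))⁻¹ * M + δ * (C * δ ^ α) :=
    h1.trans (by gcongr)
  have h5 : (x ^ (k + p))⁻¹ = (x ^ k)⁻¹ * δ := by rw [pow_add, mul_inv]
  have h6 : ‖g x‖ ≤ (x ^ k)⁻¹ * M + C * δ ^ α := by
    refine le_of_mul_le_mul_left (h4.trans (le_of_eq ?_)) hδ0
    rw [h5]; ring
  calc x ^ k * ‖g x‖ ≤ x ^ k * ((x ^ k)⁻¹ * M + C * δ ^ α) := by gcongr
    _ = M + C * (x ^ k * δ ^ α) := by field_simp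
    _ ≤ M + C * 1 := by gcongr
    _ = M + C := by ring

/-- The factor `t^m` could spoil uniform Hölder continuity. Interpolating between the Hölder bound
and rapid decay restores it with a smaller exponent, on windows of length one. -/
theorem HolderAtTop.exists_bound_pow_mul {g : ℝ → ℂ} (h : HolderAtTop g)
    (hm : ∀ k : ℕ, Integrable fun t : ℝ => (t : ℂ) ^ k * g t) (m : ℕ) :
    ∃ R K : ℝ, ∀ z : ℂ, z.im ≠ 0 → R < z.re →
      ‖cauchyInt (fun t : ℝ => (t : ℂ) ^ m * g t) z‖ ≤ K := by
  obtain ⟨R₁, K₁, hK₁, h₁⟩ := h.exists_decay hm m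
  obtain ⟨R₂, K₂, hK₂, h₂⟩ := h.exists_decay hm (2 * m)
  obtain ⟨r, C, α, hα, hC, hH⟩ := h
  -- Half the exponent is lost in the geometric mean taken below; the cap `1` accommodates the
  -- Lipschitz increment of `t^m`.
  set β := min (α / 2) 1 with hβ
  have hβ0 : 0 < β := lt_min (by linarith) one_pos
  set H := m * 4 ^ m * K₁ + Real.sqrt (C * (2 * 4 ^ m * K₂)) with hHdef
  have hH0 : 0 ≤ H := by positivity
  -- The added `1` keeps the whole window `|u| ≤ 1` beyond every threshold, and `x > 2` makes `x +
  -- u` comparable with `x`.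
  refine ⟨max (max R₁ R₂) (max r 1) + 1, (∫ t : ℝ, ‖(t : ℂ) ^ m * g t‖) +
    2 * H * 1 ^ β / β + Real.pi * K₁, fun z hz hx => ?_⟩
  set x := z.re with hxdef
  have hxR₁ : R₁ + 1 < x := by linarith [le_max_left (max R₁ R₂) (max r 1), le_max_left R₁ R₂]
  have hxR₂ : R₂ + 1 < x := by linarith [le_max_left (max R₁ R₂) (max r 1), le_max_right R₁ R₂]
  have hxr : r + 1 < x := by linarith [le_max_right (max R₁ R₂) (max r 1), le_max_left r 1]
  have hx2 : 2 < x := by linarith [le_max_right (max R₁ R₂) (max r 1), le_max_right r 1]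
  have hx0 : 0 < x := by linarith
  have hhalf : ∀ u : ℝ, |u| ≤ 1 → x / 2 ≤ x + u ∧ x + u ≤ 2 * x := fun u hu => by
    constructor <;> linarith [(abs_le.1 hu).1, (abs_le.1 hu).2]
  have hdec : ∀ u : ℝ, |u| ≤ 1 → ∀ (k : ℕ) (K : ℝ), (x + u) ^ k * ‖g (x + u)‖ ≤ K →
      x ^ k * ‖g (x + u)‖ ≤ 2 ^ k * K := fun u hu k K hK => by
    calc x ^ k * ‖g (x + u)‖ = 2 ^ k * ((x / 2) ^ k * ‖g (x + u)‖) := by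
          rw [div_pow]; field_simp
      _ ≤ 2 ^ k * ((x + u) ^ k * ‖g (x + u)‖) := by
          have := (hhalf u hu).1
          gcongr
      _ ≤ _ := by gcongr
  refine (norm_cauchyInt_le_of_holder (hm m) hz (ρ := 1) (H := H) (α := β) one_pos hβ0 hH0
    fun u hu => ?_).trans ?_
  · rw [← hxdef]
    have hu1 := (abs_le.1 hu).1
    have hpow : |u| ≤ |u| ^ β := by
      simpa using Real.rpow_le_rpow_of_exponent_ge' (abs_nonneg u) hu hβ0.le (min_le_right (α / 2) 1)
    have hpow' : |u| ^ (α / 2) ≤ |u| ^ β :=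
      Real.rpow_le_rpow_of_exponent_ge' (abs_nonneg u) hu hβ0.le (min_le_left (α / 2) 1)
    have e1 : ((x + u : ℝ) : ℂ) ^ m * g (x + u) - (x : ℂ) ^ m * g x =
        (((x + u) ^ m - x ^ m : ℝ) : ℂ) * g (x + u) + (x : ℂ) ^ m * (g (x + u) - g x) := by
      push_cast; ring
    rw [e1]
    have a1 : ‖(((x + u) ^ m - x ^ m : ℝ) : ℂ) * g (x + u)‖ ≤ m * 4 ^ m * K₁ * |u| ^ β := by
      rw [norm_mul, Complex.norm_real, Real.norm_eq_abs]
      have b1 := abs_pow_sub_pow_le (x + u) x m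
      have b2 : max |x + u| |x| ≤ 2 * x := by
        rw [abs_of_pos hx0, abs_of_nonneg (by linarith)]
        exact max_le (hhalf u hu).2 (by linarith)
      have b3 : max |x + u| |x| ^ (m - 1) ≤ (2 * x) ^ m :=
        (pow_le_pow_left₀ (by positivity) b2 _).trans
          (pow_le_pow_right₀ (by linarith) (Nat.sub_le _ _))
      rw [add_sub_cancel_left] at b1
      calc |(x + u) ^ m - x ^ m| * ‖g (x + u)‖
          ≤ |u| * m * (2 * x) ^ m * ‖g (x + u)‖ := by
            gcongr
            exact b1.trans (by gcongr)
        _ = m * 2 ^ m * (x ^ m * ‖g (x + u)‖) * |u| := by rw [mul_pow]; ring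
        _ ≤ m * 2 ^ m * (2 ^ m * K₁) * |u| ^ β := by
            have := hdec u hu m K₁ (h₁ _ (by linarith))
            gcongr
        _ = m * (2 ^ m * 2 ^ m) * K₁ * |u| ^ β := by ring
        _ = m * 4 ^ m * K₁ * |u| ^ β := by rw [← mul_pow]; norm_num
    have a2 : ‖(x : ℂ) ^ m * (g (x + u) - g x)‖ ≤
        Real.sqrt (C * (2 * 4 ^ m * K₂)) * |u| ^ β := by
      rw [norm_mul, norm_pow, Complex.norm_real, Real.norm_eq_abs, abs_of_pos hx0]
      have b1 : ‖g (x + u) - g x‖ ≤ C * |u| ^ α := by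
        have := hH (x + u) (by linarith) x (by linarith)
        rwa [add_sub_cancel_left] at this
      have b2 : x ^ (2 * m) * ‖g (x + u) - g x‖ ≤ 2 * 4 ^ m * K₂ := by
        have c1 := hdec u hu (2 * m) K₂ (h₂ _ (by linarith))
        have c2 := hdec 0 (by simp) (2 * m) K₂ (h₂ _ (by linarith))
        rw [add_zero] at c2
        calc x ^ (2 * m) * ‖g (x + u) - g x‖ ≤ x ^ (2 * m) * (‖g (x + u)‖ + ‖g x‖) := by
              gcongr; exact norm_sub_le _ _
          _ ≤ 2 ^ (2 * m) * K₂ + 2 ^ (2 * m) * K₂ := by rw [mul_add]; gcongr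
          _ = 2 * 4 ^ m * K₂ := by rw [pow_mul]; norm_num; ring
      -- Geometric mean: the square of `x^m ‖Δg‖` is `x^{2m} ‖Δg‖`, bounded by decay of order `2m`,
      -- times `‖Δg‖`, bounded by Hölder continuity.
      refine le_trans ?_ (mul_le_mul_of_nonneg_left hpow' (Real.sqrt_nonneg _))
      have e2 : |u| ^ (α / 2) = Real.sqrt (|u| ^ α) := by
        rw [Real.sqrt_eq_rpow, ← Real.rpow_mul (abs_nonneg u)]; ring_nf
      rw [e2, ← Real.sqrt_mul (by positivity)]
      refine Real.le_sqrt_of_sq_le ?_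
      calc (x ^ m * ‖g (x + u) - g x‖) ^ 2
          = (x ^ (2 * m) * ‖g (x + u) - g x‖) * ‖g (x + u) - g x‖ := by ring
        _ ≤ (2 * 4 ^ m * K₂) * (C * |u| ^ α) := by gcongr
        _ = _ := by ring
    calc _ ≤ _ := norm_add_le _ _
      _ ≤ _ := add_le_add a1 a2
      _ = H * |u| ^ β := by rw [hHdef]; ring
  · rw [← hxdef]
    refine add_le_add (add_le_add ?_ le_rfl) (mul_le_mul_of_nonneg_left ?_ Real.pi_nonneg)
    · refine integral_mono_of_nonneg (Eventually.of_forall fun t => ?_) (hm m).norm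
        (Eventually.of_forall fun t => ?_)
      · exact Set.indicator_nonneg (fun t _ => by positivity) t
      · refine Set.indicator_apply_le' (fun ht => ?_) (fun _ => norm_nonneg _)
        refine mul_le_of_le_one_left (norm_nonneg _) (inv_le_one_of_one_le₀ ?_)
        exact (show 1 ≤ |t - x| from ht).trans
          (by simpa using Complex.abs_re_le_norm ((t : ℂ) - z))
    · rw [norm_mul, norm_pow, Complex.norm_real, Real.norm_eq_abs, abs_of_pos hx0]
      exact h₁ x (by linarith)

theorem cauchyInt_comp_neg (g : ℝ → ℂ) (z : ℂ) :
    cauchyInt (fun t => g (-t)) z = -cauchyInt g (-z) := by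
  rw [cauchyInt, cauchyInt, ← integral_neg, ← integral_neg_eq_self]
  refine integral_congr_ae (Eventually.of_forall fun t => ?_)
  simp only [neg_neg, Complex.ofReal_neg, sub_neg_eq_add, ← neg_mul, ← inv_neg, neg_add]
  rfl

theorem cauchyInt_const_mul (c : ℂ) (g : ℝ → ℂ) (z : ℂ) :
    cauchyInt (fun t => c * g t) z = c * cauchyInt g z := by
  rw [cauchyInt, cauchyInt, ← integral_const_mul]
  refine integral_congr_ae (Eventually.of_forall fun t => ?_)
  simp only
  ring

theorem moments_comp_neg {g : ℝ → ℂ} (hm : ∀ k : ℕ, Integrable fun t : ℝ => (t : ℂ) ^ k * g t)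
    (k : ℕ) : Integrable fun t : ℝ => (t : ℂ) ^ k * g (-t) := by
  refine ((hm k).comp_neg.const_mul ((-1) ^ k)).congr (Eventually.of_forall fun t => ?_)
  simp only [Complex.ofReal_neg]
  rw [← mul_assoc, ← mul_pow]
  simp

/-- A real point off the cut lies beyond a finite endpoint, and its size forces a gap of one. An
infinite endpoint contributes `toReal = 0` to the threshold, which is harmless. -/
theorem compl_cut_real_cases {a b : EReal} (hab : a < b) {z : ℂ} (hz : z ∈ (cut a b)ᶜ)
    (him : z.im = 0) (hn : |a.toReal| + |b.toReal| + 1 < ‖z‖) :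
    ∀ t ∈ interval a b, 1 ≤ ‖(t : ℂ) - z‖ := by
  intro t ht
  have hzr : (z.re : ℂ) = z := by apply Complex.ext <;> simp [him]
  rw [← hzr, Complex.norm_real, Real.norm_eq_abs] at hn
  rw [← hzr, ← Complex.ofReal_sub, Complex.norm_real, Real.norm_eq_abs]
  have hcase : ((z.re : ℝ) : EReal) < a ∨ b < ((z.re : ℝ) : EReal) := by
    by_contra! h
    exact hz ⟨him, h.1, h.2⟩
  rcases hcase with h | h
  · induction a using EReal.rec with
    | bot => exact absurd h not_lt_bot
    | top => exact absurd hab not_top_lt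
    | coe a =>
      have h1 : z.re < a := by exact_mod_cast h
      have h2 : a < t := by exact_mod_cast ht.1
      rw [EReal.toReal_coe] at hn
      have := neg_abs_le a
      have := abs_nonneg b.toReal
      have h3 : z.re < 0 := by
        by_contra! h3
        rw [abs_of_nonneg h3] at hn
        linarith [le_abs_self a]
      rw [abs_of_neg h3] at hn
      rw [abs_of_nonneg] <;> linarith
  · induction b using EReal.rec with
    | top => exact absurd h not_top_lt
    | bot => exact absurd hab not_lt_bot
    | coe b =>
      have h1 : b < z.re := by exact_mod_cast h
      have h2 : t < b := by exact_mod_cast ht.2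
      rw [EReal.toReal_coe] at hn
      have := le_abs_self b
      have := abs_nonneg a.toReal
      have h3 : 0 < z.re := by
        by_contra! h3
        rw [abs_of_nonpos h3] at hn
        linarith [neg_abs_le b]
      rw [abs_of_pos h3] at hn
      rw [abs_of_nonpos] <;> linarith

/-- The Cauchy integrals of `t ^ m * g t` are bounded near infinity off the cut. -/
theorem cauchyInt_pow_mul_isBigO {a b : EReal} (hab : a < b) {g : ℝ → ℂ}
    (hm : ∀ k : ℕ, Integrable fun t : ℝ => (t : ℂ) ^ k * g t)
    (hs : ∀ t, t ∉ interval a b → g t = 0) (ht : HolderAtTop g)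
    (hb : HolderAtTop fun t => g (-t)) (m : ℕ) :
    cauchyInt (fun t : ℝ => (t : ℂ) ^ m * g t) =O[atInfty a b] (fun _ => (1 : ℝ)) := by
  obtain ⟨R₁, K₁, h₁⟩ := ht.exists_bound_pow_mul hm m
  obtain ⟨R₂, K₂, h₂⟩ := hb.exists_bound_pow_mul (moments_comp_neg hm) m
  set M := ∫ t : ℝ, ‖(t : ℂ) ^ m * g t‖
  refine IsBigO.of_bound (max M (max K₁ K₂)) ?_
  have hbig : ∀ᶠ z in atInfty a b, max (|a.toReal| + |b.toReal| + 1) (max R₁ R₂ + 1) < ‖z‖ :=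
    (tendsto_norm_cobounded_atTop.mono_left inf_le_left).eventually_gt_atTop _
  have hcut : ∀ᶠ z in atInfty a b, z ∈ (cut a b)ᶜ := mem_inf_of_right (mem_principal_self _)
  filter_upwards [hbig, hcut] with z hz hzc
  rw [norm_one, mul_one]
  have hone : (∀ t : ℝ, (t : ℂ) ^ m * g t ≠ 0 → 1 ≤ ‖(t : ℂ) - z‖) →
      ‖cauchyInt (fun t : ℝ => (t : ℂ) ^ m * g t) z‖ ≤ max M (max K₁ K₂) := fun h => by
    refine le_trans ?_ (le_max_left _ _)
    have h' := norm_cauchyInt_le (hm m) one_pos h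
    rwa [inv_one, one_mul] at h'
  -- Real points and points with `|Im z| ≥ 1` are at distance at least one from the support. In the
  -- remaining strip `|Re z|` is large, and the Hölder bound applies directly or after reflection.
  by_cases him : z.im = 0
  · refine hone fun t ht0 => compl_cut_real_cases hab hzc him ((le_max_left _ _).trans_lt hz) t ?_
    by_contra h
    exact ht0 (by rw [hs t h, mul_zero])
  by_cases him1 : 1 ≤ |z.im|
  · exact hone fun t _ => him1.trans (by simpa using Complex.abs_im_le_norm ((t : ℂ) - z))
  have hre : max R₁ R₂ < |z.re| := by
    have h1 := Complex.norm_le_abs_re_add_abs_im z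
    have h2 := (le_max_right _ _).trans_lt hz
    linarith
  rcases abs_choice z.re with h | h
  · refine (h₁ z him ?_).trans ((le_max_left _ _).trans (le_max_right _ _))
    rw [h] at hre
    exact (le_max_left _ _).trans_lt hre
  · have h3 := h₂ (-z) (by simpa using him) (by
      rw [h] at hre
      simpa using (le_max_right _ _).trans_lt hre)
    refine le_trans (le_of_eq ?_) (h3.trans ((le_max_right _ _).trans (le_max_right _ _)))
    have h4 := cauchyInt_comp_neg (fun t : ℝ => (t : ℂ) ^ m * g (t)) (-z)
    rw [neg_neg] at h4
    rw [← norm_neg, ← h4]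
    have h5 : (fun t : ℝ => ((-t : ℝ) : ℂ) ^ m * g (-t)) =
        fun t : ℝ => (-1) ^ m * ((t : ℂ) ^ m * g (-t)) := by
      funext t
      rw [← mul_assoc, ← mul_pow]
      simp
    rw [h5, cauchyInt_const_mul, norm_mul, norm_pow, norm_neg, norm_one, one_pow, one_mul]

/-! ### Growth at a finite endpoint -/

/-- The absolute value of `hfun`, as a function of the distance to the endpoint. -/
noncomputable def hdist (γ d : ℝ) : ℝ :=
  if γ < 0 then d ^ γ else if γ = 0 then |Real.log d| else 1

theorem norm_hfun (γ c : ℝ) (z : ℂ) : ‖hfun γ c z‖ = hdist γ ‖z - c‖ := by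
  unfold hfun hdist
  split_ifs
  · rw [Real.norm_eq_abs, abs_of_nonneg (Real.rpow_nonneg (norm_nonneg _) _)]
  · rfl
  · simp

/-- Below `e⁻¹` the logarithm is at most `-1`, so constants can be absorbed into `h` for every sign
of `γ`. -/
theorem one_le_hdist {γ d : ℝ} (hd : 0 < d) (hd' : d < Real.exp (-1)) : 1 ≤ hdist γ d := by
  have hd1 : d ≤ 1 := hd'.le.trans (Real.exp_le_one_iff.2 (by norm_num))
  unfold hdist
  split_ifs with h1 h2
  · exact Real.one_le_rpow_of_pos_of_le_one_of_nonpos hd hd1 h1.le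
  · have h3 := Real.log_lt_log hd hd'
    rw [Real.log_exp] at h3
    rw [abs_of_neg (by linarith)]
    linarith
  · exact le_rfl

theorem rpow_le_hdist {γ d : ℝ} (hd : 0 < d) (hd' : d < Real.exp (-1)) : d ^ γ ≤ hdist γ d := by
  have hd1 : d ≤ 1 := hd'.le.trans (Real.exp_le_one_iff.2 (by norm_num))
  rcases lt_or_ge γ 0 with h | h
  · simp [hdist, h]
  · exact (Real.rpow_le_one hd.le hd1 h).trans (one_le_hdist hd hd')

/-- This integral is the origin of `h`: its size is `d^γ`, `|log d|` or a constant according to the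
sign of `γ`. -/
theorem integral_rpow_sub_one_le_hdist {γ δ : ℝ} (hδ : 0 < δ) :
    ∃ K : ℝ, 0 ≤ K ∧ ∀ d, 0 < d → d < Real.exp (-1) → d ≤ δ →
      ∫ t in d..δ, t ^ (γ - 1) ≤ K * hdist γ d := by
  rcases eq_or_ne γ 0 with rfl | hγ
  · refine ⟨|Real.log δ| + 1, by positivity, fun d hd hd' hdδ => ?_⟩
    have h1 : ∀ t : ℝ, t ^ ((0 : ℝ) - 1) = t⁻¹ := fun t => by
      rw [zero_sub, Real.rpow_neg_one]
    have h2 := one_le_hdist (γ := 0) hd hd'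
    simp only [h1]
    rw [integral_inv_of_pos hd hδ, Real.log_div hδ.ne' hd.ne']
    have h3 : hdist 0 d = |Real.log d| := by simp [hdist]
    rw [h3] at h2 ⊢
    have h4 := le_abs_self (Real.log δ)
    have h5 := neg_abs_le (Real.log d)
    have h6 := mul_le_mul_of_nonneg_left h2 (abs_nonneg (Real.log δ))
    linarith
  · refine ⟨(1 + δ ^ γ) / |γ|, by positivity, fun d hd hd' hdδ => ?_⟩
    have h2 := one_le_hdist (γ := γ) hd hd'
    have h3 := rpow_le_hdist (γ := γ) hd hd'
    have hδγ : 0 ≤ δ ^ γ := Real.rpow_nonneg hδ.le _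
    have hdγ : 0 ≤ d ^ γ := Real.rpow_nonneg hd.le _
    rw [integral_rpow (Or.inr ⟨by intro h; exact hγ (by linarith), by
      rw [Set.uIcc_of_le hdδ]; intro h; linarith [h.1]⟩), sub_add_cancel]
    refine (le_abs_self _).trans ?_
    rw [abs_div, div_mul_eq_mul_div]
    gcongr
    rw [abs_le]
    constructor <;> nlinarith

/-- The data of a density with an algebraic singularity at the left endpoint `0` of its support:
`g t = t ^ γ * w t` near `0` with `w` bounded and Hölder continuous. -/
structure EndpointData (g w : ℝ → ℂ) (γ δ B H α : ℝ) : Prop where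
  integrable : Integrable g
  support : ∀ t, t ≤ 0 → g t = 0
  gamma : -1 < γ
  delta : 0 < δ
  B_nonneg : 0 ≤ B
  H_nonneg : 0 ≤ H
  alpha : 0 < α
  alpha_le : α ≤ 1
  eq : ∀ t, 0 < t → t ≤ δ → g t = ((t ^ γ : ℝ) : ℂ) * w t
  bound : ∀ t, 0 < t → t ≤ δ → ‖w t‖ ≤ B
  holder : ∀ s t, 0 < s → s ≤ δ → 0 < t → t ≤ δ → ‖w s - w t‖ ≤ H * |s - t| ^ α

section EndpointData

variable {g w : ℝ → ℂ} {γ δ B H α : ℝ}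

theorem EndpointData.norm_le (h : EndpointData g w γ δ B H α) {t : ℝ} (ht : 0 < t) (htδ : t ≤ δ) :
    ‖g t‖ ≤ B * t ^ γ := by
  rw [h.eq t ht htδ, norm_mul, Complex.norm_real, Real.norm_eq_abs,
    abs_of_nonneg (Real.rpow_nonneg ht.le _), mul_comm]
  gcongr
  exact h.bound t ht htδ

/-- Where `|t - z|` is comparable with `max t |z|`, the kernel is at most a multiple of `1/|z|` for
`t ≤ |z|`, of `1/t` up to `δ`, and of `1/δ` beyond. The three ranges give `|z|^γ`, the integral of
`t^{γ-1}`, and a constant, all bounded by `h`. -/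
theorem EndpointData.exists_outer_bound (h : EndpointData g w γ δ B H α) :
    ∃ K : ℝ, 0 ≤ K ∧ ∀ (z : ℂ) (S : Set ℝ), 0 < ‖z‖ → ‖z‖ < Real.exp (-1) → ‖z‖ ≤ δ →
      (∀ t ∈ S, 0 < t → max t ‖z‖ ≤ 4 * ‖(t : ℂ) - z‖) →
      ∫ t, S.indicator (fun t => ‖(t : ℂ) - z‖⁻¹ * ‖g t‖) t ≤ K * hdist γ ‖z‖ := by
  obtain ⟨K₁, hK₁, h₁⟩ := integral_rpow_sub_one_le_hdist (γ := γ) h.delta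
  have hδ := h.delta
  have hγ := h.gamma
  have hB := h.B_nonneg
  have hγ1 : 0 < γ + 1 := by linarith
  refine ⟨4 * (B / (γ + 1) + B * K₁ + δ⁻¹ * ∫ t, ‖g t‖), ?_, fun z S hz hz' hzδ hS => ?_⟩
  · have := integral_nonneg (μ := volume) (f := fun t => ‖g t‖) fun _ => norm_nonneg _
    positivity
  set d := ‖z‖ with hd
  set φ₁ : ℝ → ℝ := (Set.Ioc 0 d).indicator fun t => B * d⁻¹ * t ^ γ with hφ₁
  set φ₂ : ℝ → ℝ := (Set.Ioc d δ).indicator fun t => B * t ^ (γ - 1) with hφ₂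
  have i₁ : IntegrableOn (fun t : ℝ => B * d⁻¹ * t ^ γ) (Set.Ioc 0 d) := by
    rw [← intervalIntegrable_iff_integrableOn_Ioc_of_le hz.le]
    exact (intervalIntegral.intervalIntegrable_rpow' hγ).const_mul _
  have i₂ : IntegrableOn (fun t : ℝ => B * t ^ (γ - 1)) (Set.Ioc d δ) := by
    rw [← intervalIntegrable_iff_integrableOn_Ioc_of_le hzδ]
    refine (intervalIntegral.intervalIntegrable_rpow (Or.inr ?_)).const_mul _
    rw [Set.uIcc_of_le hzδ]
    exact fun h0 => absurd h0.1 (not_le.2 hz)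
  have j₁ : Integrable φ₁ := i₁.integrable_indicator measurableSet_Ioc
  have j₂ : Integrable φ₂ := i₂.integrable_indicator measurableSet_Ioc
  have j₃ : Integrable fun t => δ⁻¹ * ‖g t‖ := h.integrable.norm.const_mul _
  have hφ₁0 : ∀ t, 0 ≤ φ₁ t := fun t => Set.indicator_nonneg
    (fun t ht => mul_nonneg (by positivity) (Real.rpow_nonneg ht.1.le _)) t
  have hφ₂0 : ∀ t, 0 ≤ φ₂ t := fun t => Set.indicator_nonneg
    (fun t ht => mul_nonneg (by positivity) (Real.rpow_nonneg (hz.trans ht.1).le _)) t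
  have hle : ∀ t, S.indicator (fun t => ‖(t : ℂ) - z‖⁻¹ * ‖g t‖) t ≤
      4 * (φ₁ t + φ₂ t + δ⁻¹ * ‖g t‖) := by
    intro t
    have hnn : 0 ≤ 4 * (φ₁ t + φ₂ t + δ⁻¹ * ‖g t‖) := by
      have := hφ₁0 t; have := hφ₂0 t; positivity
    refine Set.indicator_apply_le' (fun ht => ?_) (fun _ => hnn)
    rcases le_or_gt t 0 with ht0 | ht0
    · simpa [h.support t ht0] using hnn
    have hmax := hS t ht ht0
    have hmax0 : 0 < max t d := lt_max_of_lt_left ht0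
    have hinv : ‖(t : ℂ) - z‖⁻¹ ≤ 4 * (max t d)⁻¹ := by
      rw [inv_le_comm₀ (by linarith) (by positivity), mul_inv, inv_inv]
      linarith
    refine (mul_le_mul_of_nonneg_right hinv (norm_nonneg _)).trans ?_
    rw [mul_assoc]
    gcongr
    rcases le_or_gt t d with htd | htd
    · have e1 : φ₁ t = B * d⁻¹ * t ^ γ :=
        Set.indicator_of_mem (show t ∈ Set.Ioc 0 d from ⟨ht0, htd⟩) _
      rw [max_eq_right htd]
      have e2 := h.norm_le ht0 (htd.trans hzδ)
      have e3 := mul_le_mul_of_nonneg_left e2 (inv_nonneg.2 hz.le)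
      have e4 : 0 ≤ δ⁻¹ * ‖g t‖ := by positivity
      rw [e1]
      linarith [hφ₂0 t]
    · rw [max_eq_left htd.le]
      rcases le_or_gt t δ with htδ | htδ
      · have e1 : φ₂ t = B * t ^ (γ - 1) :=
          Set.indicator_of_mem (show t ∈ Set.Ioc d δ from ⟨htd, htδ⟩) _
        have e2 := mul_le_mul_of_nonneg_left (h.norm_le ht0 htδ) (inv_nonneg.2 ht0.le)
        have e4 : 0 ≤ δ⁻¹ * ‖g t‖ := by positivity
        rw [e1, Real.rpow_sub_one ht0.ne']
        have e5 : t⁻¹ * (B * t ^ γ) = B * (t ^ γ / t) := by field_simp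
        linarith [hφ₁0 t]
      · have e2 : t⁻¹ * ‖g t‖ ≤ δ⁻¹ * ‖g t‖ := by gcongr
        linarith [hφ₁0 t, hφ₂0 t]
  refine (integral_mono_of_nonneg (Eventually.of_forall fun t => ?_)
    (((j₁.add j₂).add j₃).const_mul 4) (Eventually.of_forall hle)).trans ?_
  · exact Set.indicator_nonneg (fun t _ => by positivity) t
  simp only [Pi.add_apply]
  have v₁ : ∫ t, φ₁ t = B / (γ + 1) * d ^ γ := by
    rw [hφ₁, integral_indicator measurableSet_Ioc, ← intervalIntegral.integral_of_le hz.le,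
      intervalIntegral.integral_const_mul, integral_rpow (Or.inl hγ), Real.zero_rpow hγ1.ne',
      Real.rpow_add_one hz.ne']
    field_simp
    ring
  have v₂ : ∫ t, φ₂ t ≤ B * (K₁ * hdist γ d) := by
    rw [hφ₂, integral_indicator measurableSet_Ioc, ← intervalIntegral.integral_of_le hzδ,
      intervalIntegral.integral_const_mul]
    gcongr
    exact h₁ d hz hz' hzδ
  have hs := integral_add (j₁.add j₂) j₃
  have hs' := integral_add j₁ j₂
  simp only [Pi.add_apply] at hs hs'
  rw [integral_const_mul, hs, hs', integral_const_mul, v₁]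
  have e1 := mul_le_mul_of_nonneg_left (rpow_le_hdist (γ := γ) hz hz')
    (by positivity : 0 ≤ B / (γ + 1))
  have e2 := mul_le_mul_of_nonneg_left (one_le_hdist (γ := γ) hz hz')
    (by positivity : 0 ≤ δ⁻¹ * ∫ t, ‖g t‖)
  linarith

theorem exists_lipschitz_rpow_one (γ : ℝ) : ∃ L : ℝ, 0 ≤ L ∧ ∀ s : ℝ, |s| ≤ 1 / 2 →
    |(1 + s) ^ γ - 1| ≤ L * |s| := by
  have hc : ContDiffOn ℝ 1 (fun s : ℝ => (1 + s) ^ γ) (Set.Icc (-(1 / 2)) (1 / 2)) := by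
    refine ContDiffOn.rpow_const_of_ne (by fun_prop) fun s hs => ?_
    have := hs.1
    intro h
    linarith
  obtain ⟨K, hK⟩ := hc.exists_lipschitzOnWith one_ne_zero (convex_Icc _ _) isCompact_Icc
  refine ⟨K, K.2, fun s hs => ?_⟩
  have := hK.dist_le_mul s (abs_le.1 hs) 0 (by constructor <;> norm_num)
  simpa [Real.dist_eq] using this

/-- By homogeneity of `t^γ`, a window of relative size one half around `x` sees a Hölder constant of
order `x^{γ-α}`. -/
theorem EndpointData.exists_scaled_holder (h : EndpointData g w γ δ B H α) :
    ∃ H' : ℝ, 0 ≤ H' ∧ ∀ x u : ℝ, 0 < x → x ≤ 1 → 2 * x ≤ δ → |u| ≤ x / 2 →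
      ‖g (x + u) - g x‖ ≤ H' * x ^ (γ - α) * |u| ^ α := by
  obtain ⟨L, hL, hLs⟩ := exists_lipschitz_rpow_one γ
  have hB := h.B_nonneg
  have hH := h.H_nonneg
  refine ⟨L * B + H, by positivity, fun x u hx hx1 hxδ hu => ?_⟩
  have hu1 := (abs_le.1 hu).1
  have hu2 := (abs_le.1 hu).2
  have hxu : 0 < x + u := by linarith
  have hxuδ : x + u ≤ δ := by linarith
  have hxγ : 0 ≤ x ^ γ := Real.rpow_nonneg hx.le _
  rw [h.eq _ hxu hxuδ, h.eq x hx (by linarith)]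
  have e1 : (((x + u) ^ γ : ℝ) : ℂ) * w (x + u) - ((x ^ γ : ℝ) : ℂ) * w x =
      (((x + u) ^ γ - x ^ γ : ℝ) : ℂ) * w (x + u) + ((x ^ γ : ℝ) : ℂ) * (w (x + u) - w x) := by
    push_cast; ring
  have hux : |u / x| ≤ 1 / 2 := by
    rw [abs_div, abs_of_pos hx, div_le_iff₀ hx]; linarith
  have e2 : |(x + u) ^ γ - x ^ γ| ≤ L * (x ^ (γ - α) * |u| ^ α) := by
    have f1 : x + u = x * (1 + u / x) := by field_simp
    have f2 : (0 : ℝ) ≤ 1 + u / x := by linarith [(abs_le.1 hux).1]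
    rw [f1, Real.mul_rpow hx.le f2]
    have f3 : x ^ γ * (1 + u / x) ^ γ - x ^ γ = x ^ γ * ((1 + u / x) ^ γ - 1) := by ring
    rw [f3, abs_mul, abs_of_nonneg hxγ]
    -- The Lipschitz bound for `(1 + s)^γ` is weakened to exponent `α`; this is where `α ≤ 1` is
    -- needed.
    have f4 : |u / x| ≤ |u / x| ^ α := by
      simpa using Real.rpow_le_rpow_of_exponent_ge' (abs_nonneg (u / x)) (by linarith)
        h.alpha.le h.alpha_le
    have f5 : x ^ γ * |u / x| ^ α = x ^ (γ - α) * |u| ^ α := by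
      rw [abs_div, abs_of_pos hx, Real.div_rpow (abs_nonneg _) hx.le, Real.rpow_sub hx]
      ring
    calc x ^ γ * |(1 + u / x) ^ γ - 1| ≤ x ^ γ * (L * |u / x| ^ α) := by
          gcongr
          exact (hLs _ hux).trans (by gcongr)
      _ = L * (x ^ γ * |u / x| ^ α) := by ring
      _ = _ := by rw [f5]
  have e3 : x ^ γ ≤ x ^ (γ - α) :=
    Real.rpow_le_rpow_of_exponent_ge hx hx1 (by linarith [h.alpha])
  have e4 := h.holder (x + u) x hxu hxuδ hx (by linarith)
  rw [add_sub_cancel_left] at e4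
  rw [e1]
  refine (norm_add_le _ _).trans ?_
  rw [norm_mul, norm_mul, Complex.norm_real, Complex.norm_real, Real.norm_eq_abs, Real.norm_eq_abs,
    abs_of_nonneg hxγ]
  calc _ ≤ L * (x ^ (γ - α) * |u| ^ α) * B + x ^ (γ - α) * (H * |u| ^ α) := by
        have := h.bound _ hxu hxuδ
        gcongr
    _ = _ := by ring

/-- Away from a sector about the positive axis, `|t - z|² ≥ t² - t|z| + |z|²`, which controls both
`t²` and `|z|²`. -/
theorem max_le_of_re_le {z : ℂ} (hz : z.re ≤ ‖z‖ / 2) {t : ℝ} (ht : 0 < t) :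
    max t ‖z‖ ≤ 4 * ‖(t : ℂ) - z‖ := by
  have e1 : ‖(t : ℂ) - z‖ ^ 2 = t ^ 2 - 2 * t * z.re + ‖z‖ ^ 2 := by
    rw [Complex.sq_norm, Complex.sq_norm, Complex.normSq_apply, Complex.normSq_apply]
    simp
    ring
  have hn := norm_nonneg z
  have hn' := norm_nonneg ((t : ℂ) - z)
  refine max_le ?_ ?_ <;> refine abs_le_of_sq_le_sq' ?_ (by positivity) |>.2 <;>
    nlinarith [sq_nonneg (t - ‖z‖), mul_nonneg ht.le (sub_nonneg.2 hz)]

theorem max_le_of_lt_re {z : ℂ} (hz : ‖z‖ / 2 < z.re) {t : ℝ} (ht : z.re / 2 ≤ |t - z.re|) :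
    max t ‖z‖ ≤ 4 * ‖(t : ℂ) - z‖ := by
  have h1 : |t - z.re| ≤ ‖(t : ℂ) - z‖ := by simpa using Complex.abs_re_le_norm ((t : ℂ) - z)
  have h2 := le_abs_self (t - z.re)
  refine max_le ?_ ?_ <;> linarith [norm_nonneg z]

/-- Outside the sector `Re z > |z|/2` the whole integral falls under the outer bound. Inside it a
window of half-width `Re z / 2` is removed: the local terms scale as `(Re z)^{γ-α} (Re z)^α` and
`(Re z)^γ`, both of order `|z|^γ`. -/
theorem EndpointData.exists_bound (h : EndpointData g w γ δ B H α) :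
    ∃ K ε : ℝ, 0 < ε ∧ ∀ z : ℂ, ‖z‖ < ε → (z.im ≠ 0 ∨ z.re < 0) →
      ‖cauchyInt g z‖ ≤ K * hdist γ ‖z‖ := by
  obtain ⟨K, hK, hout⟩ := h.exists_outer_bound
  obtain ⟨H', hH', hhol⟩ := h.exists_scaled_holder
  have hδ := h.delta
  have hα := h.alpha
  have hB := h.B_nonneg
  -- The factor `2^|γ|` compares `(Re z)^γ` with `|z|^γ` in the sector, for either sign of `γ`.
  refine ⟨K + (2 * H' / α + Real.pi * B) * 2 ^ |γ|, min (Real.exp (-1)) (δ / 2),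
    lt_min (Real.exp_pos _) (by linarith), fun z hz hcase => ?_⟩
  have hz1 : ‖z‖ < Real.exp (-1) := hz.trans_le (min_le_left _ _)
  have hz2 : ‖z‖ < δ / 2 := hz.trans_le (min_le_right _ _)
  have hz0 : 0 < ‖z‖ := norm_pos_iff.2 fun h0 => by
    rcases hcase with h1 | h1 <;> simp [h0] at h1
  have hh1 := one_le_hdist (γ := γ) hz0 hz1
  have hh2 := rpow_le_hdist (γ := γ) hz0 hz1
  rw [add_mul]
  rcases le_or_gt z.re (‖z‖ / 2) with hre | hre
  · refine le_trans ?_ (le_add_of_nonneg_right (by positivity))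
    refine le_trans ?_ (hout z Set.univ hz0 hz1 (by linarith) fun t _ ht => max_le_of_re_le hre ht)
    refine (norm_integral_le_integral_norm _).trans (le_of_eq ?_)
    simp only [norm_mul, norm_inv, Set.indicator_univ]
  · have him : z.im ≠ 0 := by
      rcases hcase with h1 | h1
      · exact h1
      · linarith
    have hx0 : 0 < z.re := by linarith
    have hxd : z.re ≤ ‖z‖ := Complex.re_le_norm z
    have hx1 : z.re ≤ 1 := hxd.trans (hz1.le.trans (Real.exp_le_one_iff.2 (by norm_num)))
    have hb := norm_cauchyInt_le_of_holder h.integrable him (ρ := z.re / 2) (α := α)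
      (H := H' * z.re ^ (γ - α)) (by linarith) hα
      (mul_nonneg hH' (Real.rpow_nonneg hx0.le _))
      fun u hu => hhol z.re u hx0 hx1 (by linarith) hu
    refine hb.trans ?_
    rw [add_assoc]
    have h2 := hout z {t : ℝ | z.re / 2 ≤ |t - z.re|} hz0 hz1 (by linarith)
      fun t ht _ => max_le_of_lt_re hre ht
    refine add_le_add h2 ?_
    have h3 := h.norm_le hx0 (by linarith)
    have h4 : z.re ^ γ ≤ 2 ^ |γ| * ‖z‖ ^ γ := by
      rcases le_total 0 γ with h0 | h0
      · have := Real.rpow_le_rpow hx0.le hxd h0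
        refine this.trans (le_mul_of_one_le_left (Real.rpow_nonneg hz0.le _) ?_)
        exact Real.one_le_rpow one_le_two (abs_nonneg _)
      · have := Real.rpow_le_rpow_of_nonpos (by linarith : 0 < ‖z‖ / 2) hre.le h0
        refine this.trans (le_of_eq ?_)
        rw [Real.div_rpow hz0.le zero_le_two, abs_of_nonpos h0, Real.rpow_neg zero_le_two]
        ring
    have h5 : 2 * (H' * z.re ^ (γ - α)) * (z.re / 2) ^ α / α ≤ 2 * H' / α * z.re ^ γ := by
      have e1 : (z.re / 2) ^ α ≤ z.re ^ α :=
        Real.rpow_le_rpow (by linarith) (by linarith) hα.le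
      have e2 : z.re ^ (γ - α) * z.re ^ α = z.re ^ γ := by
        rw [← Real.rpow_add hx0]; ring_nf
      have e3 : 0 ≤ z.re ^ (γ - α) := Real.rpow_nonneg hx0.le _
      calc _ ≤ 2 * (H' * z.re ^ (γ - α)) * z.re ^ α / α := by gcongr
        _ = 2 * H' / α * (z.re ^ (γ - α) * z.re ^ α) := by ring
        _ = _ := by rw [e2]
    calc _ ≤ 2 * H' / α * z.re ^ γ + Real.pi * (B * z.re ^ γ) := by gcongr
      _ = (2 * H' / α + Real.pi * B) * z.re ^ γ := by ring
      _ ≤ (2 * H' / α + Real.pi * B) * (2 ^ |γ| * hdist γ ‖z‖) := by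
        have := Real.pi_pos
        gcongr
        exact h4.trans (by gcongr)
      _ = _ := by ring

end EndpointData

variable {N : ℕ} {a b : EReal} {γ : ℝ → ℝ} {W : ℝ → Matrix (Fin N) (Fin N) ℝ}

/-! ### The entries of a matrix weight -/

/-- An entry of the weight, extended by zero off the interval. -/
noncomputable def wEntry (a b : EReal) (W : ℝ → Matrix (Fin N) (Fin N) ℝ) (i j : Fin N) (t : ℝ) :
    ℂ := (interval a b).indicator (fun t => cW W t i j) t

theorem wEntry_of_mem {t : ℝ} (ht : t ∈ interval a b) (i j : Fin N) :
    wEntry a b W i j t = (W t i j : ℂ) := by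
  simp [wEntry, ht, cW]

theorem wEntry_of_notMem {t : ℝ} (ht : t ∉ interval a b) (i j : Fin N) :
    wEntry a b W i j t = 0 := by
  simp [wEntry, ht]

theorem integrable_of_abs {f : ℝ → ℝ} {s : Set ℝ} (h0 : IntegrableOn f s) (k : ℕ)
    (h : IntegrableOn (fun x : ℝ => |x| ^ k * f x) s) :
    IntegrableOn (fun x : ℝ => ((x : ℂ) ^ k * (f x : ℂ))) s := by
  refine Integrable.mono' h.norm ?_ (Eventually.of_forall fun x => ?_)
  · exact (Continuous.aestronglyMeasurable (by fun_prop)).mul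
      (Complex.continuous_ofReal.comp_aestronglyMeasurable h0.aestronglyMeasurable)
  · simp

theorem IsMatrixWeight.moments_wEntry (hW : IsMatrixWeight a b γ W) (i j : Fin N) (k : ℕ) :
    Integrable fun t : ℝ => (t : ℂ) ^ k * wEntry a b W i j t := by
  have h := integrable_of_abs (by simpa using hW.moments 0 i j) k (hW.moments k i j)
  refine (h.integrable_indicator (isOpen_interval a b).measurableSet).congr
    (Eventually.of_forall fun t => ?_)
  by_cases ht : t ∈ interval a b
  · simp [wEntry_of_mem ht, ht]
  · simp [wEntry_of_notMem ht, ht]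

theorem IsMatrixWeight.integrable_wEntry (hW : IsMatrixWeight a b γ W) (i j : Fin N) :
    Integrable (wEntry a b W i j) := by
  simpa using hW.moments_wEntry i j 0

theorem abs_sub_le_of_holderOnWith {f : ℝ → ℝ} {S : Set ℝ} {C α : NNReal}
    (h : HolderOnWith C α f S) {s t : ℝ} (hs : s ∈ S) (ht : t ∈ S) :
    |f s - f t| ≤ C * |s - t| ^ (α : ℝ) := by
  have h1 := h.edist_le hs ht
  rw [edist_dist, edist_dist, ENNReal.ofReal_rpow_of_nonneg dist_nonneg α.coe_nonneg,
    ← ENNReal.ofReal_coe_nnreal, ← ENNReal.ofReal_mul C.coe_nonneg, ENNReal.ofReal_le_ofReal_iff] at h1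
  · simpa [Real.dist_eq] using h1
  · have : 0 ≤ dist s t ^ (α : ℝ) := Real.rpow_nonneg dist_nonneg _
    positivity

theorem IsHolderOn.exists_bound {F : ℝ → Matrix (Fin N) (Fin N) ℝ} {S : Set ℝ}
    (h : IsHolderOn F S) : ∃ C α : ℝ, 0 ≤ C ∧ 0 < α ∧ ∀ i j, ∀ s ∈ S, ∀ t ∈ S,
      |F s i j - F t i j| ≤ C * |s - t| ^ α := by
  obtain ⟨C, α, hα, h⟩ := h
  exact ⟨C, α, C.2, hα, fun i j s hs t ht => abs_sub_le_of_holderOnWith (h i j) hs ht⟩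

theorem IsMatrixWeight.boundary_values (hW : IsMatrixWeight a b γ W) (i j : Fin N) {x₀ : ℝ}
    (hx₀ : x₀ ∈ interval a b) :
    ∃ vp vm : ℂ, Tendsto (cauchyInt (wEntry a b W i j)) (nhdsUpper x₀) (𝓝 vp) ∧
      Tendsto (cauchyInt (wEntry a b W i j)) (nhdsLower x₀) (𝓝 vm) ∧
      vp - vm = 2 * Real.pi * Complex.I * (W x₀ i j : ℂ) := by
  obtain ⟨r, hr, hH⟩ := hW.holder x₀ hx₀
  obtain ⟨C, α, hC, hα, hH⟩ := hH.exists_bound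
  obtain ⟨r', hr', hsub⟩ := Metric.isOpen_iff.1 (isOpen_interval a b) x₀ hx₀
  have hmem : ∀ t, |t - x₀| < min r r' → t ∈ interval a b ∩ Metric.ball x₀ r := fun t ht =>
    ⟨hsub (by rw [Metric.mem_ball, Real.dist_eq]; exact ht.trans_le (min_le_right _ _)),
      by rw [Metric.mem_ball, Real.dist_eq]; exact ht.trans_le (min_le_left _ _)⟩
  have hρ : 0 < min r r' / 2 := half_pos (lt_min hr hr')
  rw [← wEntry_of_mem hx₀ i j]
  refine exists_boundary_values_cauchyInt (hW.integrable_wEntry i j) hρ hα hC fun x hx u hu => ?_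
  have hx1 := hmem x (by linarith)
  have hx2 := hmem (x + u) (by
    have : x + u - x₀ = (x - x₀) + u := by ring
    rw [this]
    linarith [abs_add_le (x - x₀) u])
  rw [wEntry_of_mem hx1.1, wEntry_of_mem hx2.1, ← Complex.ofReal_sub, Complex.norm_real,
    Real.norm_eq_abs]
  simpa using hH i j _ hx2 _ hx1

theorem IsMatrixWeight.holderAtTop (hab : a < b) (hW : IsMatrixWeight a b γ W) (i j : Fin N) :
    HolderAtTop (wEntry a b W i j) := by
  by_cases hb : b = ⊤
  · obtain ⟨r, hH⟩ := hW.holder_top hb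
    obtain ⟨C, α, hC, hα, hH⟩ := hH.exists_bound
    have hmem : ∀ t, max r a.toReal < t → t ∈ interval a b ∩ Set.Ioi r := fun t ht => by
      refine ⟨⟨?_, hb ▸ EReal.coe_lt_top t⟩, (le_max_left _ _).trans_lt ht⟩
      refine lt_of_le_of_lt (EReal.le_coe_toReal hab.ne_top)
        (EReal.coe_lt_coe_iff.2 ((le_max_right _ _).trans_lt ht))
    refine ⟨max r a.toReal, C, α, hα, hC, fun s hs t ht => ?_⟩
    rw [wEntry_of_mem (hmem s hs).1, wEntry_of_mem (hmem t ht).1, ← Complex.ofReal_sub,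
      Complex.norm_real]
    exact hH i j s (hmem s hs) t (hmem t ht)
  · refine ⟨b.toReal, 0, 1, one_pos, le_rfl, fun s hs t ht => ?_⟩
    have hnot : ∀ t : ℝ, b.toReal < t → t ∉ interval a b := fun t ht h =>
      absurd (h.2.trans_le (EReal.le_coe_toReal hb)) (not_lt.2 (by exact_mod_cast ht.le))
    rw [wEntry_of_notMem (hnot s hs), wEntry_of_notMem (hnot t ht)]
    simp

theorem IsMatrixWeight.holderAtBot (hab : a < b) (hW : IsMatrixWeight a b γ W) (i j : Fin N) :
    HolderAtTop fun t => wEntry a b W i j (-t) := by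
  by_cases ha : a = ⊥
  · obtain ⟨r, hH⟩ := hW.holder_bot ha
    obtain ⟨C, α, hC, hα, hH⟩ := hH.exists_bound
    have hmem : ∀ t, max (-r) (-b.toReal) < t → -t ∈ interval a b ∩ Set.Iio r := fun t ht => by
      refine ⟨⟨ha ▸ EReal.bot_lt_coe _, ?_⟩, ?_⟩
      · refine lt_of_lt_of_le (EReal.coe_lt_coe_iff.2 ?_) (EReal.coe_toReal_le hab.ne_bot)
        linarith [(le_max_right (-r) _).trans_lt ht]
      · show -t < r
        linarith [(le_max_left (-r) _).trans_lt ht]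
    refine ⟨max (-r) (-b.toReal), C, α, hα, hC, fun s hs t ht => ?_⟩
    simp only
    rw [wEntry_of_mem (hmem s hs).1, wEntry_of_mem (hmem t ht).1, ← Complex.ofReal_sub,
      Complex.norm_real]
    have := hH i j _ (hmem s hs) _ (hmem t ht)
    rwa [neg_sub_neg, abs_sub_comm t s] at this
  · refine ⟨-a.toReal, 0, 1, one_pos, le_rfl, fun s hs t ht => ?_⟩
    have hnot : ∀ t : ℝ, -a.toReal < t → -t ∉ interval a b := fun t ht h => by
      have h1 := (EReal.coe_toReal_le ha).trans_lt h.1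
      rw [EReal.coe_lt_coe_iff] at h1
      linarith
    simp only
    rw [wEntry_of_notMem (hnot s hs), wEntry_of_notMem (hnot t ht)]
    simp

theorem IsMatrixWeight.isBigO_atInfty (hab : a < b) (hW : IsMatrixWeight a b γ W) (i j : Fin N)
    (m : ℕ) : cauchyInt (fun t : ℝ => (t : ℂ) ^ m * wEntry a b W i j t) =O[atInfty a b]
      (fun _ => (1 : ℝ)) :=
  cauchyInt_pow_mul_isBigO hab (hW.moments_wEntry i j) (fun _ ht => wEntry_of_notMem ht i j)
    (hW.holderAtTop hab i j) (hW.holderAtBot hab i j) m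

/-- The sign `σ` treats both endpoints at once: `t ↦ c + σ t` places the endpoint at `0` with the
support on its right. -/
theorem cauchyInt_affine (g : ℝ → ℂ) (c σ : ℝ) (hσ : σ = 1 ∨ σ = -1) (z : ℂ) :
    cauchyInt (fun t => g (c + σ * t)) (σ * (z - c)) = σ * cauchyInt g z := by
  rcases hσ with rfl | rfl
  · have h := integral_add_left_eq_self (μ := volume)
      (fun s : ℝ => ((s : ℂ) - z)⁻¹ * g s) c
    simp only [cauchyInt, Complex.ofReal_one, one_mul]
    rw [← h]
    refine integral_congr_ae (Eventually.of_forall fun t => ?_)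
    simp only [Complex.ofReal_add]
    congr 2
    ring
  · have h := integral_sub_left_eq_self (fun s : ℝ => ((s : ℂ) - z)⁻¹ * g s) volume c
    simp only [cauchyInt, Complex.ofReal_neg, Complex.ofReal_one, neg_mul, one_mul]
    rw [← h, ← integral_neg]
    refine integral_congr_ae (Eventually.of_forall fun t => ?_)
    simp only [Complex.ofReal_sub, ← neg_mul, ← inv_neg, ← sub_eq_add_neg]
    congr 2
    ring

theorem isBigO_atEndpoint_of_endpointData {g w : ℝ → ℂ} {γ : ℝ → ℝ} {c σ δ B H α : ℝ}
    (hσ : σ = 1 ∨ σ = -1) (hd : EndpointData (fun t => g (c + σ * t)) w (γ c) δ B H α)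
    (hcut : ∀ᶠ z in atEndpoint a b c, z.im ≠ 0 ∨ σ * (z.re - c) < 0) :
    cauchyInt g =O[atEndpoint a b c] hfun (γ c) c := by
  obtain ⟨K, ε, hε, hK⟩ := hd.exists_bound
  refine IsBigO.of_bound K ?_
  have hnear : ∀ᶠ z : ℂ in atEndpoint a b c, ‖z - c‖ < ε := by
    have : Tendsto (fun z : ℂ => ‖z - c‖) (atEndpoint a b c) (𝓝 ‖(c : ℂ) - c‖) :=
      (Continuous.tendsto (by fun_prop) _).mono_left nhdsWithin_le_nhds
    rw [sub_self, norm_zero] at this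
    exact this.eventually_lt_const hε
  have hσ1 : ‖(σ : ℂ)‖ = 1 := by rcases hσ with rfl | rfl <;> simp
  have hσ0 : σ ≠ 0 := by rcases hσ with rfl | rfl <;> norm_num
  filter_upwards [hcut, hnear] with z hz hzε
  have h1 := hK (σ * (z - c)) (by rw [norm_mul, hσ1, one_mul]; exact hzε) (by
    simpa [hσ0] using hz)
  rw [cauchyInt_affine g c σ hσ z, norm_mul, norm_mul, hσ1, one_mul, one_mul] at h1
  rwa [norm_hfun]

theorem IsMatrixWeight.exists_endpointData (hW : IsMatrixWeight a b γ W) (i j : Fin N) {c σ : ℝ}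
    (hσ : σ = 1 ∨ σ = -1) (hc : IsFiniteEndpoint a b c)
    (hout : ∀ t ≤ 0, c + σ * t ∉ interval a b)
    (hin : ∃ δ, 0 < δ ∧ ∀ t, 0 < t → t ≤ δ → c + σ * t ∈ interval a b) :
    ∃ (w : ℝ → ℂ) (δ B H α : ℝ),
      EndpointData (fun t => wEntry a b W i j (c + σ * t)) w (γ c) δ B H α := by
  obtain ⟨hγ, Wt, hWt, -, r, hr, hH⟩ := hW.endpoint c hc
  obtain ⟨C, α, hC, hα, hH⟩ := hH.exists_bound
  obtain ⟨δ, hδ, hin⟩ := hin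
  have hσ1 : |σ| = 1 := by rcases hσ with rfl | rfl <;> simp
  have hσ0 : σ ≠ 0 := by rcases hσ with rfl | rfl <;> norm_num
  have hδ' : 0 < min δ (min (r / 2) 1) := lt_min hδ (lt_min (by linarith) one_pos)
  have hmem : ∀ t, 0 < t → t ≤ min δ (min (r / 2) 1) →
      c + σ * t ∈ insert c (interval a b) ∩ Metric.ball c r := fun t ht ht' => by
    refine ⟨Or.inr (hin t ht (ht'.trans (min_le_left _ _))), ?_⟩
    rw [Metric.mem_ball, Real.dist_eq, add_sub_cancel_left, abs_mul, hσ1, one_mul, abs_of_pos ht]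
    linarith [ht'.trans ((min_le_right _ _).trans (min_le_left _ _))]
  have hc' : c ∈ insert c (interval a b) ∩ Metric.ball c r :=
    ⟨Or.inl rfl, Metric.mem_ball_self hr⟩
  -- The length is capped by `r / 2` to stay in the Hölder ball and by `1` so that distances are at
  -- most one. The cap gives both the bound `|Wt c| + C` and the passage to exponent `min α 1`.
  refine ⟨fun t => (Wt (c + σ * t) i j : ℂ), min δ (min (r / 2) 1), |Wt c i j| + C, C, min α 1,
    ?_, ?_, hγ, hδ', by positivity, hC, lt_min hα one_pos, min_le_right _ _, ?_, ?_, ?_⟩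
  · have := (hW.integrable_wEntry i j).comp_add_left c
    exact this.comp_mul_left' hσ0
  · exact fun t ht => wEntry_of_notMem (hout t ht) i j
  · intro t ht ht'
    have hI := hin t ht (ht'.trans (min_le_left _ _))
    rw [wEntry_of_mem hI, hWt _ hI, add_sub_cancel_left, abs_mul, hσ1, one_mul, abs_of_pos ht,
      Matrix.smul_apply, smul_eq_mul, Complex.ofReal_mul]
  · intro t ht ht'
    have h1 := hH i j _ (hmem t ht ht') c hc'
    rw [add_sub_cancel_left, abs_mul, hσ1, one_mul, abs_of_pos ht] at h1
    have h2 : t ^ α ≤ 1 := Real.rpow_le_one ht.le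
      (ht'.trans ((min_le_right _ _).trans (min_le_right _ _))) hα.le
    have h3 := abs_sub_abs_le_abs_sub (Wt (c + σ * t) i j) (Wt c i j)
    have h4 := mul_le_mul_of_nonneg_left h2 hC
    rw [Complex.norm_real, Real.norm_eq_abs]
    linarith
  · intro s t hs hs' ht ht'
    have h1 := hH i j _ (hmem s hs hs') _ (hmem t ht ht')
    rw [add_sub_add_left_eq_sub, ← mul_sub, abs_mul, hσ1, one_mul] at h1
    rw [← Complex.ofReal_sub, Complex.norm_real, Real.norm_eq_abs]
    refine h1.trans (mul_le_mul_of_nonneg_left ?_ hC)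
    have hs1 := hs'.trans ((min_le_right _ _).trans (min_le_right _ _))
    have ht1 := ht'.trans ((min_le_right _ _).trans (min_le_right _ _))
    exact Real.rpow_le_rpow_of_exponent_ge' (abs_nonneg _)
      (abs_le.2 ⟨by linarith, by linarith⟩) (lt_min hα one_pos).le (min_le_left _ _)

theorem exists_real_mem_interval (hab : a < b) : ∃ d : ℝ, d ∈ interval a b := by
  obtain ⟨d, h1, h2⟩ := EReal.lt_iff_exists_real_btwn.1 hab
  exact ⟨d, h1, h2⟩

/-- The Cauchy integrals of the entries of the weight grow at most like `h` at the endpoints. -/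
theorem IsMatrixWeight.isBigO_atEndpoint (hab : a < b) (hW : IsMatrixWeight a b γ W) (i j : Fin N)
    {c : ℝ} (hc : IsFiniteEndpoint a b c) :
    cauchyInt (wEntry a b W i j) =O[atEndpoint a b c] hfun (γ c) c := by
  obtain ⟨d, hd1, hd2⟩ := exists_real_mem_interval hab
  have hev : ∀ᶠ z in atEndpoint a b c, z ∈ (cut a b)ᶜ := eventually_mem_nhdsWithin
  have hre : Tendsto (fun z : ℂ => z.re) (atEndpoint a b c) (𝓝 c) := by
    simpa [atEndpoint] using (Complex.continuous_re.tendsto (c : ℂ)).mono_left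
      (nhdsWithin_le_nhds (s := (cut a b)ᶜ))
  rcases hc with hc' | hc'
  · have hcd : c < d := by rw [← hc'] at hd1; exact_mod_cast hd1
    obtain ⟨w, δ, B, H, α, h⟩ := hW.exists_endpointData i j (σ := 1) (Or.inl rfl) (Or.inl hc')
      (fun t ht h => by
        have := h.1
        rw [← hc', EReal.coe_lt_coe_iff] at this
        linarith)
      ⟨d - c, by linarith, fun t ht ht' => ⟨by
        rw [← hc', EReal.coe_lt_coe_iff]; linarith, lt_of_le_of_lt
          (EReal.coe_le_coe_iff.2 (by linarith)) hd2⟩⟩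
    refine isBigO_atEndpoint_of_endpointData (Or.inl rfl) h ?_
    filter_upwards [hev, hre.eventually_lt_const hcd] with z hz hzd
    by_contra! hcon
    refine hz ⟨hcon.1, ?_, ?_⟩
    · rw [← hc', EReal.coe_le_coe_iff]; linarith [hcon.2]
    · exact ((EReal.coe_lt_coe_iff.2 hzd).trans hd2).le
  · have hcd : d < c := by rw [← hc'] at hd2; exact_mod_cast hd2
    obtain ⟨w, δ, B, H, α, h⟩ := hW.exists_endpointData i j (σ := -1) (Or.inr rfl) (Or.inr hc')
      (fun t ht h => by
        have := h.2
        rw [← hc', EReal.coe_lt_coe_iff] at this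
        linarith)
      ⟨c - d, by linarith, fun t ht ht' => ⟨lt_of_lt_of_le hd1
          (EReal.coe_le_coe_iff.2 (by linarith)), by
        rw [← hc', EReal.coe_lt_coe_iff]; linarith⟩⟩
    refine isBigO_atEndpoint_of_endpointData (Or.inr rfl) h ?_
    filter_upwards [hev, hre.eventually_const_lt hcd] with z hz hzd
    by_contra! hcon
    refine hz ⟨hcon.1, ?_, ?_⟩
    · exact (hd1.trans (EReal.coe_lt_coe_iff.2 hzd)).le
    · rw [← hc', EReal.coe_le_coe_iff]; linarith [hcon.2]

/-! ### Matrix polynomials, moments, and functions of the second kind -/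

theorem pval_eq_sum {ι : Type*} [Fintype ι] [DecidableEq ι] (P : Polynomial (Matrix ι ι ℂ)) {n : ℕ}
    (hn : P.natDegree ≤ n) (z : ℂ) :
    pval P z = ∑ k ∈ Finset.range (n + 1), z ^ k • P.coeff k := by
  rw [pval, Polynomial.eval_eq_sum_range' (Nat.lt_succ_of_le hn)]
  refine Finset.sum_congr rfl fun k _ => ?_
  rw [← map_pow, Matrix.scalar_apply, ← Matrix.smul_one_eq_diagonal, Matrix.mul_smul, mul_one]

/-- The moments of the weight. -/
noncomputable def moment (a b : EReal) (W : ℝ → Matrix (Fin N) (Fin N) ℝ) (k : ℕ) :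
    Matrix (Fin N) (Fin N) ℂ := Matrix.of fun i j => ∫ t : ℝ, (t : ℂ) ^ k * wEntry a b W i j t

/-- The Cauchy transform of `t ^ k W(t)`, without the factor `1 / (2πi)`. -/
noncomputable def cauchyPow (a b : EReal) (W : ℝ → Matrix (Fin N) (Fin N) ℝ) (k : ℕ) (z : ℂ) :
    Matrix (Fin N) (Fin N) ℂ :=
  Matrix.of fun i j => cauchyInt (fun t => (t : ℂ) ^ k * wEntry a b W i j t) z

theorem integral_interval_eq (f : ℝ → ℂ) (i j : Fin N) :
    ∫ t in interval a b, f t * cW W t i j = ∫ t, f t * wEntry a b W i j t := by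
  rw [← integral_indicator (isOpen_interval a b).measurableSet]
  refine integral_congr_ae (Eventually.of_forall fun t => ?_)
  by_cases ht : t ∈ interval a b <;> simp [wEntry, ht]

theorem cauchyW_eq (z : ℂ) :
    cauchyW a b W z = (2 * Real.pi * Complex.I : ℂ)⁻¹ • cauchyPow a b W 0 z := by
  rw [cauchyW]
  congr 1
  ext i j
  simp only [matInt, Matrix.of_apply, Matrix.smul_apply, smul_eq_mul, cauchyPow, pow_zero, one_mul,
    cauchyInt]
  exact integral_interval_eq _ i j

/-- Integrate `t / (t - z) = 1 + z / (t - z)` against `t^k W`. -/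
theorem cauchyPow_succ (hW : IsMatrixWeight a b γ W) (k : ℕ) {z : ℂ} (hz : z ∈ (cut a b)ᶜ) :
    cauchyPow a b W (k + 1) z = z • cauchyPow a b W k z + moment a b W k := by
  ext i j
  have hi : Integrable fun t : ℝ => ((t : ℂ) - z)⁻¹ * ((t : ℂ) ^ k * wEntry a b W i j t) :=
    integrable_kernel_mul_of_compl_cut (hW.moments_wEntry i j k)
      (fun t ht => by rw [wEntry_of_notMem ht, mul_zero]) hz
  simp only [cauchyPow, moment, Matrix.of_apply, Matrix.add_apply, Matrix.smul_apply, smul_eq_mul,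
    cauchyInt]
  rw [← integral_const_mul, ← integral_add (hi.const_mul z) (hW.moments_wEntry i j k)]
  refine integral_congr_ae (Eventually.of_forall fun t => ?_)
  by_cases ht : t ∈ interval a b
  · have hne : (t : ℂ) - z ≠ 0 := fun h0 => by
      rw [sub_eq_zero] at h0
      exact hz (h0 ▸ ⟨by simp, by simpa using ht.1.le, by simpa using ht.2.le⟩)
    simp only
    field_simp
    ring
  · simp [wEntry_of_notMem ht]

theorem cauchyPow_eq (hW : IsMatrixWeight a b γ W) (k : ℕ) {z : ℂ} (hz : z ∈ (cut a b)ᶜ) :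
    cauchyPow a b W k z = z ^ k • cauchyPow a b W 0 z +
      ∑ i ∈ Finset.range k, z ^ (k - 1 - i) • moment a b W i := by
  induction k with
  | zero => simp
  | succ k ih =>
    rw [cauchyPow_succ hW k hz, ih, Finset.sum_range_succ, smul_add, smul_smul, ← pow_succ',
      Finset.smul_sum, ← add_assoc]
    simp only [Nat.add_sub_cancel, Nat.sub_self, pow_zero, one_smul]
    congr 2
    refine Finset.sum_congr rfl fun i hi => ?_
    rw [smul_smul, ← pow_succ']
    congr 2
    have := Finset.mem_range.1 hi
    omega

/-- The recursion is solved for the lower power. The remainder stays an exact Cauchy transform, of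
`t^{k+m} W`, so the whole expansion depends only on the boundedness of such transforms. -/
theorem cauchyPow_expansion (hW : IsMatrixWeight a b γ W) (k m : ℕ) {z : ℂ}
    (hz : z ∈ (cut a b)ᶜ) (hz0 : z ≠ 0) :
    cauchyPow a b W k z = -(∑ j ∈ Finset.range m, (z ^ (j + 1))⁻¹ • moment a b W (k + j)) +
      (z ^ m)⁻¹ • cauchyPow a b W (k + m) z := by
  induction m with
  | zero => simp
  | succ m ih =>
    rw [ih, Finset.sum_range_succ, ← add_assoc k m 1, cauchyPow_succ hW (k + m) hz, smul_add,
      smul_smul, pow_succ z m, mul_inv, mul_assoc, inv_mul_cancel₀ hz0, mul_one]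
    module

theorem integral_smul_mul_cW (hW : IsMatrixWeight a b γ W) (A B : Matrix (Fin N) (Fin N) ℂ)
    (c : ℂ) (k : ℕ) (i j : Fin N) :
    IntegrableOn (fun t : ℝ => ((c * (t : ℂ) ^ k) • (A * cW W t * B)) i j) (interval a b) ∧
    ∫ t in interval a b, ((c * (t : ℂ) ^ k) • (A * cW W t * B)) i j =
      (c • (A * moment a b W k * B)) i j := by
  have hint : ∀ p q, IntegrableOn (fun t : ℝ => (t : ℂ) ^ k * cW W t p q) (interval a b) := by
    intro p q
    rw [← integrable_indicator_iff (isOpen_interval a b).measurableSet]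
    refine (hW.moments_wEntry p q k).congr (Eventually.of_forall fun t => ?_)
    by_cases ht : t ∈ interval a b <;> simp [wEntry, ht]
  have he : ∀ t : ℝ, ((c * (t : ℂ) ^ k) • (A * cW W t * B)) i j =
      ∑ q, ∑ p, (c * A i p * B q j) * ((t : ℂ) ^ k * cW W t p q) := by
    intro t
    simp only [Matrix.smul_apply, Matrix.mul_apply, smul_eq_mul, Finset.sum_mul, Finset.mul_sum]
    refine Finset.sum_congr rfl fun q _ => Finset.sum_congr rfl fun p _ => ?_
    ring
  have hI : ∀ q p, IntegrableOn (fun t : ℝ => (c * A i p * B q j) * ((t : ℂ) ^ k * cW W t p q))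
      (interval a b) := fun q p => (hint p q).const_mul _
  simp only [he]
  refine ⟨integrable_finsetSum _ fun q _ => integrable_finsetSum _ fun p _ => hI q p, ?_⟩
  rw [integral_finsetSum _ fun q _ => integrable_finsetSum _ fun p _ => hI q p]
  simp only [Matrix.smul_apply, Matrix.mul_apply, smul_eq_mul, Finset.sum_mul, Finset.mul_sum]
  refine Finset.sum_congr rfl fun q _ => ?_
  rw [integral_finsetSum _ fun p _ => hI q p]
  refine Finset.sum_congr rfl fun p _ => ?_
  rw [integral_const_mul, integral_interval_eq]
  simp only [moment, Matrix.of_apply]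
  ring

theorem matInt_sum {κ : Type*} (s : Finset κ) (F : κ → ℝ → Matrix (Fin N) (Fin N) ℂ)
    (h : ∀ k ∈ s, ∀ i j, IntegrableOn (fun t => F k t i j) (interval a b)) :
    matInt a b (fun t => ∑ k ∈ s, F k t) = ∑ k ∈ s, matInt a b (F k) := by
  ext i j
  simp only [matInt, Matrix.of_apply, Matrix.sum_apply]
  exact integral_finsetSum _ fun k hk => h k hk i j

theorem pval_mul_cW_mul (P Q : Polynomial (Matrix (Fin N) (Fin N) ℂ)) (x : ℝ) :
    pval P x * cW W x * (pval Q x).conjTranspose =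
      ∑ kl ∈ Finset.range (P.natDegree + 1) ×ˢ Finset.range (Q.natDegree + 1),
        ((1 : ℂ) * (x : ℂ) ^ (kl.1 + kl.2)) •
        (P.coeff kl.1 * cW W x * (Q.coeff kl.2).conjTranspose) := by
  rw [pval_eq_sum P le_rfl, pval_eq_sum Q le_rfl, Finset.sum_product, Matrix.conjTranspose_sum,
    Finset.sum_mul, Finset.sum_mul]
  refine Finset.sum_congr rfl fun k _ => ?_
  rw [Finset.mul_sum]
  refine Finset.sum_congr rfl fun l _ => ?_
  rw [Matrix.conjTranspose_smul, star_pow]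
  simp only [Matrix.smul_mul, Matrix.mul_smul, smul_smul, one_mul, pow_add]
  congr 1
  rw [mul_comm]
  simp

theorem integrableOn_innerW (hW : IsMatrixWeight a b γ W)
    (P Q : Polynomial (Matrix (Fin N) (Fin N) ℂ)) (i j : Fin N) :
    IntegrableOn (fun x : ℝ => (pval P x * cW W x * (pval Q x).conjTranspose) i j)
      (interval a b) := by
  simp only [pval_mul_cW_mul, Matrix.sum_apply]
  exact integrable_finsetSum _ fun kl _ => (integral_smul_mul_cW hW _ _ _ _ i j).1

theorem sum_range_eq_of_natDegree_le {M : Type*} [AddCommMonoid M] {R : Type*} [Semiring R]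
    (P : Polynomial R) {n : ℕ} (hn : P.natDegree ≤ n) (f : ℕ → R → M) (hf : ∀ k, f k 0 = 0) :
    ∑ k ∈ Finset.range (P.natDegree + 1), f k (P.coeff k) =
      ∑ k ∈ Finset.range (n + 1), f k (P.coeff k) := by
  refine Finset.sum_subset (Finset.range_mono (by omega)) fun k _ hk => ?_
  rw [Polynomial.coeff_eq_zero_of_natDegree_lt (by
    have := mt Finset.mem_range.2 hk; omega), hf]

theorem innerW_eq_sum (hW : IsMatrixWeight a b γ W)
    (P Q : Polynomial (Matrix (Fin N) (Fin N) ℂ)) {n m : ℕ} (hn : P.natDegree ≤ n)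
    (hm : Q.natDegree ≤ m) :
    innerW a b W P Q = ∑ k ∈ Finset.range (n + 1), ∑ l ∈ Finset.range (m + 1),
      P.coeff k * moment a b W (k + l) * (Q.coeff l).conjTranspose := by
  rw [innerW]
  simp only [pval_mul_cW_mul]
  rw [matInt_sum _ _ fun kl _ i j => (integral_smul_mul_cW hW _ _ _ _ i j).1, Finset.sum_product]
  rw [← sum_range_eq_of_natDegree_le P hn (fun k A => ∑ l ∈ Finset.range (m + 1),
    A * moment a b W (k + l) * (Q.coeff l).conjTranspose) (by simp)]
  refine Finset.sum_congr rfl fun k _ => ?_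
  rw [← sum_range_eq_of_natDegree_le Q hm (fun l B =>
    P.coeff k * moment a b W (k + l) * B.conjTranspose) (by simp)]
  refine Finset.sum_congr rfl fun l _ => ?_
  ext i j
  refine (integral_smul_mul_cW hW _ _ _ _ i j).2.trans ?_
  rw [one_smul]

theorem secondKind_eq_sum (hW : IsMatrixWeight a b γ W)
    (P : ℕ → Polynomial (Matrix (Fin N) (Fin N) ℂ)) {n m : ℕ} (hn : (P n).natDegree ≤ m) (z : ℂ) :
    secondKind a b W P n z = ∑ k ∈ Finset.range (m + 1), ∑ i ∈ Finset.range k,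
      z ^ (k - 1 - i) • ((P n).coeff k * moment a b W i) := by
  have he : ∀ t : ℝ, (t : ℂ) ≠ z →
      (((t : ℂ) - z)⁻¹ • (pval (P n) t - pval (P n) z)) * cW W t =
      ∑ p ∈ (Finset.range (m + 1)).sigma fun k => Finset.range k,
        (z ^ (p.1 - 1 - p.2) * (t : ℂ) ^ p.2) • ((P n).coeff p.1 * cW W t * 1) := by
    intro t ht
    have hne : (t : ℂ) - z ≠ 0 := sub_ne_zero.2 ht
    rw [pval_eq_sum (P n) hn, pval_eq_sum (P n) hn, Finset.sum_sigma, ← Finset.sum_sub_distrib,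
      Finset.smul_sum, Finset.sum_mul]
    refine Finset.sum_congr rfl fun k _ => ?_
    simp only [mul_one]
    rw [← Finset.sum_smul, ← sub_smul, smul_smul, Matrix.smul_mul]
    congr 1
    rw [← (Commute.all (t : ℂ) z).geom_sum₂_mul k, mul_comm, mul_assoc, mul_inv_cancel₀ hne, mul_one]
    exact Finset.sum_congr rfl fun i _ => mul_comm _ _
  -- At `t = z` the quotient takes the default value `0` instead of the derivative; a single point
  -- does not affect the integral.
  have hae : ∀ᵐ t : ℝ ∂(volume.restrict (interval a b)), (t : ℂ) ≠ z := by
    refine ae_restrict_of_ae ?_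
    have : ∀ᵐ t : ℝ, t ≠ z.re := by rw [ae_iff]; simp
    filter_upwards [this] with t ht h
    exact ht (by rw [← h]; simp)
  have h1 : secondKind a b W P n z = matInt a b fun t : ℝ =>
      ∑ p ∈ (Finset.range (m + 1)).sigma fun k => Finset.range k,
        (z ^ (p.1 - 1 - p.2) * (t : ℂ) ^ p.2) • ((P n).coeff p.1 * cW W t * 1) := by
    ext i j
    simp only [secondKind, matInt, Matrix.of_apply]
    refine integral_congr_ae ?_
    filter_upwards [hae] with t ht
    rw [he t ht]
  rw [h1, matInt_sum _ _ fun p _ i j => (integral_smul_mul_cW hW _ _ _ _ i j).1, Finset.sum_sigma]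
  refine Finset.sum_congr rfl fun k _ => Finset.sum_congr rfl fun l _ => ?_
  ext i j
  refine (integral_smul_mul_cW hW _ _ _ _ i j).2.trans ?_
  rw [mul_one]

/-- The Cauchy transform of `P(t) W(t)`, without the factor `1 / (2πi)`. -/
noncomputable def cauchyPoly (a b : EReal) (W : ℝ → Matrix (Fin N) (Fin N) ℝ)
    (P : Polynomial (Matrix (Fin N) (Fin N) ℂ)) (z : ℂ) : Matrix (Fin N) (Fin N) ℂ :=
  ∑ k ∈ Finset.range (P.natDegree + 1), P.coeff k * cauchyPow a b W k z

/-- Write `P_n(t) = P_n(z) + (P_n(t) - P_n(z))` under the integral. This explains the second-kind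
entries of `R_n`. -/
theorem cauchyPoly_eq (hW : IsMatrixWeight a b γ W)
    (P : ℕ → Polynomial (Matrix (Fin N) (Fin N) ℂ)) (n : ℕ) {z : ℂ} (hz : z ∈ (cut a b)ᶜ) :
    cauchyPoly a b W (P n) z =
      pval (P n) z * cauchyPow a b W 0 z + secondKind a b W P n z := by
  rw [cauchyPoly, pval_eq_sum (P n) le_rfl, secondKind_eq_sum hW P le_rfl, Finset.sum_mul,
    ← Finset.sum_add_distrib]
  refine Finset.sum_congr rfl fun k _ => ?_
  rw [cauchyPow_eq hW k hz, mul_add, Matrix.mul_smul, Matrix.smul_mul, Finset.mul_sum]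
  simp only [Matrix.mul_smul]

theorem innerW_X_pow (hW : IsMatrixWeight a b γ W) (P : Polynomial (Matrix (Fin N) (Fin N) ℂ))
    (j : ℕ) : innerW a b W P (Polynomial.X ^ j) =
      ∑ k ∈ Finset.range (P.natDegree + 1), P.coeff k * moment a b W (k + j) := by
  rw [innerW_eq_sum hW P _ le_rfl (Polynomial.natDegree_X_pow_le j)]
  refine Finset.sum_congr rfl fun k _ => ?_
  rw [Finset.sum_eq_single j]
  · simp
  · intro l _ hl
    simp [Polynomial.coeff_X_pow, hl]
  · simp

/-- The coefficients appear as inner products with monomials, so orthogonality translates into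
vanishing at infinity. -/
theorem cauchyPoly_expansion (hW : IsMatrixWeight a b γ W)
    (P : Polynomial (Matrix (Fin N) (Fin N) ℂ)) (m : ℕ) {z : ℂ}
    (hz : z ∈ (cut a b)ᶜ) (hz0 : z ≠ 0) :
    cauchyPoly a b W P z =
      -(∑ j ∈ Finset.range m, (z ^ (j + 1))⁻¹ • innerW a b W P (Polynomial.X ^ j)) +
      (z ^ m)⁻¹ • ∑ k ∈ Finset.range (P.natDegree + 1), P.coeff k * cauchyPow a b W (k + m) z := by
  simp only [innerW_X_pow hW, Finset.smul_sum]
  rw [Finset.sum_comm, ← Finset.sum_neg_distrib, ← Finset.sum_add_distrib, cauchyPoly]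
  refine Finset.sum_congr rfl fun k _ => ?_
  rw [cauchyPow_expansion hW k m hz hz0, mul_add, mul_neg, Finset.mul_sum]
  simp only [Matrix.mul_smul]

/-! ### The matrix inner product and orthonormal polynomials -/

theorem wEntry_comm (hW : IsMatrixWeight a b γ W) (i j : Fin N) (t : ℝ) :
    wEntry a b W i j t = wEntry a b W j i t := by
  by_cases ht : t ∈ interval a b
  · rw [wEntry_of_mem ht, wEntry_of_mem ht]
    have := (hW.posDef t ht).isHermitian.apply j i
    rw [star_trivial] at this
    rw [this]
  · rw [wEntry_of_notMem ht, wEntry_of_notMem ht]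

theorem star_wEntry (i j : Fin N) (t : ℝ) : star (wEntry a b W i j t) = wEntry a b W i j t := by
  by_cases ht : t ∈ interval a b
  · rw [wEntry_of_mem ht]; exact Complex.conj_ofReal _
  · rw [wEntry_of_notMem ht, star_zero]

theorem moment_transpose (hW : IsMatrixWeight a b γ W) (k : ℕ) :
    (moment a b W k).transpose = moment a b W k := by
  ext i j
  simp only [moment, Matrix.transpose_apply, Matrix.of_apply, wEntry_comm hW j i]

theorem moment_map_star (k : ℕ) :
    (moment a b W k).map (starRingEnd ℂ) = moment a b W k := by
  ext i j
  simp only [moment, Matrix.map_apply, Matrix.of_apply]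
  rw [← integral_conj]
  refine integral_congr_ae (Eventually.of_forall fun t => ?_)
  have := star_wEntry (a := a) (b := b) (W := W) i j t
  simp only [map_mul, map_pow, Complex.conj_ofReal]
  rw [starRingEnd_apply, this]

theorem moment_conjTranspose (hW : IsMatrixWeight a b γ W) (k : ℕ) :
    (moment a b W k).conjTranspose = moment a b W k := by
  rw [Matrix.conjTranspose, moment_transpose hW]
  exact moment_map_star k

section inner

variable (hW : IsMatrixWeight a b γ W) (P Q R : Polynomial (Matrix (Fin N) (Fin N) ℂ))
include hW

theorem innerW_conjTranspose : (innerW a b W P Q).conjTranspose = innerW a b W Q P := by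
  rw [innerW_eq_sum hW P Q le_rfl le_rfl, innerW_eq_sum hW Q P le_rfl le_rfl, Finset.sum_comm,
    Matrix.conjTranspose_sum]
  refine Finset.sum_congr rfl fun k _ => ?_
  rw [Matrix.conjTranspose_sum]
  refine Finset.sum_congr rfl fun l _ => ?_
  rw [Matrix.conjTranspose_mul, Matrix.conjTranspose_mul, Matrix.conjTranspose_conjTranspose,
    moment_conjTranspose hW, mul_assoc, add_comm]

theorem innerW_sub_left : innerW a b W (P - Q) R = innerW a b W P R - innerW a b W Q R := by
  have hP := le_max_left P.natDegree Q.natDegree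
  have hQ := le_max_right P.natDegree Q.natDegree
  rw [innerW_eq_sum hW _ R (Polynomial.natDegree_sub_le P Q) le_rfl,
    innerW_eq_sum hW P R hP le_rfl, innerW_eq_sum hW Q R hQ le_rfl, ← Finset.sum_sub_distrib]
  refine Finset.sum_congr rfl fun k _ => ?_
  rw [← Finset.sum_sub_distrib]
  refine Finset.sum_congr rfl fun l _ => ?_
  rw [Polynomial.coeff_sub, sub_mul, sub_mul]

theorem innerW_C_mul_left (A : Matrix (Fin N) (Fin N) ℂ) :
    innerW a b W (Polynomial.C A * P) Q = A * innerW a b W P Q := by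
  rw [innerW_eq_sum hW _ Q (Polynomial.natDegree_C_mul_le A P) le_rfl,
    innerW_eq_sum hW P Q le_rfl le_rfl, Finset.mul_sum]
  refine Finset.sum_congr rfl fun k _ => ?_
  rw [Finset.mul_sum]
  refine Finset.sum_congr rfl fun l _ => ?_
  rw [Polynomial.coeff_C_mul, mul_assoc, mul_assoc, mul_assoc]

theorem innerW_zero_left : innerW a b W 0 Q = 0 := by
  simpa using innerW_C_mul_left hW 0 Q 0

theorem innerW_sub_right : innerW a b W P (Q - R) = innerW a b W P Q - innerW a b W P R := by
  rw [← innerW_conjTranspose hW, innerW_sub_left hW, Matrix.conjTranspose_sub,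
    innerW_conjTranspose hW, innerW_conjTranspose hW]

theorem innerW_C_mul_right (A : Matrix (Fin N) (Fin N) ℂ) :
    innerW a b W P (Polynomial.C A * Q) = innerW a b W P Q * A.conjTranspose := by
  rw [← innerW_conjTranspose hW, innerW_C_mul_left hW, Matrix.conjTranspose_mul,
    innerW_conjTranspose hW]

theorem innerW_zero_right : innerW a b W P 0 = 0 := by
  rw [← innerW_conjTranspose hW, innerW_zero_left hW, Matrix.conjTranspose_zero]

theorem innerW_add_left : innerW a b W (P + Q) R = innerW a b W P R + innerW a b W Q R := by
  have h := innerW_sub_left hW (P + Q) Q R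
  rw [add_sub_cancel_right] at h
  rw [h, sub_add_cancel]

theorem innerW_sum_left {κ : Type*} (s : Finset κ)
    (F : κ → Polynomial (Matrix (Fin N) (Fin N) ℂ)) :
    innerW a b W (∑ k ∈ s, F k) R = ∑ k ∈ s, innerW a b W (F k) R := by
  classical
  induction s using Finset.induction_on with
  | empty => simp [innerW_zero_left hW]
  | insert k s hk ih =>
    rw [Finset.sum_insert hk, Finset.sum_insert hk, ← ih, innerW_add_left hW]

end inner

/-- A polynomial orthogonal to `P_0, …, P_{n-1}`, which have nonsingular leading coefficients, is
orthogonal to all polynomials of degree less than `n`. -/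
theorem innerW_eq_zero_of_orthogonal (hW : IsMatrixWeight a b γ W)
    {P : ℕ → Polynomial (Matrix (Fin N) (Fin N) ℂ)} {n : ℕ}
    (hdeg : ∀ k < n, (P k).natDegree ≤ k) (hlead : ∀ k < n, IsUnit ((P k).coeff k))
    {R : Polynomial (Matrix (Fin N) (Fin N) ℂ)} (hR : ∀ k < n, innerW a b W R (P k) = 0) :
    ∀ Q : Polynomial (Matrix (Fin N) (Fin N) ℂ), (∀ j, n ≤ j → Q.coeff j = 0) →
      innerW a b W R Q = 0 := by
  suffices h : ∀ m ≤ n, ∀ Q : Polynomial (Matrix (Fin N) (Fin N) ℂ),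
      (∀ j, m ≤ j → Q.coeff j = 0) → innerW a b W R Q = 0 from h n le_rfl
  intro m
  induction m with
  | zero =>
    intro _ Q hQ
    have : Q = 0 := Polynomial.ext fun j => by simpa using hQ j (Nat.zero_le _)
    rw [this, innerW_zero_right hW]
  | succ m ih =>
    intro hm Q hQ
    have hm' : m < n := hm
    -- Subtracting `A P_m` removes the coefficient of degree `m`; invertibility of the leading
    -- coefficient replaces division by a scalar.
    set A := Q.coeff m * ((P m).coeff m)⁻¹ with hA
    have hAm : A * (P m).coeff m = Q.coeff m := by
      rw [hA, mul_assoc, Matrix.nonsing_inv_mul _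
        ((Matrix.isUnit_iff_isUnit_det _).1 (hlead m hm')), mul_one]
    have h0 := ih hm'.le (Q - Polynomial.C A * P m) fun j hj => by
      rw [Polynomial.coeff_sub, Polynomial.coeff_C_mul]
      rcases eq_or_lt_of_le hj with rfl | hj
      · rw [hAm, sub_self]
      · rw [hQ j hj, Polynomial.coeff_eq_zero_of_natDegree_lt ((hdeg m hm').trans_lt hj), mul_zero,
          sub_zero]
    rw [innerW_sub_right hW, innerW_C_mul_right hW, hR m hm', zero_mul, sub_zero] at h0
    exact h0

/-! ### Positivity of the Gram matrix and Gram–Schmidt -/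

section posDef

open scoped ComplexOrder

theorem exists_isUnit_eq_conjTranspose_mul {𝕜 : Type*} [RCLike 𝕜] {A : Matrix (Fin N) (Fin N) 𝕜}
    (hA : A.PosDef) : ∃ B : Matrix (Fin N) (Fin N) 𝕜, IsUnit B ∧ A = B.conjTranspose * B := by
  open scoped MatrixOrder in
  obtain ⟨B, hB⟩ := CStarAlgebra.nonneg_iff_eq_star_mul_self.mp hA.posSemidef.nonneg
  refine ⟨B, ?_, hB⟩
  have h := (Matrix.isUnit_iff_isUnit_det _).1 hA.isUnit
  rw [hB, Matrix.det_mul] at h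
  exact (Matrix.isUnit_iff_isUnit_det _).2 (isUnit_of_mul_isUnit_right h)

/-- With `W = Bᵀ B`, the diagonal entry is the squared norm of row `i` of `Q Bᵀ`, and invertibility
of `B` passes its vanishing on to row `i` of `Q`. -/
theorem diag_mul_cW_mul (hW : IsMatrixWeight a b γ W) {x : ℝ} (hx : x ∈ interval a b)
    (Q : Matrix (Fin N) (Fin N) ℂ) (i : Fin N) :
    0 ≤ (Q * cW W x * Q.conjTranspose) i i ∧
      ((∃ j, Q i j ≠ 0) → (Q * cW W x * Q.conjTranspose) i i ≠ 0) := by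
  obtain ⟨B, hB, hWB⟩ := exists_isUnit_eq_conjTranspose_mul (hW.posDef x hx)
  set C : Matrix (Fin N) (Fin N) ℂ := B.map (algebraMap ℝ ℂ) with hC
  have hC1 : IsUnit C := hB.map (algebraMap ℝ ℂ).mapMatrix
  have hCW : cW W x = C.conjTranspose * C := by
    have : C.conjTranspose = B.conjTranspose.map (algebraMap ℝ ℂ) := by
      ext p q
      simp [hC, Matrix.conjTranspose_apply]
    rw [this, hC, ← Matrix.map_mul, ← hWB]
    rfl
  set D := Q * C.conjTranspose with hD
  have hDD : Q * cW W x * Q.conjTranspose = D * D.conjTranspose := by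
    rw [hCW, hD, Matrix.conjTranspose_mul, Matrix.conjTranspose_conjTranspose]
    simp only [mul_assoc]
  have hsum : (D * D.conjTranspose) i i = ∑ j, D i j * star (D i j) := by
    simp [Matrix.mul_apply, Matrix.conjTranspose_apply]
  have hnn : ∀ j ∈ Finset.univ, 0 ≤ D i j * star (D i j) := fun j _ => mul_star_self_nonneg _
  rw [hDD, hsum]
  refine ⟨Finset.sum_nonneg hnn, ?_⟩
  rintro ⟨j, hj⟩ h0
  rw [Finset.sum_eq_zero_iff_of_nonneg hnn] at h0
  have hrow : D i = 0 := funext fun k => by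
    have := h0 k (Finset.mem_univ _)
    simpa using this
  have hQ : D * C.conjTranspose⁻¹ = Q := by
    have hC2 : IsUnit C.conjTranspose.det := (Matrix.isUnit_iff_isUnit_det _).1 hC1.star
    rw [hD, mul_assoc, Matrix.mul_nonsing_inv _ hC2, mul_one]
  refine hj ?_
  rw [← hQ, Matrix.mul_apply]
  exact Finset.sum_eq_zero fun k _ => by rw [hrow, Pi.zero_apply, zero_mul]

theorem pval_apply (P : Polynomial (Matrix (Fin N) (Fin N) ℂ)) (z : ℂ) (i j : Fin N) :
    pval P z i j = ((matPolyEquiv.symm P) i j).eval z := by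
  conv_lhs => rw [← matPolyEquiv.apply_symm_apply P]
  exact matPolyEquiv_eval _ _ _ _

theorem interval_nonempty_measure_pos (hab : a < b) : 0 < volume (interval a b) := by
  refine (isOpen_interval a b).measure_pos _ ?_
  obtain ⟨d, h1, h2⟩ := EReal.lt_iff_exists_real_btwn.1 hab
  exact ⟨d, h1, h2⟩

/-- The quadratic form at `v` is a diagonal entry of the Gram matrix of `v^* P`, the integral of a
nonnegative function. That function vanishes at most at the roots of one nonzero scalar polynomial.
-/
theorem innerW_self_posDef (hab : a < b) (hW : IsMatrixWeight a b γ W)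
    (P : Polynomial (Matrix (Fin N) (Fin N) ℂ)) (n : ℕ) (hP : P.coeff n = 1) :
    (innerW a b W P P).PosDef := by
  refine Matrix.PosDef.of_dotProduct_mulVec_pos (innerW_conjTranspose hW P P) fun v hv => ?_
  obtain ⟨i, hi⟩ : ∃ i, v i ≠ 0 := by
    by_contra! h
    exact hv (funext h)
  -- The vector is repeated in every row, so that `A P` stays a square matrix polynomial. Looking at
  -- index `i` with `v i ≠ 0` makes the `(i, i)` entry of `A P` nonzero through its coefficient of
  -- degree `n`.
  set A : Matrix (Fin N) (Fin N) ℂ := Matrix.of fun _ j => star (v j) with hA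
  set Q := Polynomial.C A * P with hQ
  have h1 : star v ⬝ᵥ (innerW a b W P P).mulVec v = innerW a b W Q Q i i := by
    rw [hQ, innerW_C_mul_left hW, innerW_C_mul_right hW, Matrix.mul_apply]
    simp only [dotProduct, Matrix.mulVec, Matrix.mul_apply, Matrix.conjTranspose_apply, hA,
      Matrix.of_apply, star_star, Pi.star_apply]
  rw [h1]
  set F : ℝ → ℂ := fun x => (pval Q x * cW W x * (pval Q x).conjTranspose) i i with hF
  have hint : IntegrableOn F (interval a b) := integrableOn_innerW hW Q Q i i
  have hval : innerW a b W Q Q i i = ∫ x in interval a b, F x := rfl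
  have hreal : ∀ x ∈ interval a b, ((F x).re : ℂ) = F x := fun x hx => by
    have := (diag_mul_cW_mul hW hx (pval Q x) i).1
    have h2 := (Complex.le_def.1 this).2
    exact Complex.ext (by simp) (by simpa using h2)
  have hFre : ∫ x in interval a b, F x = ((∫ x in interval a b, (F x).re : ℝ) : ℂ) := by
    rw [← integral_complex_ofReal]
    exact setIntegral_congr_fun (isOpen_interval a b).measurableSet fun x hx => (hreal x hx).symm
  have hp0 : (matPolyEquiv.symm Q) i i ≠ 0 := by
    intro h0
    have h2 := matPolyEquiv_symm_apply_coeff Q i i n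
    rw [h0, Polynomial.coeff_zero, hQ, Polynomial.coeff_C_mul, hP, mul_one, hA,
      Matrix.of_apply] at h2
    exact hi (star_eq_zero.1 h2.symm)
  have hpos : 0 < ∫ x in interval a b, (F x).re := by
    have hint' : IntegrableOn (fun x => (F x).re) (interval a b) := hint.re
    rw [setIntegral_pos_iff_support_of_nonneg_ae _ hint']
    · have hfin : {x : ℝ | ((matPolyEquiv.symm Q) i i).eval (x : ℂ) = 0}.Finite := by
        refine Set.Finite.of_finite_image (f := fun x : ℝ => (x : ℂ)) ?_
          Complex.ofReal_injective.injOn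
        refine (Polynomial.finite_setOfPred_isRoot hp0).subset ?_
        rintro _ ⟨x, hx, rfl⟩
        exact hx
      have hsub : interval a b \ {x : ℝ | ((matPolyEquiv.symm Q) i i).eval (x : ℂ) = 0} ⊆
          Function.support (fun x => (F x).re) ∩ interval a b := by
        rintro x ⟨hx, hx0⟩
        refine ⟨fun h => ?_, hx⟩
        refine (diag_mul_cW_mul hW hx (pval Q x) i).2 ⟨i, ?_⟩ ?_
        · rw [pval_apply]; exact hx0
        · have := hreal x hx
          simp only at h
          rw [h] at this
          exact this.symm
      refine lt_of_lt_of_le ?_ (measure_mono hsub)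
      rw [measure_sdiff_null (hfin.measure_zero _)]
      exact interval_nonempty_measure_pos hab
    · refine (ae_restrict_iff' (isOpen_interval a b).measurableSet).2
        (Eventually.of_forall fun x hx => ?_)
      exact (Complex.le_def.1 (diag_mul_cW_mul hW hx (pval Q x) i).1).1
  rw [hval, hFre]
  exact_mod_cast hpos

/-- Gram–Schmidt applied to `x^n`. Orthogonality is stated against all polynomials of lower degree,
so the result does not refer to the earlier choices. -/
theorem exists_orthonormal_step (hab : a < b) (hW : IsMatrixWeight a b γ W) (n : ℕ) :
    ∃ P : Polynomial (Matrix (Fin N) (Fin N) ℂ), P.natDegree ≤ n ∧ IsUnit (P.coeff n) ∧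
      (∀ Q : Polynomial (Matrix (Fin N) (Fin N) ℂ), (∀ j, n ≤ j → Q.coeff j = 0) →
        innerW a b W P Q = 0) ∧ innerW a b W P P = 1 := by
  induction n using Nat.strong_induction_on with
  | _ n ih =>
  choose! P hdeg hlead horth hone using ih
  set X : Polynomial (Matrix (Fin N) (Fin N) ℂ) := Polynomial.X ^ n with hX
  set S := X - ∑ k ∈ Finset.range n, Polynomial.C (innerW a b W X (P k)) * P k with hS
  have hPcoeff : ∀ k < n, ∀ j, k < j → (P k).coeff j = 0 := fun k hk j hj =>
    Polynomial.coeff_eq_zero_of_natDegree_lt ((hdeg k hk).trans_lt hj)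
  have hPP : ∀ k < n, ∀ j < n, k ≠ j → innerW a b W (P k) (P j) = 0 := by
    intro k hk j hj hkj
    rcases lt_or_gt_of_ne hkj with h | h
    · rw [← innerW_conjTranspose hW, horth j hj (P k) fun l hl => hPcoeff k hk l (h.trans_le hl),
        Matrix.conjTranspose_zero]
    · exact horth k hk (P j) fun l hl => hPcoeff j hj l (h.trans_le hl)
  have hSP : ∀ j < n, innerW a b W S (P j) = 0 := by
    intro j hj
    rw [hS, innerW_sub_left hW, innerW_sum_left hW, Finset.sum_eq_single_of_mem j
      (Finset.mem_range.2 hj), innerW_C_mul_left hW, hone j hj, mul_one, sub_self]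
    intro k hk hkj
    rw [innerW_C_mul_left hW, hPP k (Finset.mem_range.1 hk) j hj hkj, mul_zero]
  have hsumc : ∀ l, n ≤ l →
      (∑ k ∈ Finset.range n, Polynomial.C (innerW a b W X (P k)) * P k).coeff l = 0 := by
    intro l hl
    rw [Polynomial.finsetSum_coeff]
    refine Finset.sum_eq_zero fun k hk => ?_
    have hk' := Finset.mem_range.1 hk
    rw [Polynomial.coeff_C_mul, hPcoeff k hk' l (hk'.trans_le hl), mul_zero]
  have hSn : S.coeff n = 1 := by
    rw [hS, Polynomial.coeff_sub, hsumc n le_rfl, hX, Polynomial.coeff_X_pow_self, sub_zero]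
  have hSdeg : S.natDegree ≤ n := by
    rw [Polynomial.natDegree_le_iff_coeff_eq_zero]
    intro l hl
    rw [hS, Polynomial.coeff_sub, hsumc l hl.le, hX, Polynomial.coeff_X_pow, if_neg hl.ne',
      sub_zero]
  have hSorth := innerW_eq_zero_of_orthogonal hW hdeg hlead hSP
  -- Normalisation: if the Gram matrix of the monic `S` is `B^* B`, left multiplication by `(B^*)⁻¹`
  -- makes it the identity.
  obtain ⟨B, hB, hBB⟩ := exists_isUnit_eq_conjTranspose_mul (innerW_self_posDef hab hW S n hSn)
  have hBd : IsUnit B.conjTranspose.det := (Matrix.isUnit_iff_isUnit_det _).1 hB.star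
  refine ⟨Polynomial.C (B.conjTranspose)⁻¹ * S, (Polynomial.natDegree_C_mul_le _ _).trans hSdeg,
    ?_, fun Q hQ => ?_, ?_⟩
  · rw [Polynomial.coeff_C_mul, hSn, mul_one, Matrix.isUnit_iff_isUnit_det]
    exact Matrix.isUnit_nonsing_inv_det _ hBd
  · rw [innerW_C_mul_left hW, hSorth Q hQ, mul_zero]
  · rw [innerW_C_mul_left hW, innerW_C_mul_right hW, hBB, Matrix.conjTranspose_nonsing_inv,
      Matrix.conjTranspose_conjTranspose, mul_assoc B.conjTranspose,
      Matrix.mul_nonsing_inv _ ((Matrix.isUnit_iff_isUnit_det _).1 hB), mul_one,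
      Matrix.nonsing_inv_mul _ hBd]

end posDef

/-- The `P_n` can be chosen independently of each other, since each is orthogonal to everything of
lower degree; Hermitian symmetry covers the other order. -/
theorem exists_isOrthonormalSeq (hab : a < b) (hW : IsMatrixWeight a b γ W) :
    ∃ P : ℕ → Polynomial (Matrix (Fin N) (Fin N) ℂ), IsOrthonormalSeq a b W P := by
  choose P hdeg hlead horth hone using exists_orthonormal_step hab hW
  have hlt : ∀ n m, m < n → innerW a b W (P n) (P m) = 0 := fun n m h =>
    horth n (P m) fun j hj => Polynomial.coeff_eq_zero_of_natDegree_lt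
      ((hdeg m).trans_lt (h.trans_le hj))
  refine ⟨P, hdeg, hlead, fun n m => ?_⟩
  rcases lt_trichotomy n m with h | rfl | h
  · rw [if_neg h.ne, ← innerW_conjTranspose hW, hlt m n h, Matrix.conjTranspose_zero]
  · rw [if_pos rfl, hone]
  · rw [if_neg h.ne', hlt n m h]

section seq

variable {P : ℕ → Polynomial (Matrix (Fin N) (Fin N) ℂ)}

theorem IsOrthonormalSeq.innerW_X_pow_of_lt (hW : IsMatrixWeight a b γ W)
    (hP : IsOrthonormalSeq a b W P) {n j : ℕ} (hj : j < n) :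
    innerW a b W (P n) (Polynomial.X ^ j) = 0 := by
  refine innerW_eq_zero_of_orthogonal hW (n := n) (fun k _ => hP.natDegree_le k)
    (fun k _ => hP.isUnit_lead k) (fun k hk => ?_) _ fun l hl => ?_
  · rw [hP.orthonormal, if_neg hk.ne']
  · rw [Polynomial.coeff_X_pow, if_neg (by omega)]

/-- `P_n - κ_n x^n` has lower degree, so `(P_n, P_n) = 1` may be computed with `κ_n x^n` in the
second slot. -/
theorem IsOrthonormalSeq.innerW_X_pow_self (hW : IsMatrixWeight a b γ W)
    (hP : IsOrthonormalSeq a b W P) (n : ℕ) :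
    innerW a b W (P n) (Polynomial.X ^ n) * (kappa P n).conjTranspose = 1 := by
  have h1 := innerW_eq_zero_of_orthogonal hW (n := n) (R := P n) (fun k _ => hP.natDegree_le k)
    (fun k _ => hP.isUnit_lead k) (fun k hk => by rw [hP.orthonormal, if_neg hk.ne'])
    (P n - Polynomial.C (kappa P n) * Polynomial.X ^ n) fun l hl => by
      rw [Polynomial.coeff_sub, Polynomial.coeff_C_mul, Polynomial.coeff_X_pow]
      rcases eq_or_lt_of_le hl with rfl | hl
      · simp [kappa]
      · rw [if_neg hl.ne', Polynomial.coeff_eq_zero_of_natDegree_lt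
          ((hP.natDegree_le n).trans_lt hl), mul_zero, sub_zero]
  rw [innerW_sub_right hW, innerW_C_mul_right hW, hP.orthonormal, if_pos rfl, sub_eq_zero] at h1
  exact h1.symm

end seq

/-! ### Entrywise polynomial matrix functions -/

/-- A matrix function whose entries are polynomials. -/
def IsMatPoly {ι κ : Type*} (f : ℂ → Matrix ι κ ℂ) : Prop :=
  ∃ p : ι → κ → Polynomial ℂ, ∀ z i j, f z i j = (p i j).eval z

section IsMatPoly

variable {ι κ ν ξ : Type*}

theorem IsMatPoly.const (A : Matrix ι κ ℂ) : IsMatPoly fun _ => A :=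
  ⟨fun i j => Polynomial.C (A i j), fun z i j => by simp⟩

theorem IsMatPoly.neg {f : ℂ → Matrix ι κ ℂ} (hf : IsMatPoly f) : IsMatPoly fun z => -f z := by
  obtain ⟨p, hp⟩ := hf
  exact ⟨fun i j => -p i j, fun z i j => by simp [hp]⟩

theorem IsMatPoly.const_smul {f : ℂ → Matrix ι κ ℂ} (hf : IsMatPoly f) (c : ℂ) :
    IsMatPoly fun z => c • f z := by
  obtain ⟨p, hp⟩ := hf
  exact ⟨fun i j => Polynomial.C c * p i j, fun z i j => by simp [hp]⟩

theorem IsMatPoly.pow_smul {f : ℂ → Matrix ι κ ℂ} (hf : IsMatPoly f) (k : ℕ) :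
    IsMatPoly fun z => z ^ k • f z := by
  obtain ⟨p, hp⟩ := hf
  exact ⟨fun i j => Polynomial.X ^ k * p i j, fun z i j => by simp [hp]⟩

theorem IsMatPoly.mul [Fintype κ] {f : ℂ → Matrix ι κ ℂ} {g : ℂ → Matrix κ ν ℂ} (hf : IsMatPoly f)
    (hg : IsMatPoly g) : IsMatPoly fun z => f z * g z := by
  obtain ⟨p, hp⟩ := hf
  obtain ⟨q, hq⟩ := hg
  exact ⟨fun i j => ∑ k, p i k * q k j, fun z i j => by
    simp [hp, hq, Matrix.mul_apply, Polynomial.eval_finsetSum]⟩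

theorem IsMatPoly.sum {τ : Type*} (s : Finset τ) {f : τ → ℂ → Matrix ι κ ℂ}
    (hf : ∀ k ∈ s, IsMatPoly (f k)) : IsMatPoly fun z => ∑ k ∈ s, f k z := by
  choose! p hp using hf
  refine ⟨fun i j => ∑ k ∈ s, p k i j, fun z i j => ?_⟩
  change (∑ k ∈ s, f k z) i j = (∑ k ∈ s, p k i j).eval z
  rw [Matrix.sum_apply, Polynomial.eval_finsetSum]
  exact Finset.sum_congr rfl fun k hk => hp k hk z i j

theorem IsMatPoly.fromBlocks {A : ℂ → Matrix ι κ ℂ} {B : ℂ → Matrix ι ν ℂ} {C : ℂ → Matrix ξ κ ℂ}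
    {D : ℂ → Matrix ξ ν ℂ} (hA : IsMatPoly A) (hB : IsMatPoly B) (hC : IsMatPoly C)
    (hD : IsMatPoly D) : IsMatPoly fun z => Matrix.fromBlocks (A z) (B z) (C z) (D z) := by
  obtain ⟨p, hp⟩ := hA
  obtain ⟨q, hq⟩ := hB
  obtain ⟨r, hr⟩ := hC
  obtain ⟨s, hs⟩ := hD
  refine ⟨Sum.elim (fun i => Sum.elim (p i) (q i)) (fun i => Sum.elim (r i) (s i)), fun z i j => ?_⟩
  rcases i with i | i <;> rcases j with j | j <;> simp [hp, hq, hr, hs]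

theorem IsMatPoly.starFun {f : ℂ → Matrix (Fin N) (Fin N) ℂ} (hf : IsMatPoly f) :
    IsMatPoly (starFun f) := by
  obtain ⟨p, hp⟩ := hf
  refine ⟨fun i j => (p j i).map (starRingEnd ℂ), fun z i j => ?_⟩
  have h := Polynomial.eval_map_apply (p := p j i) (f := starRingEnd ℂ) (starRingEnd ℂ z)
  rw [Complex.conj_conj] at h
  rw [h, MOPRL.starFun, Matrix.conjTranspose_apply, hp]
  rfl

theorem IsMatPoly.differentiable {f : ℂ → Matrix ι κ ℂ} (hf : IsMatPoly f) (i : ι) (j : κ) :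
    Differentiable ℂ fun z => f z i j := by
  obtain ⟨p, hp⟩ := hf
  simp only [hp]
  exact (p i j).differentiable

theorem IsMatPoly.continuous {f : ℂ → Matrix ι κ ℂ} (hf : IsMatPoly f) : Continuous f :=
  continuous_matrix fun i j => (hf.differentiable i j).continuous

theorem IsMatPoly.exists_polynomial [Fintype ι] [DecidableEq ι] {f : ℂ → Matrix ι ι ℂ}
    (hf : IsMatPoly f) : ∃ S : Polynomial (Matrix ι ι ℂ), ∀ z, f z = pval S z := by
  obtain ⟨p, hp⟩ := hf
  refine ⟨matPolyEquiv (Matrix.of p), fun z => ?_⟩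
  ext i j
  rw [hp]
  exact (matPolyEquiv_eval _ _ _ _).symm

theorem isMatPoly_pval (P : Polynomial (Matrix (Fin N) (Fin N) ℂ)) : IsMatPoly (pval P) :=
  ⟨fun i j => matPolyEquiv.symm P i j, fun z i j => pval_apply P z i j⟩

end IsMatPoly

section transfer

variable (hW : IsMatrixWeight a b γ W) (P : ℕ → Polynomial (Matrix (Fin N) (Fin N) ℂ))
include hW

theorem isMatPoly_secondKind (n : ℕ) : IsMatPoly (secondKind a b W P n) := by
  have h : secondKind a b W P n = _ := funext fun z => secondKind_eq_sum hW P le_rfl z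
  rw [h]
  exact IsMatPoly.sum _ fun k _ => IsMatPoly.sum _ fun i _ => (IsMatPoly.const _).pow_smul _

theorem isMatPoly_transferR (n : ℕ) : IsMatPoly (transferR a b W P n) := by
  cases n with
  | zero => exact IsMatPoly.const 1
  | succ n =>
    exact IsMatPoly.fromBlocks ((IsMatPoly.const _).mul (isMatPoly_pval _))
      (((IsMatPoly.const _).mul (isMatPoly_secondKind hW P _)).const_smul _)
      (((IsMatPoly.const _).mul (isMatPoly_pval _)).const_smul _).neg
      ((IsMatPoly.const _).mul (isMatPoly_secondKind hW P _)).neg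

theorem isMatPoly_transferDual (n : ℕ) : IsMatPoly (transferDual a b W P n) := by
  cases n with
  | zero => exact IsMatPoly.const 1
  | succ n =>
    exact IsMatPoly.fromBlocks
      ((isMatPoly_secondKind hW P _).starFun.mul (IsMatPoly.const _)).neg
      (((isMatPoly_secondKind hW P _).starFun.mul (IsMatPoly.const _)).const_smul _).neg
      (((isMatPoly_pval _).starFun.mul (IsMatPoly.const _)).const_smul _)
      ((isMatPoly_pval _).starFun.mul (IsMatPoly.const _))

end transfer

/-! ### Asymptotic expansions at infinity -/

/-- Entrywise `O`. -/
def EntryO {ι κ E : Type*} [Norm E] (l : Filter ℂ) (f : ℂ → Matrix ι κ ℂ) (g : ℂ → E) : Prop :=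
  ∀ i j, (fun z => f z i j) =O[l] g

section EntryO

variable {ι κ ν E : Type*} [NormedAddCommGroup E] {l : Filter ℂ} {f f' : ℂ → Matrix ι κ ℂ}
  {g : ℂ → E}

theorem EntryO.add (hf : EntryO l f g) (hf' : EntryO l f' g) : EntryO l (fun z => f z + f' z) g :=
  fun i j => (hf i j).add (hf' i j)

theorem EntryO.sum {τ : Type*} {s : Finset τ} {F : τ → ℂ → Matrix ι κ ℂ}
    (h : ∀ k ∈ s, EntryO l (F k) g) : EntryO l (fun z => ∑ k ∈ s, F k z) g := fun i j => by
  simp only [Matrix.sum_apply]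
  exact IsBigO.fun_sum fun k hk => h k hk i j

theorem EntryO.const_mul [Fintype ι] (A : Matrix ν ι ℂ) (hf : EntryO l f g) :
    EntryO l (fun z => A * f z) g := fun i j => by
  simp only [Matrix.mul_apply]
  exact IsBigO.fun_sum fun k _ => (hf k j).const_mul_left _

theorem EntryO.smul {φ u v : ℂ → ℂ} (hφ : φ =O[l] u) (hf : EntryO l f v) :
    EntryO l (fun z => φ z • f z) fun z => u z * v z := fun i j => by
  simpa only [Matrix.smul_apply, smul_eq_mul] using hφ.mul (hf i j)

theorem EntryO.congr' (hf : EntryO l f g) (h : ∀ᶠ z in l, f z = f' z) : EntryO l f' g :=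
  fun i j => (hf i j).congr' (h.mono fun z hz => by simp only [hz]) EventuallyEq.rfl

end EntryO

theorem eventually_atInfty_ne_zero (a b : EReal) :
    ∀ᶠ z in atInfty a b, z ≠ 0 ∧ z ∈ (cut a b)ᶜ := by
  have h : ∀ᶠ z in atInfty a b, z ≠ 0 :=
    (Bornology.eventually_ne_cobounded 0).filter_mono inf_le_left
  exact h.and (mem_inf_of_right (mem_principal_self _))

theorem inv_pow_isBigO_inv_pow {m k : ℕ} (h : m ≤ k) :
    (fun z : ℂ => (z ^ k)⁻¹) =O[atInfty a b] fun z => (z ^ m)⁻¹ := by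
  refine IsBigO.of_bound 1 ?_
  have h1 : ∀ᶠ z in atInfty a b, 1 < ‖z‖ :=
    (tendsto_norm_cobounded_atTop.mono_left inf_le_left).eventually_gt_atTop _
  filter_upwards [h1] with z hz
  rw [one_mul, norm_inv, norm_inv, norm_pow, norm_pow]
  gcongr
  exact hz.le

/-- The asymptotic expansion `f(z) ~ ∑ c_k z^{-k}` at infinity off the cut. -/
def HasExpansion {ι κ : Type*} (a b : EReal) (f : ℂ → Matrix ι κ ℂ) (c : ℕ → Matrix ι κ ℂ) :
    Prop :=
  ∀ m : ℕ, EntryO (atInfty a b) (fun z => f z - ∑ k ∈ Finset.range (m + 1), (z ^ k)⁻¹ • c k)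
    fun z => (z ^ (m + 1))⁻¹

section HasExpansion

variable {ι κ ν ξ : Type*} {f : ℂ → Matrix ι κ ℂ} {c : ℕ → Matrix ι κ ℂ}

theorem entryO_inv_pow_smul (A : Matrix ι κ ℂ) {m k : ℕ} (h : m ≤ k) :
    EntryO (atInfty a b) (fun z => (z ^ k)⁻¹ • A) fun z => (z ^ m)⁻¹ := fun i j => by
  simp only [Matrix.smul_apply, smul_eq_mul, mul_comm _ (A i j)]
  exact (inv_pow_isBigO_inv_pow h).const_mul_left _

/-- It suffices to bound the remainders of arbitrarily long partial sums. -/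
theorem HasExpansion.of_exists_ge (h : ∀ m : ℕ, ∃ K ≥ m, EntryO (atInfty a b)
    (fun z => f z - ∑ k ∈ Finset.range K, (z ^ k)⁻¹ • c k) fun z => (z ^ m)⁻¹) :
    HasExpansion a b f c := by
  intro m
  obtain ⟨K, hK, hO⟩ := h (m + 1)
  have h2 : EntryO (atInfty a b) (fun z => ∑ k ∈ Finset.Ico (m + 1) K, (z ^ k)⁻¹ • c k)
      fun z => (z ^ (m + 1))⁻¹ :=
    EntryO.sum fun k hk => entryO_inv_pow_smul _ (Finset.mem_Ico.1 hk).1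
  refine (hO.add h2).congr' (Eventually.of_forall fun z => ?_)
  rw [← Finset.sum_range_add_sum_Ico _ hK]
  abel

theorem HasExpansion.const_mul [Fintype ι] (A : Matrix ν ι ℂ) (h : HasExpansion a b f c) :
    HasExpansion a b (fun z => A * f z) fun k => A * c k := fun m => by
  refine ((h m).const_mul A).congr' (Eventually.of_forall fun z => ?_)
  rw [Matrix.mul_sub, Matrix.mul_sum]
  simp only [Matrix.mul_smul]

theorem HasExpansion.const_smul (s : ℂ) (h : HasExpansion a b f c) :
    HasExpansion a b (fun z => s • f z) fun k => s • c k := fun m => by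
  have h1 : EntryO (atInfty a b) (fun z => s • (f z - ∑ k ∈ Finset.range (m + 1), (z ^ k)⁻¹ • c k))
      fun z => (z ^ (m + 1))⁻¹ := fun i j => by
    simp only [Matrix.smul_apply, smul_eq_mul]
    exact (h m i j).const_mul_left s
  refine h1.congr' (Eventually.of_forall fun z => ?_)
  rw [smul_sub, Finset.smul_sum]
  simp only [smul_comm s]

theorem HasExpansion.congr' {f' : ℂ → Matrix ι κ ℂ} (h : HasExpansion a b f c)
    (hf : ∀ᶠ z in atInfty a b, f z = f' z) : HasExpansion a b f' c := fun m =>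
  (h m).congr' (hf.mono fun z hz => by rw [hz])

/-- Vanishing of the first `q` coefficients keeps positive powers of `z` from appearing;
orthogonality supplies it. -/
theorem HasExpansion.pow_smul {q : ℕ} (h : HasExpansion a b f c) (hc : ∀ k < q, c k = 0) :
    HasExpansion a b (fun z => z ^ q • f z) fun k => c (q + k) := fun m => by
  have h1 := EntryO.smul (isBigO_refl (fun z : ℂ => z ^ q) _) (h (q + m))
  intro i j
  refine IsBigO.congr' (h1 i j) ?_ ?_
  · filter_upwards [eventually_atInfty_ne_zero a b] with z hz
    rw [add_assoc q m 1, Finset.sum_range_add, Finset.sum_eq_zero fun k hk => by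
      rw [hc k (Finset.mem_range.1 hk), smul_zero], zero_add, smul_sub, Finset.smul_sum]
    have : ∀ k, z ^ q • (z ^ (q + k))⁻¹ • c (q + k) = (z ^ k)⁻¹ • c (q + k) := fun k => by
      have := pow_ne_zero q hz.1
      rw [smul_smul, pow_add, mul_inv, ← mul_assoc, mul_inv_cancel₀ this, one_mul]
    simp only [this]
  · filter_upwards [eventually_atInfty_ne_zero a b] with z hz
    have := pow_ne_zero q hz.1
    rw [add_assoc, pow_add, mul_inv, ← mul_assoc, mul_inv_cancel₀ this, one_mul]

theorem HasExpansion.fromBlocks {A : ℂ → Matrix ι κ ℂ} {B : ℂ → Matrix ι ν ℂ} {C : ℂ → Matrix ξ κ ℂ}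
    {D : ℂ → Matrix ξ ν ℂ} {cA : ℕ → Matrix ι κ ℂ} {cB : ℕ → Matrix ι ν ℂ}
    {cC : ℕ → Matrix ξ κ ℂ} {cD : ℕ → Matrix ξ ν ℂ} (hA : HasExpansion a b A cA)
    (hB : HasExpansion a b B cB) (hC : HasExpansion a b C cC) (hD : HasExpansion a b D cD) :
    HasExpansion a b (fun z => Matrix.fromBlocks (A z) (B z) (C z) (D z))
      fun k => Matrix.fromBlocks (cA k) (cB k) (cC k) (cD k) := fun m i j => by
  rcases i with i | i <;> rcases j with j | j
  · simpa [Matrix.sum_apply] using hA m i j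
  · simpa [Matrix.sum_apply] using hB m i j
  · simpa [Matrix.sum_apply] using hC m i j
  · simpa [Matrix.sum_apply] using hD m i j

theorem hasExpansion_const (A : Matrix ι κ ℂ) :
    HasExpansion a b (fun _ => A) fun k => if k = 0 then A else 0 := fun m => by
  have : ∀ z : ℂ, A - ∑ k ∈ Finset.range (m + 1), (z ^ k)⁻¹ • (if k = 0 then A else 0) = 0 := by
    intro z
    rw [Finset.sum_eq_single_of_mem 0 (by simp) (fun k _ hk => by simp [hk])]
    simp
  intro i j
  simp only [this, Matrix.zero_apply]
  exact isBigO_zero _ _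

end HasExpansion

theorem hasExpansion_pval (P : Polynomial (Matrix (Fin N) (Fin N) ℂ)) {n : ℕ}
    (hn : P.natDegree ≤ n) : HasExpansion a b (fun z => (z ^ n)⁻¹ • pval P z)
      fun k => if k ≤ n then P.coeff (n - k) else 0 := by
  refine HasExpansion.of_exists_ge fun m => ⟨max m (n + 1), le_max_left _ _, ?_⟩
  have h0 : EntryO (atInfty a b) (fun _ => (0 : Matrix (Fin N) (Fin N) ℂ))
      fun z : ℂ => (z ^ m)⁻¹ := fun i j => isBigO_zero _ _
  refine h0.congr' ?_
  filter_upwards [eventually_atInfty_ne_zero a b] with z hz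
  rw [← Finset.sum_subset (Finset.range_mono (le_max_right m (n + 1))) fun k _ hk => by
    rw [if_neg (by have := mt Finset.mem_range.2 hk; omega), smul_zero], pval_eq_sum P hn,
    ← Finset.sum_range_reflect, Finset.smul_sum, ← Finset.sum_sub_distrib]
  refine (Finset.sum_eq_zero fun k hk => ?_).symm
  have hk' : k ≤ n := Nat.lt_succ_iff.1 (Finset.mem_range.1 hk)
  rw [if_pos hk', smul_smul, show n + 1 - 1 - k = n - k by omega]
  have h2 : (z ^ n)⁻¹ * z ^ (n - k) = (z ^ k)⁻¹ := by
    rw [eq_comm, inv_eq_iff_eq_inv, mul_inv, inv_inv]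
    have h3 : z ^ n = z ^ k * z ^ (n - k) := by rw [← pow_add]; congr 1; omega
    rw [h3, mul_assoc, mul_inv_cancel₀ (pow_ne_zero _ hz.1), mul_one]
  rw [h2, sub_self]

theorem hasExpansion_cauchyPoly (hab : a < b) (hW : IsMatrixWeight a b γ W)
    (P : Polynomial (Matrix (Fin N) (Fin N) ℂ)) : HasExpansion a b (cauchyPoly a b W P)
      fun k => if k = 0 then 0 else -innerW a b W P (Polynomial.X ^ (k - 1)) := by
  -- The exact remainder is only `z^{-m}` times a bounded function, one power short of what an
  -- expansion asks; comparing with longer partial sums recovers it.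
  refine HasExpansion.of_exists_ge fun m => ⟨m + 1, Nat.le_succ m, ?_⟩
  have hB : EntryO (atInfty a b) (fun z => ∑ k ∈ Finset.range (P.natDegree + 1),
      P.coeff k * cauchyPow a b W (k + m) z) fun _ => (1 : ℂ) :=
    EntryO.sum fun k _ => EntryO.const_mul _ fun i j =>
      (hW.isBigO_atInfty hab i j (k + m)).trans (isBigO_of_le _ fun _ => by simp)
  have h1 := EntryO.smul (isBigO_refl (fun z : ℂ => (z ^ m)⁻¹) (atInfty a b)) hB
  simp only [mul_one] at h1
  refine h1.congr' ?_
  filter_upwards [eventually_atInfty_ne_zero a b] with z hz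
  have h2 : ∑ k ∈ Finset.range (m + 1), (z ^ k)⁻¹ •
      (if k = 0 then 0 else -innerW a b W P (Polynomial.X ^ (k - 1))) =
      -(∑ j ∈ Finset.range m, (z ^ (j + 1))⁻¹ • innerW a b W P (Polynomial.X ^ j)) := by
    rw [Finset.sum_range_succ']
    simp
  rw [cauchyPoly_expansion hW P m hz.2 hz.1, h2, add_sub_cancel_left]

/-! ### The function `R_n Y^0` solves the Riemann–Hilbert problem -/

theorem tendsto_matrix_iff {α ι κ : Type*} {l : Filter α} {f : α → Matrix ι κ ℂ}
    {A : Matrix ι κ ℂ} : Tendsto f l (𝓝 A) ↔ ∀ i j, Tendsto (fun z => f z i j) l (𝓝 (A i j)) :=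
  tendsto_pi_nhds.trans (forall_congr' fun _ => tendsto_pi_nhds)

/-- Full limits from the half plane at every point already force continuous boundary values, by
extension into a regular space; no uniformity in the Plemelj formula is needed. -/
theorem continuousOn_of_tendsto_nhdsUpper {Y : ℂ → BlockMat N} {Yp : ℝ → BlockMat N} {s : Set ℝ}
    (h : ∀ x ∈ s, Tendsto Y (nhdsUpper x) (𝓝 (Yp x))) : ContinuousOn Yp s := by
  have hreg : RegularSpace (BlockMat N) :=
    inferInstanceAs (RegularSpace (Fin N ⊕ Fin N → Fin N ⊕ Fin N → ℂ))
  have h1 : ContinuousOn (extendFrom {z : ℂ | 0 < z.im} Y) ((fun x : ℝ => (x : ℂ)) '' s) := by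
    refine continuousOn_extendFrom ?_ ?_
    · rintro _ ⟨x, -, rfl⟩
      exact mem_closure_upper x
    · rintro _ ⟨x, hx, rfl⟩
      exact ⟨_, h x hx⟩
  refine (h1.comp Complex.continuous_ofReal.continuousOn (Set.mapsTo_image _ s)).congr fun x hx => ?_
  exact (extendFrom_eq (mem_closure_upper x) (h x hx)).symm

theorem continuousOn_of_tendsto_nhdsLower {Y : ℂ → BlockMat N} {Ym : ℝ → BlockMat N} {s : Set ℝ}
    (h : ∀ x ∈ s, Tendsto Y (nhdsLower x) (𝓝 (Ym x))) : ContinuousOn Ym s := by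
  have hreg : RegularSpace (BlockMat N) :=
    inferInstanceAs (RegularSpace (Fin N ⊕ Fin N → Fin N ⊕ Fin N → ℂ))
  have h1 : ContinuousOn (extendFrom {z : ℂ | z.im < 0} Y) ((fun x : ℝ => (x : ℂ)) '' s) := by
    refine continuousOn_extendFrom ?_ ?_
    · rintro _ ⟨x, -, rfl⟩
      exact mem_closure_lower x
    · rintro _ ⟨x, hx, rfl⟩
      exact ⟨_, h x hx⟩
  refine (h1.comp Complex.continuous_ofReal.continuousOn (Set.mapsTo_image _ s)).congr fun x hx => ?_
  exact (extendFrom_eq (mem_closure_lower x) (h x hx)).symm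

theorem cauchyW_apply (z : ℂ) (i j : Fin N) : cauchyW a b W z i j =
    (2 * Real.pi * Complex.I : ℂ)⁻¹ * cauchyInt (wEntry a b W i j) z := by
  rw [cauchyW_eq]
  simp [cauchyPow]

theorem two_pi_I_ne_zero : (2 * Real.pi * Complex.I : ℂ) ≠ 0 := by
  have := Real.pi_ne_zero
  simp [this]

theorem IsMatrixWeight.cauchyW_boundary (hW : IsMatrixWeight a b γ W) {x : ℝ}
    (hx : x ∈ interval a b) : ∃ Cp Cm : Matrix (Fin N) (Fin N) ℂ,
      Tendsto (cauchyW a b W) (nhdsUpper x) (𝓝 Cp) ∧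
      Tendsto (cauchyW a b W) (nhdsLower x) (𝓝 Cm) ∧ Cp = Cm + cW W x := by
  choose vp vm h1 h2 h3 using fun i j => hW.boundary_values i j hx
  refine ⟨Matrix.of fun i j => (2 * Real.pi * Complex.I : ℂ)⁻¹ * vp i j,
    Matrix.of fun i j => (2 * Real.pi * Complex.I : ℂ)⁻¹ * vm i j, ?_, ?_, ?_⟩
  · refine tendsto_matrix_iff.2 fun i j => ?_
    simp only [cauchyW_apply, Matrix.of_apply]
    exact (h1 i j).const_mul _
  · refine tendsto_matrix_iff.2 fun i j => ?_
    simp only [cauchyW_apply, Matrix.of_apply]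
    exact (h2 i j).const_mul _
  · ext i j
    have h := h3 i j
    rw [sub_eq_iff_eq_add] at h
    have h0 := two_pi_I_ne_zero
    simp only [Matrix.of_apply, Matrix.add_apply, cW, Matrix.map_apply, h]
    rw [mul_add, inv_mul_cancel_left₀ h0, add_comm]

theorem tendsto_fromBlocks_one {l : Filter ℂ} {f : ℂ → Matrix (Fin N) (Fin N) ℂ}
    {A : Matrix (Fin N) (Fin N) ℂ} (h : Tendsto f l (𝓝 A)) :
    Tendsto (fun z => (Matrix.fromBlocks 1 (f z) 0 1 : BlockMat N)) l
      (𝓝 (Matrix.fromBlocks 1 A 0 1)) := by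
  refine tendsto_matrix_iff.2 fun i j => ?_
  rcases i with i | i <;> rcases j with j | j <;> simp only [Matrix.fromBlocks_apply₁₁,
    Matrix.fromBlocks_apply₁₂, Matrix.fromBlocks_apply₂₁, Matrix.fromBlocks_apply₂₂]
  · exact tendsto_const_nhds
  · exact tendsto_matrix_iff.1 h i j
  · exact tendsto_const_nhds
  · exact tendsto_const_nhds

theorem analyticOnNhd_cauchyW (hW : IsMatrixWeight a b γ W) (i j : Fin N) :
    AnalyticOnNhd ℂ (fun z => cauchyW a b W z i j) (cut a b)ᶜ := by
  simp only [cauchyW_apply]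
  exact analyticOnNhd_const.mul (analyticOnNhd_cauchyInt (hW.integrable_wEntry i j)
    fun t ht => wEntry_of_notMem ht i j)

theorem analyticOnNhd_mul {s : Set ℂ} {ι κ ν : Type*} [Fintype κ] {f : ℂ → Matrix ι κ ℂ}
    {g : ℂ → Matrix κ ν ℂ} (hf : ∀ i j, AnalyticOnNhd ℂ (fun z => f z i j) s)
    (hg : ∀ i j, AnalyticOnNhd ℂ (fun z => g z i j) s) (i : ι) (j : ν) :
    AnalyticOnNhd ℂ (fun z => (f z * g z) i j) s := by
  simp only [Matrix.mul_apply]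
  exact Finset.analyticOnNhd_fun_sum _ fun k _ => (hf i k).mul (hg k j)

theorem analyticOnNhd_fromBlocks_one {s : Set ℂ} {f : ℂ → Matrix (Fin N) (Fin N) ℂ}
    (hf : ∀ i j, AnalyticOnNhd ℂ (fun z => f z i j) s) (i j : Fin N ⊕ Fin N) :
    AnalyticOnNhd ℂ (fun z => (Matrix.fromBlocks 1 (f z) 0 1 : BlockMat N) i j) s := by
  rcases i with i | i <;> rcases j with j | j <;> simp only [Matrix.fromBlocks_apply₁₁,
    Matrix.fromBlocks_apply₁₂, Matrix.fromBlocks_apply₂₁, Matrix.fromBlocks_apply₂₂]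
  · exact analyticOnNhd_const
  · exact hf i j
  · exact analyticOnNhd_const
  · exact analyticOnNhd_const

theorem IsMatPoly.analyticOnNhd {ι κ : Type*} {f : ℂ → Matrix ι κ ℂ} (hf : IsMatPoly f) (s : Set ℂ)
    (i : ι) (j : κ) : AnalyticOnNhd ℂ (fun z => f z i j) s := fun z _ =>
  (hf.differentiable i j).analyticAt z

theorem IsMatPoly.isBigO_one {ι κ : Type*} {f : ℂ → Matrix ι κ ℂ} (hf : IsMatPoly f) (c : ℂ)
    {l : Filter ℂ} (hl : l ≤ 𝓝 c) (i : ι) (j : κ) : (fun z => f z i j) =O[l] fun _ => (1 : ℝ) :=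
  (((hf.differentiable i j).continuous.tendsto c).mono_left hl).isBigO_one ℝ

theorem one_isBigO_hfun (hab : a < b) {c : ℝ} (hc : IsFiniteEndpoint a b c) (g : ℝ) :
    (fun _ : ℂ => (1 : ℝ)) =O[atEndpoint a b c] hfun g c := by
  refine IsBigO.of_bound 1 ?_
  have hnear : ∀ᶠ z : ℂ in atEndpoint a b c, ‖z - c‖ < Real.exp (-1) := by
    have : Tendsto (fun z : ℂ => ‖z - c‖) (atEndpoint a b c) (𝓝 ‖(c : ℂ) - c‖) :=
      (Continuous.tendsto (by fun_prop) _).mono_left nhdsWithin_le_nhds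
    rw [sub_self, norm_zero] at this
    exact this.eventually_lt_const (Real.exp_pos _)
  have hev : ∀ᶠ z in atEndpoint a b c, z ∈ (cut a b)ᶜ := eventually_mem_nhdsWithin
  filter_upwards [hnear, hev] with z hz hzc
  rw [norm_hfun, norm_one, one_mul]
  refine one_le_hdist (norm_pos_iff.2 (sub_ne_zero.2 ?_)) hz
  rintro rfl
  exact hzc (coe_mem_cut hab hc)

theorem cauchyW_isBigO_hfun (hab : a < b) (hW : IsMatrixWeight a b γ W) {c : ℝ}
    (hc : IsFiniteEndpoint a b c) (i j : Fin N) :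
    (fun z => cauchyW a b W z i j) =O[atEndpoint a b c] hfun (γ c) c := by
  simp only [cauchyW_apply]
  exact (hW.isBigO_atEndpoint hab i j hc).const_mul_left _

theorem fromBlocks_mul_diagPow_neg (A B C D : Matrix (Fin N) (Fin N) ℂ) (n : ℕ) (z : ℂ) :
    (Matrix.fromBlocks A B C D : BlockMat N) * diagPow (-(n : ℤ)) z =
      Matrix.fromBlocks ((z ^ n)⁻¹ • A) (z ^ n • B) ((z ^ n)⁻¹ • C) (z ^ n • D) := by
  rw [diagPow, Matrix.fromBlocks_multiply]
  simp

theorem diagPow_neg_mul_diagPow (k : ℤ) {z : ℂ} (hz : z ≠ 0) :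
    (diagPow (-k) z * diagPow k z : BlockMat N) = 1 := by
  rw [diagPow, diagPow, Matrix.fromBlocks_multiply]
  have hk := zpow_ne_zero k hz
  simp [smul_smul, hk, Matrix.fromBlocks_one]

theorem exists_infinity_of_hasExpansion {Y : ℂ → BlockMat N} {n : ℕ} {c : ℕ → BlockMat N}
    (h : HasExpansion a b (fun z => Y z * diagPow (-(n : ℤ)) z) c) (hc : c 0 = 1) :
    ∃ A : ℕ → BlockMat N, ∀ m : ℕ, 1 ≤ m → ∃ E : ℂ → BlockMat N,
    (∀ i j, (fun z => E z i j) =O[atInfty a b] fun z => (z ^ (m + 1))⁻¹) ∧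
    ∀ᶠ z in atInfty a b,
      Y z = (1 + ∑ k ∈ Finset.Icc 1 m, (z ^ k)⁻¹ • A k + E z) * diagPow n z := by
  refine ⟨c, fun m _ => ⟨_, h m, ?_⟩⟩
  filter_upwards [eventually_atInfty_ne_zero a b] with z hz
  have h1 : ∑ k ∈ Finset.range (m + 1), (z ^ k)⁻¹ • c k =
      1 + ∑ k ∈ Finset.Icc 1 m, (z ^ k)⁻¹ • c k := by
    rw [Finset.range_eq_Ico, Finset.sum_eq_sum_Ico_succ_bot (Nat.succ_pos m), hc]
    simp only [pow_zero, inv_one, one_smul]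
    congr 1
  rw [h1, add_sub_cancel, mul_assoc, diagPow_neg_mul_diagPow _ hz.1, mul_one]

/-- The second column becomes a pure Cauchy transform of polynomials times `W`, the form whose
expansion is known. -/
theorem solY_succ_eq (hW : IsMatrixWeight a b γ W)
    (P : ℕ → Polynomial (Matrix (Fin N) (Fin N) ℂ)) (n : ℕ) {z : ℂ} (hz : z ∈ (cut a b)ᶜ) :
    solY a b W P (n + 1) z = Matrix.fromBlocks
      ((kappa P (n + 1))⁻¹ * pval (P (n + 1)) z)
      ((2 * Real.pi * Complex.I : ℂ)⁻¹ • ((kappa P (n + 1))⁻¹ * cauchyPoly a b W (P (n + 1)) z))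
      (-(2 * Real.pi * Complex.I : ℂ) • ((kappa P n).conjTranspose * pval (P n) z))
      (-(kappa P n).conjTranspose * cauchyPoly a b W (P n) z) := by
  have h0 := two_pi_I_ne_zero
  rw [solY, transferR, Y0, Matrix.fromBlocks_multiply, cauchyPoly_eq hW P _ hz,
    cauchyPoly_eq hW P _ hz, cauchyW_eq]
  congr 1
  · simp
  · simp only [mul_one, Matrix.mul_smul, mul_add, smul_add, mul_assoc]
  · simp
  · generalize (2 * Real.pi * Complex.I : ℂ) = s at h0 ⊢
    simp only [mul_one, Matrix.mul_smul, neg_mul, Matrix.smul_mul, mul_add,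
      smul_smul, inv_mul_cancel₀ h0, one_smul, mul_assoc]

/-- Both entries of the right column are shifted by `z^{n+1}`, which is allowed because `P_{n+1}`
and `P_n` are orthogonal to `1, …, x^{n-1}`. The next coefficient vanishes for `P_{n+1}`, and for
`P_n` it is `-(κ_n^*)⁻¹`, cancelled by the factor `-κ_n^*`. -/
theorem solY_hasExpansion (hab : a < b) (hW : IsMatrixWeight a b γ W)
    {P : ℕ → Polynomial (Matrix (Fin N) (Fin N) ℂ)} (hP : IsOrthonormalSeq a b W P) (n : ℕ) :
    ∃ c : ℕ → BlockMat N, c 0 = 1 ∧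
      HasExpansion a b (fun z => solY a b W P n z * diagPow (-(n : ℤ)) z) c := by
  cases n with
  | zero =>
    have hC := (hasExpansion_cauchyPoly hab hW 1).const_smul (2 * Real.pi * Complex.I : ℂ)⁻¹
    have h := HasExpansion.fromBlocks (hasExpansion_const (a := a) (b := b)
      (1 : Matrix (Fin N) (Fin N) ℂ)) hC (hasExpansion_const (0 : Matrix (Fin N) (Fin N) ℂ))
      (hasExpansion_const (1 : Matrix (Fin N) (Fin N) ℂ))
    refine ⟨_, ?_, h.congr' (Eventually.of_forall fun z => ?_)⟩
    · simp [Matrix.fromBlocks_one]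
    · rw [solY, transferR, Y0, one_mul, fromBlocks_mul_diagPow_neg, cauchyW_eq]
      simp [cauchyPoly]
  | succ n =>
    have hκ : (kappa P (n + 1))⁻¹ * kappa P (n + 1) = 1 :=
      Matrix.nonsing_inv_mul _ ((Matrix.isUnit_iff_isUnit_det _).1 (hP.isUnit_lead (n + 1)))
    have h11 := (hasExpansion_pval (a := a) (b := b) (P (n + 1)) (hP.natDegree_le (n + 1))).const_mul
      (kappa P (n + 1))⁻¹
    have h21 := ((hasExpansion_pval (a := a) (b := b) (P n)
      ((hP.natDegree_le n).trans (Nat.le_succ n))).const_mul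
      (kappa P n).conjTranspose).const_smul (-(2 * Real.pi * Complex.I : ℂ))
    have hz : ∀ p, n ≤ p → ∀ k < n + 1, (if k = 0 then 0 else
        -innerW a b W (P p) (Polynomial.X ^ (k - 1))) = 0 := by
      intro p hp k hk
      split_ifs with hk0
      · rfl
      · rw [hP.innerW_X_pow_of_lt hW (by omega), neg_zero]
    have h12 := (((hasExpansion_cauchyPoly hab hW (P (n + 1))).pow_smul
      (hz (n + 1) (Nat.le_succ n))).const_mul (kappa P (n + 1))⁻¹).const_smul
      (2 * Real.pi * Complex.I : ℂ)⁻¹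
    have h22 := ((hasExpansion_cauchyPoly hab hW (P n)).pow_smul (hz n le_rfl)).const_mul
      (-(kappa P n).conjTranspose)
    refine ⟨_, ?_, (HasExpansion.fromBlocks h11 h12 h21 h22).congr' ?_⟩
    · have hμ : (kappa P n).conjTranspose * innerW a b W (P n) (Polynomial.X ^ n) = 1 :=
        mul_eq_one_comm.1 (hP.innerW_X_pow_self hW n)
      have h0 : innerW a b W (P (n + 1)) (Polynomial.X ^ n) = 0 :=
        hP.innerW_X_pow_of_lt hW (Nat.lt_succ_self n)
      have h1 : (P n).coeff (n + 1) = 0 :=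
        Polynomial.coeff_eq_zero_of_natDegree_lt (Nat.lt_succ_of_le (hP.natDegree_le n))
      have h2 : (P (n + 1)).coeff (n + 1) = kappa P (n + 1) := rfl
      simp [hμ, h0, h1, h2, hκ, Matrix.fromBlocks_one]
    · filter_upwards [eventually_atInfty_ne_zero a b] with z hz
      rw [solY_succ_eq hW P n hz.2, fromBlocks_mul_diagPow_neg]
      congr 1
      · rw [Matrix.mul_smul]
      · rw [Matrix.mul_smul, smul_comm]
      · rw [Matrix.mul_smul, smul_comm]
      · rw [Matrix.mul_smul]

theorem solvesRHP_solY (hab : a < b) (hW : IsMatrixWeight a b γ W)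
    {P : ℕ → Polynomial (Matrix (Fin N) (Fin N) ℂ)} (hP : IsOrthonormalSeq a b W P) (n : ℕ) :
    SolvesRHP a b γ W n (solY a b W P n) := by
  have hR := isMatPoly_transferR hW P n
  refine ⟨?_, ?_, ?_, ?_⟩
  · exact analyticOnNhd_mul (hR.analyticOnNhd _)
      (analyticOnNhd_fromBlocks_one (analyticOnNhd_cauchyW hW))
  · have h : ∀ x, x ∈ interval a b → ∃ Yp Ym : BlockMat N,
        Tendsto (solY a b W P n) (nhdsUpper x) (𝓝 Yp) ∧
        Tendsto (solY a b W P n) (nhdsLower x) (𝓝 Ym) ∧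
        Yp = Ym * Matrix.fromBlocks 1 (cW W x) 0 1 := by
      intro x hx
      obtain ⟨Cp, Cm, h1, h2, h3⟩ := hW.cauchyW_boundary hx
      refine ⟨transferR a b W P n x * Matrix.fromBlocks 1 Cp 0 1,
        transferR a b W P n x * Matrix.fromBlocks 1 Cm 0 1, ?_, ?_, ?_⟩
      · exact ((hR.continuous.tendsto _).mono_left nhdsWithin_le_nhds).mul
          (tendsto_fromBlocks_one h1)
      · exact ((hR.continuous.tendsto _).mono_left nhdsWithin_le_nhds).mul
          (tendsto_fromBlocks_one h2)
      · rw [mul_assoc, Matrix.fromBlocks_multiply, h3]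
        simp [add_comm]
    choose! Yp Ym h using h
    exact ⟨Yp, Ym, continuousOn_of_tendsto_nhdsUpper fun x hx => (h x hx).1,
      continuousOn_of_tendsto_nhdsLower fun x hx => (h x hx).2.1, h⟩
  · obtain ⟨c, hc, h⟩ := solY_hasExpansion hab hW hP n
    exact exists_infinity_of_hasExpansion h hc
  · intro c hc i j
    have hRO : ∀ k, (fun z => transferR a b W P n z i k) =O[atEndpoint a b c] fun _ => (1 : ℝ) :=
      fun k => hR.isBigO_one c nhdsWithin_le_nhds i k
    have h1h := one_isBigO_hfun hab hc (γ c)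
    constructor
    · simp only [solY, Matrix.mul_apply]
      refine IsBigO.fun_sum fun k _ => ?_
      have : (fun z => Y0 a b W z k (Sum.inl j)) =O[atEndpoint a b c] fun _ => (1 : ℝ) := by
        rcases k with k | k <;> simp only [Y0, Matrix.fromBlocks_apply₁₁, Matrix.fromBlocks_apply₂₁]
        · exact isBigO_const_const _ one_ne_zero _
        · exact isBigO_const_const _ one_ne_zero _
      simpa using (hRO k).mul this
    · simp only [solY, Matrix.mul_apply]
      refine IsBigO.fun_sum fun k _ => ?_
      have : (fun z => Y0 a b W z k (Sum.inr j)) =O[atEndpoint a b c] hfun (γ c) c := by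
        rcases k with k | k <;> simp only [Y0, Matrix.fromBlocks_apply₁₂, Matrix.fromBlocks_apply₂₂]
        · exact cauchyW_isBigO_hfun hab hW hc k j
        · exact (isBigO_const_const _ one_ne_zero _).trans h1h
      simpa using (hRO k).mul this

/-! ### Uniqueness for the Riemann–Hilbert problem -/

theorem IsMatPoly.exists_map {ι κ : Type*} {f : ℂ → Matrix ι κ ℂ} (hf : IsMatPoly f) :
    ∃ M : Matrix ι κ (Polynomial ℂ), ∀ z, f z = M.map (Polynomial.evalRingHom z) := by
  obtain ⟨p, hp⟩ := hf
  exact ⟨Matrix.of p, fun z => Matrix.ext fun i j => hp z i j⟩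

/-- Using the adjugate in place of the inverse keeps everything polynomial in `z`, with no division
to control. -/
theorem IsMatPoly.adjugate {ι : Type*} [Fintype ι] [DecidableEq ι] {f : ℂ → Matrix ι ι ℂ}
    (hf : IsMatPoly f) : IsMatPoly fun z => (f z).adjugate := by
  obtain ⟨M, hM⟩ := hf.exists_map
  refine ⟨M.adjugate, fun z i j => ?_⟩
  change (f z).adjugate i j = _
  rw [hM, ← RingHom.mapMatrix_apply, ← RingHom.map_adjugate]
  rfl

theorem IsMatPoly.differentiable_det {ι : Type*} [Fintype ι] [DecidableEq ι]
    {f : ℂ → Matrix ι ι ℂ} (hf : IsMatPoly f) : Differentiable ℂ fun z => (f z).det := by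
  obtain ⟨M, hM⟩ := hf.exists_map
  have h : (fun z => (f z).det) = fun z => M.det.eval z := by
    funext z
    rw [hM, ← RingHom.mapMatrix_apply, ← RingHom.map_det]
    rfl
  rw [h]
  exact M.det.differentiable

theorem tendsto_inv_atInfty (a b : EReal) : Tendsto (fun z : ℂ => z⁻¹) (atInfty a b) (𝓝 0) :=
  tendsto_inv₀_cobounded.mono_left inf_le_left

theorem tendsto_one_add_expansion {E : ℂ → BlockMat N} (A : BlockMat N)
    (hE : ∀ i j, (fun z => E z i j) =O[atInfty a b] fun z => (z ^ 2)⁻¹) :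
    Tendsto (fun z : ℂ => 1 + z⁻¹ • A + E z) (atInfty a b) (𝓝 1) := by
  have h0 := tendsto_inv_atInfty a b
  have h1 : Tendsto (fun z : ℂ => z⁻¹ • A) (atInfty a b) (𝓝 0) := by
    simpa using h0.smul_const A
  have h2 : Tendsto E (atInfty a b) (𝓝 0) := by
    refine tendsto_matrix_iff.2 fun i j => (hE i j).trans_tendsto ?_
    simpa using h0.pow 2
  simpa using (h1.const_add 1).add h2

theorem SolvesRHP.tendsto_mul_diagPow {n : ℕ} {Y : ℂ → BlockMat N} (h : SolvesRHP a b γ W n Y) :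
    Tendsto (fun z => Y z * diagPow (-(n : ℤ)) z) (atInfty a b) (𝓝 1) := by
  obtain ⟨A, hA⟩ := h.infinity
  obtain ⟨E, hE, hY⟩ := hA 1 le_rfl
  refine (tendsto_one_add_expansion (A 1) hE).congr' ?_
  filter_upwards [hY, eventually_atInfty_ne_zero a b] with z hz h0
  have h1 := diagPow_neg_mul_diagPow (N := N) (-(n : ℤ)) h0.1
  rw [neg_neg] at h1
  rw [hz, mul_assoc, h1, mul_one]
  simp

theorem det_diagPow (k : ℤ) {z : ℂ} (hz : z ≠ 0) : (diagPow k z : BlockMat N).det = 1 := by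
  rw [diagPow, Matrix.det_fromBlocks_zero₂₁, Matrix.det_smul, Matrix.det_smul]
  simp [mul_inv_cancel₀ (pow_ne_zero N (zpow_ne_zero k hz))]

theorem det_Y0 (z : ℂ) : (Y0 a b W z).det = 1 := by
  rw [Y0, Matrix.det_fromBlocks_zero₂₁]
  simp

theorem Y0_mul_dualY0 (z : ℂ) : Y0 a b W z * dualY0 a b W z = 1 := by
  rw [Y0, dualY0, Matrix.fromBlocks_multiply]
  simp [Matrix.fromBlocks_one]

theorem adjugate_eq_of_mul_eq_one {ι : Type*} [Fintype ι] [DecidableEq ι] {A B : Matrix ι ι ℂ}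
    (h : A * B = 1) (hA : A.det = 1) : A.adjugate = B := by
  rw [← mul_one A.adjugate, ← h, ← mul_assoc, Matrix.adjugate_mul, hA, one_smul, one_mul]

/-- `Y^0` and the diagonal factor have determinant one, so the polynomial `det R_n` tends to `1` at
infinity and Liouville applies. -/
theorem det_transferR (hab : a < b) (hW : IsMatrixWeight a b γ W)
    {P : ℕ → Polynomial (Matrix (Fin N) (Fin N) ℂ)} (hP : IsOrthonormalSeq a b W P) (n : ℕ)
    (z : ℂ) : (transferR a b W P n z).det = 1 := by
  refine eq_of_tendsto_atInfty (a := a) (b := b)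
    (isMatPoly_transferR hW P n).differentiable_det ?_ z
  have h := ((continuous_id.matrix_det.tendsto (1 : BlockMat N)).comp
    (solvesRHP_solY hab hW hP n).tendsto_mul_diagPow)
  simp only [id, Matrix.det_one] at h
  refine h.congr' ?_
  filter_upwards [eventually_atInfty_ne_zero a b] with z hz
  simp [solY, det_diagPow _ hz.1, det_Y0]

theorem det_solY (hab : a < b) (hW : IsMatrixWeight a b γ W)
    {P : ℕ → Polynomial (Matrix (Fin N) (Fin N) ℂ)} (hP : IsOrthonormalSeq a b W P) (n : ℕ)
    (z : ℂ) : (solY a b W P n z).det = 1 := by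
  rw [solY, Matrix.det_mul, det_transferR hab hW hP, det_Y0, one_mul]

theorem adjugate_solY (P : ℕ → Polynomial (Matrix (Fin N) (Fin N) ℂ)) (n : ℕ) (z : ℂ) :
    (solY a b W P n z).adjugate = dualY0 a b W z * (transferR a b W P n z).adjugate := by
  rw [solY, Matrix.adjugate_mul_distrib, adjugate_eq_of_mul_eq_one (Y0_mul_dualY0 z) (det_Y0 z)]

/-- The condition `γ > -1` is what makes the endpoint singularity weaker than a pole. -/
theorem tendsto_sub_mul_hfun {g : ℝ} (hg : -1 < g) (c : ℝ) :
    Tendsto (fun z : ℂ => ‖z - c‖ * hfun g c z) (𝓝[≠] (c : ℂ)) (𝓝 0) := by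
  have hd : Tendsto (fun z : ℂ => ‖z - c‖) (𝓝[≠] (c : ℂ)) (𝓝 0) := by
    have : Continuous fun z : ℂ => ‖z - c‖ := by fun_prop
    simpa using (this.tendsto (c : ℂ)).mono_left nhdsWithin_le_nhds
  rcases lt_trichotomy g 0 with h | h | h
  · have h1 := hd.rpow_const (p := 1 + g) (Or.inr (by linarith))
    rw [Real.zero_rpow (by linarith)] at h1
    refine h1.congr' ?_
    filter_upwards [self_mem_nhdsWithin] with z hz
    have : 0 < ‖z - c‖ := norm_pos_iff.2 (sub_ne_zero.2 hz)
    rw [hfun, if_pos h, Real.rpow_add this, Real.rpow_one]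
  · have h1 := (Real.continuous_mul_log.tendsto 0).comp hd
    simpa [hfun, h, Function.comp_def] using h1
  · simpa [hfun, h.not_gt, h.ne'] using hd

/-- Functions that are `O(h)` at a finite endpoint have removable or mild singularities there. -/
theorem tendsto_sub_mul_of_isBigO_hfun (hab : a < b) {c : ℝ} (hc : IsFiniteEndpoint a b c)
    {g : ℝ} (hg : -1 < g) {f : ℂ → ℂ} (hf : f =O[atEndpoint a b c] hfun g c) :
    Tendsto (fun z : ℂ => (z - c) * f z) (𝓝[(cut a b)ᶜ] (c : ℂ)) (𝓝 0) := by
  have hle : 𝓝[(cut a b)ᶜ] (c : ℂ) ≤ 𝓝[≠] (c : ℂ) :=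
    nhdsWithin_mono _ fun z hz h => hz (h ▸ coe_mem_cut hab hc)
  have h1 : (fun z : ℂ => (z - c) * f z) =O[𝓝[(cut a b)ᶜ] (c : ℂ)]
      fun z => ‖z - c‖ * hfun g c z :=
    (isBigO_norm_right.2 (isBigO_refl (fun z : ℂ => z - c) _)).mul hf
  exact h1.trans_tendsto ((tendsto_sub_mul_hfun hg c).mono_left hle)

/-- Only the bounded first column of `Y` is multiplied by the Cauchy transform, so no product `h ·
h` arises. -/
theorem SolvesRHP.mul_dualY0_isBigO (hab : a < b) (hW : IsMatrixWeight a b γ W) {n : ℕ}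
    {Y : ℂ → BlockMat N} (h : SolvesRHP a b γ W n Y) {c : ℝ} (hc : IsFiniteEndpoint a b c)
    (i j : Fin N ⊕ Fin N) :
    (fun z => (Y z * dualY0 a b W z) i j) =O[atEndpoint a b c] hfun (γ c) c := by
  have h1h := one_isBigO_hfun hab hc (γ c)
  simp only [Matrix.mul_apply, Fintype.sum_sum_type, dualY0]
  rcases j with j | j
  · simp only [Matrix.fromBlocks_apply₁₁, Matrix.fromBlocks_apply₂₁, Matrix.one_apply,
      Matrix.zero_apply, mul_zero, Finset.sum_const_zero, add_zero, mul_ite, mul_one,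
      Finset.sum_ite_eq', Finset.mem_univ, if_true]
    exact (h.endpoint c hc i j).1.trans h1h
  · simp only [Matrix.fromBlocks_apply₁₂, Matrix.fromBlocks_apply₂₂, Matrix.one_apply,
      Matrix.neg_apply, mul_ite, mul_zero, mul_one, Finset.sum_ite_eq', Finset.mem_univ, if_true]
    refine IsBigO.add (IsBigO.fun_sum fun k _ => ?_) (h.endpoint c hc i j).2
    simpa using (h.endpoint c hc i k).1.mul (cauchyW_isBigO_hfun hab hW hc k j).neg_left

/-- By Plemelj, `y^0 = (Y^0)⁻¹` undoes the jump of `Y`: the limits from the two half planes agree.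
-/
theorem SolvesRHP.exists_tendsto_mul_dualY0 (hW : IsMatrixWeight a b γ W) {n : ℕ}
    {Y : ℂ → BlockMat N} (h : SolvesRHP a b γ W n Y) {x : ℝ} (hx : x ∈ interval a b) :
    ∃ l, Tendsto (fun z => Y z * dualY0 a b W z) (𝓝[(cut a b)ᶜ] (x : ℂ)) (𝓝 l) := by
  obtain ⟨Yp, Ym, -, -, hY⟩ := h.jump
  obtain ⟨hp, hm, hpm⟩ := hY x hx
  obtain ⟨Cp, Cm, h1, h2, h3⟩ := hW.cauchyW_boundary hx
  have hpl := hp.mul (tendsto_fromBlocks_one h1.neg)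
  have hml := hm.mul (tendsto_fromBlocks_one h2.neg)
  refine ⟨Ym x * Matrix.fromBlocks 1 (-Cm) 0 1,
    (Tendsto.sup ?_ hml).mono_left (nhdsWithin_compl_cut_le hx)⟩
  convert hpl using 2
  rw [hpm, mul_assoc, Matrix.fromBlocks_multiply, h3]
  simp

theorem SolvesRHP.eqOn_solY (hab : a < b) (hW : IsMatrixWeight a b γ W)
    {P : ℕ → Polynomial (Matrix (Fin N) (Fin N) ℂ)} (hP : IsOrthonormalSeq a b W P) {n : ℕ}
    {Y : ℂ → BlockMat N} (h : SolvesRHP a b γ W n Y) :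
    Set.EqOn Y (solY a b W P n) (cut a b)ᶜ := by
  have hR := (isMatPoly_transferR hW P n).adjugate
  have hT : ∀ z, Y z * (solY a b W P n z).adjugate =
      Y z * dualY0 a b W z * (transferR a b W P n z).adjugate := fun z => by
    rw [adjugate_solY, mul_assoc]
  -- The two diagonal factors, one from each solution, meet in the middle of the product and cancel.
  have hlim : Tendsto (fun z => Y z * (solY a b W P n z).adjugate) (atInfty a b) (𝓝 1) := by
    have h1 := (solvesRHP_solY hab hW hP n).tendsto_mul_diagPow
    have h2 := h.tendsto_mul_diagPow.mul
      ((continuous_id.matrix_adjugate.tendsto (1 : BlockMat N)).comp h1)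
    simp only [id, Matrix.adjugate_one, mul_one] at h2
    refine h2.congr' ?_
    filter_upwards [eventually_atInfty_ne_zero a b] with z hz
    have h3 := diagPow_neg_mul_diagPow (N := N) n hz.1
    rw [Function.comp_apply, Matrix.adjugate_mul_distrib,
      adjugate_eq_of_mul_eq_one h3 (det_diagPow _ hz.1), mul_assoc, ← mul_assoc (diagPow _ z), h3,
      one_mul]
  have hone : ∀ z ∈ (cut a b)ᶜ, Y z * (solY a b W P n z).adjugate = 1 := by
    intro z hz
    ext i j
    obtain ⟨g, hg, hgT⟩ : ∃ g : ℂ → ℂ, Differentiable ℂ g ∧ Set.EqOn g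
        (fun z => (Y z * (solY a b W P n z).adjugate) i j) (cut a b)ᶜ := by
      refine exists_entire_extension hab ?_ ?_ ?_
      · simp only [hT]
        refine analyticOnNhd_mul (analyticOnNhd_mul h.analytic
          (analyticOnNhd_fromBlocks_one fun i j => ?_)) (hR.analyticOnNhd _) i j
        exact (analyticOnNhd_cauchyW hW i j).neg
      · intro x hx
        obtain ⟨l, hl⟩ := h.exists_tendsto_mul_dualY0 hW hx
        simp only [hT]
        exact ⟨_, tendsto_matrix_iff.1
          (hl.mul ((hR.continuous.tendsto _).mono_left nhdsWithin_le_nhds)) i j⟩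
      · intro c hc
        refine tendsto_sub_mul_of_isBigO_hfun hab hc (hW.endpoint c hc).1 ?_
        simp only [hT, Matrix.mul_apply (M := Y _ * dualY0 a b W _)]
        refine IsBigO.fun_sum fun k _ => ?_
        simpa using (h.mul_dualY0_isBigO hab hW hc i k).mul
          (hR.isBigO_one c nhdsWithin_le_nhds k j)
    refine (hgT hz).symm.trans ?_
    refine eq_of_tendsto_atInfty (a := a) (b := b) hg ?_ z
    refine (tendsto_matrix_iff.1 hlim i j).congr' ?_
    filter_upwards [eventually_atInfty_ne_zero a b] with z hz
    exact (hgT hz.2).symm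
  intro z hz
  have h1 := det_solY hab hW hP n z
  rw [← mul_one (Y z), ← one_smul ℂ (1 : BlockMat N), ← h1, ← Matrix.adjugate_mul, ← mul_assoc,
    hone z hz, one_mul]

/-! ### The duality `A ↦ J Aᵀ J⁻¹` -/

theorem dualTranspose_fromBlocks (A B C D : Matrix (Fin N) (Fin N) ℂ) :
    dualTranspose (Matrix.fromBlocks A B C D) =
      Matrix.fromBlocks D.transpose (-B.transpose) (-C.transpose) A.transpose := by
  simp [dualTranspose, Matrix.fromBlocks_transpose, Matrix.fromBlocks_multiply]

theorem dualTranspose_apply (A : BlockMat N) (i j : Fin N ⊕ Fin N) :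
    dualTranspose A i j = (if i.isLeft = j.isLeft then 1 else -1) * A j.swap i.swap := by
  rw [← Matrix.fromBlocks_toBlocks A, dualTranspose_fromBlocks]
  rcases i with i | i <;> rcases j with j | j <;> simp

theorem dualTranspose_mul (A B : BlockMat N) :
    dualTranspose (A * B) = dualTranspose B * dualTranspose A := by
  have h : (Matrix.fromBlocks 0 1 (-1) 0 * Matrix.fromBlocks 0 (-1) 1 0 : BlockMat N) = 1 := by
    simp [Matrix.fromBlocks_multiply, Matrix.fromBlocks_one]
  simp only [dualTranspose, Matrix.transpose_mul, mul_assoc]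
  rw [← mul_assoc (Matrix.fromBlocks 0 1 (-1) 0) (Matrix.fromBlocks 0 (-1) 1 0), h, one_mul]

theorem dualTranspose_dualTranspose (A : BlockMat N) : dualTranspose (dualTranspose A) = A := by
  rw [← Matrix.fromBlocks_toBlocks A, dualTranspose_fromBlocks, dualTranspose_fromBlocks]
  simp

theorem dualTranspose_add (A B : BlockMat N) :
    dualTranspose (A + B) = dualTranspose A + dualTranspose B := by
  simp [dualTranspose, mul_add, add_mul]

theorem dualTranspose_smul (c : ℂ) (A : BlockMat N) :
    dualTranspose (c • A) = c • dualTranspose A := by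
  simp [dualTranspose]

theorem dualTranspose_sum {ι : Type*} (s : Finset ι) (A : ι → BlockMat N) :
    dualTranspose (∑ k ∈ s, A k) = ∑ k ∈ s, dualTranspose (A k) := by
  simp [dualTranspose, Matrix.transpose_sum, Finset.mul_sum, Finset.sum_mul]

theorem dualTranspose_one : dualTranspose (1 : BlockMat N) = 1 := by
  rw [← Matrix.fromBlocks_one, dualTranspose_fromBlocks]
  simp

theorem dualTranspose_diagPow (k : ℤ) (z : ℂ) :
    dualTranspose (diagPow k z : BlockMat N) = diagPow (-k) z := by
  rw [diagPow, dualTranspose_fromBlocks, diagPow]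
  simp

theorem continuous_dualTranspose : Continuous (dualTranspose : BlockMat N → BlockMat N) :=
  (continuous_const.mul continuous_id.matrix_transpose).mul continuous_const

theorem cW_transpose (hW : IsMatrixWeight a b γ W) {x : ℝ} (hx : x ∈ interval a b) :
    (cW W x).transpose = cW W x := by
  have h := (hW.posDef x hx).isHermitian
  rw [Matrix.IsHermitian, Matrix.conjTranspose_eq_transpose_of_trivial] at h
  rw [cW, ← Matrix.transpose_map, h]

theorem dualTranspose_jump (hW : IsMatrixWeight a b γ W) {x : ℝ} (hx : x ∈ interval a b) :
    dualTranspose (Matrix.fromBlocks 1 (cW W x) 0 1) = Matrix.fromBlocks 1 (-cW W x) 0 1 := by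
  simp [dualTranspose_fromBlocks, cW_transpose hW hx]

/-- The map reverses products, so a right jump becomes a left one; it inverts `diag(z^n, z^{-n})`
and sends the second block column to the first block row, which matches the endpoint conditions.
Symmetry of `W` gives the correct jump matrix. -/
theorem SolvesRHP.dualTranspose (hW : IsMatrixWeight a b γ W) {n : ℕ} {Y : ℂ → BlockMat N}
    (h : SolvesRHP a b γ W n Y) : SolvesDualRHP a b γ W n fun z => dualTranspose (Y z) := by
  refine ⟨fun i j => ?_, ?_, ?_, fun c hc i j => ⟨?_, ?_⟩⟩
  · simp only [dualTranspose_apply]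
    exact analyticOnNhd_const.mul (h.analytic _ _)
  · obtain ⟨Yp, Ym, hp, hm, hY⟩ := h.jump
    refine ⟨_, _, continuous_dualTranspose.comp_continuousOn hp,
      continuous_dualTranspose.comp_continuousOn hm, fun x hx => ?_⟩
    obtain ⟨h1, h2, h3⟩ := hY x hx
    refine ⟨(continuous_dualTranspose.tendsto _).comp h1,
      (continuous_dualTranspose.tendsto _).comp h2, ?_⟩
    rw [Function.comp_apply, h3, dualTranspose_mul, dualTranspose_jump hW hx]
    rfl
  · obtain ⟨A, hA⟩ := h.infinity
    refine ⟨fun k => MOPRL.dualTranspose (A k), fun m hm => ?_⟩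
    obtain ⟨E, hE, hY⟩ := hA m hm
    refine ⟨fun z => MOPRL.dualTranspose (E z), fun i j => ?_, hY.mono fun z hz => ?_⟩
    · simp only [dualTranspose_apply]
      exact (hE _ _).const_mul_left _
    · simp only [hz, dualTranspose_mul, dualTranspose_diagPow, dualTranspose_add,
        dualTranspose_sum, dualTranspose_smul, dualTranspose_one]
  · simp only [dualTranspose_apply]
    exact (h.endpoint c hc _ _).2.const_mul_left _
  · simp only [dualTranspose_apply]
    exact (h.endpoint c hc _ _).1.const_mul_left _

theorem SolvesDualRHP.dualTranspose (hW : IsMatrixWeight a b γ W) {n : ℕ} {y : ℂ → BlockMat N}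
    (h : SolvesDualRHP a b γ W n y) : SolvesRHP a b γ W n fun z => dualTranspose (y z) := by
  refine ⟨fun i j => ?_, ?_, ?_, fun c hc i j => ⟨?_, ?_⟩⟩
  · simp only [dualTranspose_apply]
    exact analyticOnNhd_const.mul (h.analytic _ _)
  · obtain ⟨Yp, Ym, hp, hm, hY⟩ := h.jump
    refine ⟨_, _, continuous_dualTranspose.comp_continuousOn hp,
      continuous_dualTranspose.comp_continuousOn hm, fun x hx => ?_⟩
    obtain ⟨h1, h2, h3⟩ := hY x hx
    refine ⟨(continuous_dualTranspose.tendsto _).comp h1,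
      (continuous_dualTranspose.tendsto _).comp h2, ?_⟩
    rw [Function.comp_apply, h3, dualTranspose_mul, ← dualTranspose_jump hW hx,
      dualTranspose_dualTranspose]
    rfl
  · obtain ⟨A, hA⟩ := h.infinity
    refine ⟨fun k => MOPRL.dualTranspose (A k), fun m hm => ?_⟩
    obtain ⟨E, hE, hY⟩ := hA m hm
    refine ⟨fun z => MOPRL.dualTranspose (E z), fun i j => ?_, hY.mono fun z hz => ?_⟩
    · simp only [dualTranspose_apply]
      exact (hE _ _).const_mul_left _
    · simp only [hz, dualTranspose_mul, dualTranspose_diagPow, dualTranspose_add, neg_neg,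
        dualTranspose_sum, dualTranspose_smul, dualTranspose_one]
  · simp only [dualTranspose_apply]
    exact (h.endpoint c hc _ _).2.const_mul_left _
  · simp only [dualTranspose_apply]
    exact (h.endpoint c hc _ _).1.const_mul_left _

/-! ### Conjugate polynomials and the dual transfer matrix -/

/-- The sequence of polynomials with complex conjugate coefficients. -/
noncomputable def conjSeq (P : ℕ → Polynomial (Matrix (Fin N) (Fin N) ℂ)) (n : ℕ) :
    Polynomial (Matrix (Fin N) (Fin N) ℂ) := (P n).map (starRingEnd ℂ).mapMatrix

theorem pval_conjSeq (P : ℕ → Polynomial (Matrix (Fin N) (Fin N) ℂ)) (n : ℕ) (z : ℂ) :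
    pval (conjSeq P n) z = (pval (P n) (starRingEnd ℂ z)).map (starRingEnd ℂ) := by
  have h := Polynomial.eval_map_apply (p := P n) (f := (starRingEnd ℂ).mapMatrix)
    (Matrix.scalar (Fin N) (starRingEnd ℂ z))
  rw [RingHom.mapMatrix_apply, RingHom.mapMatrix_apply] at h
  rw [pval, pval, ← h, conjSeq]
  congr 1
  simp [Matrix.scalar_apply, Matrix.diagonal_map]

theorem matInt_map_conj (F : ℝ → Matrix (Fin N) (Fin N) ℂ) :
    matInt a b (fun t => (F t).map (starRingEnd ℂ)) = (matInt a b F).map (starRingEnd ℂ) := by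
  ext i j
  exact integral_conj

theorem cW_map_conj (x : ℝ) : (cW W x).map (starRingEnd ℂ) = cW W x := by
  ext i j
  simp [cW]

theorem innerW_conjSeq (P : ℕ → Polynomial (Matrix (Fin N) (Fin N) ℂ)) (n m : ℕ) :
    innerW a b W (conjSeq P n) (conjSeq P m) =
      (innerW a b W (P n) (P m)).map (starRingEnd ℂ) := by
  rw [innerW, innerW, ← matInt_map_conj]
  congr 1
  funext x
  rw [Matrix.map_mul, Matrix.map_mul, cW_map_conj, pval_conjSeq, pval_conjSeq, Complex.conj_ofReal]
  rfl

/-- Since `W` and the integration variable are real, conjugating coefficients conjugates the inner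
products, and `0` and `1` are real. -/
theorem IsOrthonormalSeq.conjSeq {P : ℕ → Polynomial (Matrix (Fin N) (Fin N) ℂ)}
    (hP : IsOrthonormalSeq a b W P) : IsOrthonormalSeq a b W (conjSeq P) where
  natDegree_le n := Polynomial.natDegree_map_le.trans (hP.natDegree_le n)
  isUnit_lead n := by
    rw [MOPRL.conjSeq, Polynomial.coeff_map]
    exact (hP.isUnit_lead n).map _
  orthonormal n m := by
    rw [innerW_conjSeq, hP.orthonormal]
    split_ifs
    · exact Matrix.map_one _ (map_zero _) (map_one _)
    · exact Matrix.map_zero _ (map_zero _)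

theorem kappa_conjSeq (P : ℕ → Polynomial (Matrix (Fin N) (Fin N) ℂ)) (n : ℕ) :
    kappa (conjSeq P) n = (kappa P n).map (starRingEnd ℂ) := by
  rw [kappa, conjSeq, Polynomial.coeff_map]
  rfl

theorem secondKind_conjSeq (P : ℕ → Polynomial (Matrix (Fin N) (Fin N) ℂ)) (n : ℕ) (z : ℂ) :
    secondKind a b W (conjSeq P) n z =
      (secondKind a b W P n (starRingEnd ℂ z)).map (starRingEnd ℂ) := by
  rw [secondKind, secondKind, ← matInt_map_conj]
  congr 1
  funext t
  rw [Matrix.map_mul, cW_map_conj, pval_conjSeq, pval_conjSeq, Complex.conj_ofReal]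
  congr 1
  ext i j
  simp

/-- `F^*(z)` is the transpose of the function with conjugated coefficients evaluated at `z` itself.
Transposition is part of the duality, so the conjugation is absorbed into the sequence of
polynomials. -/
theorem transferDual_eq (P : ℕ → Polynomial (Matrix (Fin N) (Fin N) ℂ)) (n : ℕ) (z : ℂ) :
    transferDual a b W P n z = dualTranspose (transferR a b W (conjSeq P) n z) := by
  cases n with
  | zero => exact dualTranspose_one.symm
  | succ n =>
    have hk : ((kappa P n).map (starRingEnd ℂ)).conjTranspose.transpose = kappa P n := by
      ext i j
      simp
    rw [transferDual, transferR, dualTranspose_fromBlocks]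
    simp only [Matrix.transpose_neg, Matrix.transpose_mul, Matrix.transpose_smul,
      Matrix.transpose_nonsing_inv, kappa_conjSeq, secondKind_conjSeq, pval_conjSeq,
      hk, neg_neg, starFun]
    rfl

theorem cauchyW_transpose (hW : IsMatrixWeight a b γ W) (z : ℂ) :
    (cauchyW a b W z).transpose = cauchyW a b W z := by
  ext i j
  rw [Matrix.transpose_apply, cauchyW_apply, cauchyW_apply, funext (wEntry_comm hW i j)]

theorem dualY0_eq (hW : IsMatrixWeight a b γ W) (z : ℂ) :
    dualY0 a b W z = dualTranspose (Y0 a b W z) := by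
  rw [dualY0, Y0, dualTranspose_fromBlocks, cauchyW_transpose hW]
  simp

theorem solDual_eq (hW : IsMatrixWeight a b γ W)
    (P : ℕ → Polynomial (Matrix (Fin N) (Fin N) ℂ)) (n : ℕ) (z : ℂ) :
    solDual a b W P n z = dualTranspose (solY a b W (conjSeq P) n z) := by
  rw [solDual, transferDual_eq, dualY0_eq hW, solY, dualTranspose_mul]

theorem solY_mul_solDual_eq (P : ℕ → Polynomial (Matrix (Fin N) (Fin N) ℂ)) (n : ℕ) (z : ℂ) :
    solY a b W P n z * solDual a b W P n z = transferR a b W P n z * transferDual a b W P n z := by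
  rw [solY, solDual, mul_assoc, ← mul_assoc (Y0 a b W z), Y0_mul_dualY0, one_mul]

section duality

variable (hab : a < b) (hW : IsMatrixWeight a b γ W)
  {P : ℕ → Polynomial (Matrix (Fin N) (Fin N) ℂ)} (hP : IsOrthonormalSeq a b W P) (n : ℕ)
include hab hW hP

/-- Orthonormal sequences are not unique, but the solution of the problem is: the conjugate sequence
gives the same `Y^n`, and the conjugation disappears. -/
theorem solDual_eq_dualTranspose_solY {z : ℂ} (hz : z ∈ (cut a b)ᶜ) :
    solDual a b W P n z = dualTranspose (solY a b W P n z) := by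
  rw [solDual_eq hW, (solvesRHP_solY hab hW hP.conjSeq n).eqOn_solY hab hW hP hz]

theorem solvesDualRHP_solDual : SolvesDualRHP a b γ W n (solDual a b W P n) := by
  have h : solDual a b W P n = _ := funext fun z => solDual_eq hW P n z
  rw [h]
  exact (solvesRHP_solY hab hW hP.conjSeq n).dualTranspose hW

theorem SolvesDualRHP.eqOn_solDual {n : ℕ} {y : ℂ → BlockMat N} (h : SolvesDualRHP a b γ W n y) :
    Set.EqOn y (solDual a b W P n) (cut a b)ᶜ := by
  intro z hz
  rw [solDual_eq_dualTranspose_solY hab hW hP n hz, ← (h.dualTranspose hW).eqOn_solY hab hW hP hz,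
    dualTranspose_dualTranspose]

/-- Since `Y^0 y^0 = 1` whatever value the Cauchy transform takes, the product is the polynomial
`R_n r_n`. The duality, known off the cut, shows that it tends to the identity, so Liouville gives
the equality even on the cut. -/
theorem solY_mul_solDual (z : ℂ) : solY a b W P n z * solDual a b W P n z = 1 := by
  rw [solY_mul_solDual_eq]
  have hpoly := (isMatPoly_transferR hW P n).mul (isMatPoly_transferDual hW P n)
  have h1 := (solvesRHP_solY hab hW hP n).tendsto_mul_diagPow
  have h2 := h1.mul ((continuous_dualTranspose.tendsto 1).comp h1)
  rw [dualTranspose_one, mul_one] at h2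
  ext i j
  refine eq_of_tendsto_atInfty (a := a) (b := b) (hpoly.differentiable i j) ?_ z
  refine (tendsto_matrix_iff.1 h2 i j).congr' ?_
  filter_upwards [eventually_atInfty_ne_zero a b] with z hz
  rw [← solY_mul_solDual_eq, solDual_eq_dualTranspose_solY hab hW hP n hz.2,
    Function.comp_apply, dualTranspose_mul, dualTranspose_diagPow, neg_neg, mul_assoc,
    ← mul_assoc (diagPow _ z), diagPow_neg_mul_diagPow _ hz.1, one_mul]

theorem boundary_identities {x : ℝ} {l : Filter ℂ} (hl : l = nhdsUpper x ∨ l = nhdsLower x)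
    {A B : BlockMat N} (hA : Tendsto (solY a b W P n) l (𝓝 A))
    (hB : Tendsto (solDual a b W P n) l (𝓝 B)) :
    B = dualTranspose A ∧ B = A⁻¹ ∧ A.det = 1 := by
  have hne : l.NeBot := by rcases hl with rfl | rfl <;> infer_instance
  have hle : l ≤ 𝓝[(cut a b)ᶜ] (x : ℂ) := by
    rcases hl with rfl | rfl
    · exact nhdsUpper_le a b x
    · exact nhdsLower_le a b x
  have hT2 : T2Space (BlockMat N) :=
    inferInstanceAs (T2Space (Fin N ⊕ Fin N → Fin N ⊕ Fin N → ℂ))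
  have hmem : ∀ᶠ z in l, z ∈ (cut a b)ᶜ := hle self_mem_nhdsWithin
  refine ⟨?_, ?_, ?_⟩
  · refine tendsto_nhds_unique hB (((continuous_dualTranspose.tendsto A).comp hA).congr' ?_)
    exact hmem.mono fun z hz => (solDual_eq_dualTranspose_solY hab hW hP n hz).symm
  · refine (Matrix.inv_eq_right_inv ?_).symm
    refine tendsto_nhds_unique (hA.mul hB) ?_
    simp only [solY_mul_solDual hab hW hP n]
    exact tendsto_const_nhds
  · refine tendsto_nhds_unique ((continuous_id.matrix_det.tendsto A).comp hA) ?_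
    simp only [Function.comp_def, id, det_solY hab hW hP n]
    exact tendsto_const_nhds

end duality

end MOPRL

theorem mainTheorem1 (N : ℕ) (a b : EReal) (hab : a < b) (γ : ℝ → ℝ)
    (W : ℝ → Matrix (Fin N) (Fin N) ℝ) (hW : MOPRL.IsMatrixWeight a b γ W) :
    (∃ P : ℕ → Polynomial (Matrix (Fin N) (Fin N) ℂ), MOPRL.IsOrthonormalSeq a b W P) ∧
    ∀ P : ℕ → Polynomial (Matrix (Fin N) (Fin N) ℂ), MOPRL.IsOrthonormalSeq a b W P →
    ∀ n : ℕ,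
      (∃ S : Polynomial (MOPRL.BlockMat N), ∀ z : ℂ,
        MOPRL.transferR a b W P n z = MOPRL.pval S z) ∧
      (∃ S : Polynomial (MOPRL.BlockMat N), ∀ z : ℂ,
        MOPRL.transferDual a b W P n z = MOPRL.pval S z) ∧
      MOPRL.SolvesRHP a b γ W n (MOPRL.solY a b W P n) ∧
      (∀ Y : ℂ → MOPRL.BlockMat N, MOPRL.SolvesRHP a b γ W n Y →
        Set.EqOn Y (MOPRL.solY a b W P n) (MOPRL.cut a b)ᶜ) ∧
      MOPRL.SolvesDualRHP a b γ W n (MOPRL.solDual a b W P n) ∧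
      (∀ y : ℂ → MOPRL.BlockMat N, MOPRL.SolvesDualRHP a b γ W n y →
        Set.EqOn y (MOPRL.solDual a b W P n) (MOPRL.cut a b)ᶜ) ∧
      (∀ z ∈ (MOPRL.cut a b)ᶜ,
        MOPRL.solDual a b W P n z = MOPRL.dualTranspose (MOPRL.solY a b W P n z) ∧
        MOPRL.solDual a b W P n z = (MOPRL.solY a b W P n z)⁻¹ ∧
        (MOPRL.solY a b W P n z).det = 1) ∧
      (∀ x ∈ MOPRL.interval a b, ∀ l : Filter ℂ,
        l = MOPRL.nhdsUpper x ∨ l = MOPRL.nhdsLower x → ∀ A B : MOPRL.BlockMat N,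
        Tendsto (MOPRL.solY a b W P n) l (𝓝 A) → Tendsto (MOPRL.solDual a b W P n) l (𝓝 B) →
        B = MOPRL.dualTranspose A ∧ B = A⁻¹ ∧ A.det = 1) := by
  refine ⟨MOPRL.exists_isOrthonormalSeq hab hW, fun P hP n => ⟨
    (MOPRL.isMatPoly_transferR hW P n).exists_polynomial,
    (MOPRL.isMatPoly_transferDual hW P n).exists_polynomial,
    MOPRL.solvesRHP_solY hab hW hP n, fun Y hY => hY.eqOn_solY hab hW hP,
    MOPRL.solvesDualRHP_solDual hab hW hP n, fun y hy => hy.eqOn_solDual hab hW hP,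
    fun z hz => ?_, fun x _ l hl A B hA hB => MOPRL.boundary_identities hab hW hP n hl hA hB⟩⟩
  exact ⟨MOPRL.solDual_eq_dualTranspose_solY hab hW hP n hz,
    (Matrix.inv_eq_right_inv (MOPRL.solY_mul_solDual hab hW hP n z)).symm,
    MOPRL.det_solY hab hW hP n z⟩
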